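/- For $\omega\in S^2\subset\mathbb R^3$ write $x=r\omega+y$ with $r\in\mathbb R$ and $y\in\omega^\perp=\{y\in\mathbb R^3: y\cdot\omega=0\}$, and for a measurable $F:\mathbb R\times\mathbb R^3\to\mathbb C$ and $1\le p,q\le\infty$ let $$\|F\|_{L^q_tL^p_{\omega}L^2_{\omega^\perp}}=\Big\|\,\Big\|\,\|F(t,r\omega+y)\|_{L^2_y(\omega^\perp)}\Big\|_{L^p_r(\mathbb R)}\Big\|_{L^q_t(\mathbb R)} ,$$ where $\omega^\perp$ carries its two-dimensional Lebesgue measure. There is an absolute constant $C$ such that, for all directions $\omega_1,\omega_2\in S^2$ and every $F\in L^{4/3}_tL^1_{\omega_1}L^2_{\omega_1^\perp}$, the retarded Duhamel integral $$u(t)=\int_{s<t}e^{-i(t-s)\Delta}F(s)\,ds,\qquad t\in\mathbb R,$$ is, for almost every $t$, well defined as a weak integral of tempered distributions on $\mathbb R^3$ and given by a function, $u$ belongs to $L^4_tL^\infty_{\omega_2}L^2_{\omega_2^\perp}$, and $$\Big\|\int_{s<t}e^{-i(t-s)\Delta}F(s)\,ds\Big\|_{L^4_tL^\infty_{\omega_2}L^2_{\omega_2^\perp}}\le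 C\,\|F\|_{L^{4/3}_tL^1_{\omega_1}L^2_{\omega_1^\perp}} .$$ Here $e^{-i\tau\Delta}$ is the Fourier multiplier on $\mathbb R^3$ with symbol $e^{i\tau|\xi|^2}$ (for the convention $\hat f(\xi)=\int f(x)e^{-ix\cdot\xi}\,dx$), acting on tempered distributions by $\langle e^{-i\tau\Delta}f,\varphi\rangle=\langle f,e^{-i\tau\Delta}\varphi\rangle$, and the weak integral means that for every Schwartz function $\varphi$ $$\int_{\mathbb R^3}u(t,x)\varphi(x)\,dx=\int_{s<t}\Big(\int_{\mathbb R^3}F(s,x)\,(e^{-i(t-s)\Delta}\varphi)(x)\,dx\Big)ds,$$ where the integral over $x$ on the left converges absolutely and, on the right, the integral over $x$ converges absolutely for almost every $s<t$ and the integral over $s$ converges absolutely. -/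

import Mathlib

open MeasureTheory Metric
open scoped ENNReal NNReal SchwartzMap FourierTransform

/-- Three-dimensional Euclidean space. -/
abbrev R3 : Type := EuclideanSpace ℝ (Fin 3)

/-- The mixed norm `‖F‖` in `L^q_t L^p_ω L^2_{ω^⊥}` of `F : ℝ × ℝ³ → ℂ`, where `x = r ω + y` with
`r ∈ ℝ` and `y` in the plane `ω^⊥`, which carries its two-dimensional Lebesgue measure:
the `L^2` norm in `y` is taken first, then the `L^p` norm in `r`, then the `L^q` norm in `t`. -/
noncomputable def directionalNorm (q p : ℝ≥0∞) (ω : sphere (0 : R3) 1) (F : ℝ → R3 → ℂ) : ℝ≥0∞ :=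
  eLpNorm (fun t : ℝ =>
    eLpNorm (fun r : ℝ =>
      eLpNorm (fun y : (Submodule.span ℝ {(ω : R3)})ᗮ => F t (r • (ω : R3) + (y : R3)))
        2 volume) p volume) q volume

/-- Membership in `L^q_t L^p_ω L^2_{ω^⊥}`: joint measurability and finiteness of the norm. -/
def MemDirectional (q p : ℝ≥0∞) (ω : sphere (0 : R3) 1) (F : ℝ → R3 → ℂ) : Prop :=
  AEStronglyMeasurable (Function.uncurry F) (volume : Measure (ℝ × R3)) ∧
    directionalNorm q p ω F < ∞

/-- The free Schrödinger evolution `e^{-itΔ} φ` of a Schwartz function. With Mathlib's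
normalization of the Fourier transform, `Δ` is the multiplier `-(2π|ξ|)²`, so that `e^{-itΔ}` is
the multiplier `e^{it(2π|ξ|)²}`. -/
noncomputable def freeSchrodinger (t : ℝ) (φ : 𝓢(R3, ℂ)) : R3 → ℂ :=
  𝓕⁻ (fun ξ : R3 =>
    Complex.exp (Complex.I * ((t * (2 * Real.pi * ‖ξ‖) ^ 2 : ℝ) : ℂ)) * 𝓕 (φ : R3 → ℂ) ξ)

/-- `u(t) = ∫_{s < t} e^{-i(t-s)Δ} F(s) ds` for almost every `t`, as a weak integral of tempered
distributions. Here `e^{-iτΔ}` acts on a tempered distribution `f` by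
`⟨e^{-iτΔ} f, φ⟩ = ⟨f, e^{-iτΔ} φ⟩`, with the bilinear pairing `⟨f, φ⟩ = ∫ f φ dx`. All the
integrals are required to converge absolutely. This determines `u` up to a null set. -/
def IsRetardedDuhamel (F u : ℝ → R3 → ℂ) : Prop :=
  ∀ᵐ t : ℝ, ∀ φ : 𝓢(R3, ℂ),
    (∀ᵐ s : ℝ, s < t → Integrable (fun x : R3 => F s x * freeSchrodinger (t - s) φ x)) ∧
    IntegrableOn (fun s : ℝ => ∫ x : R3, F s x * freeSchrodinger (t - s) φ x) (Set.Iio t) ∧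
    Integrable (fun x : R3 => u t x * φ x) ∧
    ∫ x : R3, u t x * φ x =
      ∫ s in Set.Iio t, ∫ x : R3, F s x * freeSchrodinger (t - s) φ x

/-!
The estimate is a retarded Strichartz inequality in which the two sides are measured in norms
adapted to different directions. When `ω₁` and `ω₂` are orthogonal, the evolution
`e^{-i(t-s)Δ}` at a fixed time difference does not map `L^1_{ω₁} L^2_{ω₁^⊥}` to
`L^∞_{ω₂} L^2_{ω₂^⊥}`, so that there is no dispersive estimate to integrate. What is available is,
for each direction separately, an estimate of the unrestricted time integral in `L^2`; the estimates
for two directions are composed first, and the restriction `s < t` is imposed afterwards.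

*One direction.* Let `profile F s = (e^{isΔ} F(s))^` be the Fourier transform of the source brought
back to time `0`. On a line of frequencies `ρ ω + η`, `ρ ∈ ℝ`, the integral of `profile F s` over
`s` is the one-dimensional extension operator of a function of `(s, r)`. Its `L^2` norm in `ρ`,
computed with a Gaussian regularization, is a double integral against a kernel of size
`|s - s'|^{-1/2}`, uniformly in the regularization (`enorm_integral_gaussian_oscillatory_le`,
`lintegral_enorm_sq_extension_le`). Integrating in `η`, Plancherel's theorem on `ω^⊥` produces the
norm `L^1_ω L^2_{ω^⊥}` in space, and the Hardy–Littlewood–Sobolev inequality in time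
(`hardyLittlewoodSobolev`) gives the dual Strichartz estimate
`‖∫ profile F s ds‖_{L^2} ≤ C ‖F‖_{L^{4/3}_t L^1_ω L^2_{ω^⊥}}`
(`lintegral_enorm_sq_integral_profile_le`).

*Two directions.* Paired with a test function `G`, the Duhamel integral is
`∬_{s < t} ⟨profile G t, profile F s⟩ ds dt`. Over a product of time intervals, the
Cauchy–Schwarz inequality bounds this form by the dual estimate for `F` in the direction `ω₁` and
for `G` in the direction `ω₂`. Since `3/4 + 3/4 > 1`, the Christ–Kiselev argument `christKiselev`,
a repeated bisection of the triangle `s < t` into products of intervals, keeps the bound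
(`IsTestSource.enorm_retarded_pairing_le`). Duality of the mixed norms (`strichartzNorm_le_of_test`)
turns it into the asserted norm inequality.

*Existence.* The source is approximated by its truncations, for which all integrals are absolutely
convergent. The dual estimate restricted to `s < t` shows that their Duhamel integrals form a Cauchy
sequence in `L^2(ℝ³)` at every time, and the limit has a jointly measurable representative
(`exists_jointly_measurable_rep`). The weak formula passes to the limit because the free evolution
of a Schwartz function lies in `L^4_t L^∞_ω L^2_{ω^⊥}`
(`strichartzNorm_freeSchrodinger_ne_top`), which makes its right-hand side absolutely convergent.
-/

open Set

/-! ### The Hardy–Littlewood–Sobolev inequality for the kernel `|s - s'|^{-1/2}` -/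

lemma lintegral_eq_two_mul_Ioi_of_even {φ : ℝ → ℝ≥0∞} (he : ∀ x, φ (-x) = φ x) :
    ∫⁻ x, φ x = 2 * ∫⁻ x in Ioi 0, φ x := by
  rw [← lintegral_add_compl φ (measurableSet_Ioi (a := (0 : ℝ))), two_mul, compl_Ioi]
  congr 1
  rw [setLIntegral_congr (Iio_ae_eq_Iic (a := (0 : ℝ))).symm]
  have h := (Measure.measurePreserving_neg (volume : Measure ℝ)).setLIntegral_comp_preimage_emb
    (Homeomorph.neg ℝ).measurableEmbedding φ (Ioi 0)
  simp only [he] at h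
  rw [← h]
  congr 2
  ext x
  simp

lemma lintegral_enorm_rpow_near {R : ℝ} (hR : 0 < R) :
    ∫⁻ τ : ℝ, (if |τ| ≤ R then ‖τ‖ₑ ^ (-(1 / 2) : ℝ) else 0)
      = ENNReal.ofReal (4 * R ^ (1 / 2 : ℝ)) := by
  rw [lintegral_eq_two_mul_Ioi_of_even (by intro x; simp)]
  have h1 : ∫⁻ τ in Ioi (0 : ℝ), (if |τ| ≤ R then ‖τ‖ₑ ^ (-(1 / 2) : ℝ) else 0)
      = ∫⁻ τ in Ioc 0 R, ENNReal.ofReal (τ ^ (-(1 / 2) : ℝ)) := by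
    rw [← lintegral_indicator measurableSet_Ioi, ← lintegral_indicator measurableSet_Ioc]
    congr 1
    ext τ
    by_cases h0 : 0 < τ
    · by_cases h : τ ≤ R
      · simp only [indicator, mem_Ioi, h0, mem_Ioc, h, and_self, if_true, abs_of_pos h0]
        rw [← ENNReal.ofReal_rpow_of_pos h0, Real.enorm_of_nonneg h0.le]
      · simp [indicator, h0, h, abs_of_pos h0]
    · simp [indicator, h0]
  have hi := intervalIntegral.intervalIntegrable_rpow' (a := 0) (b := R) (r := -(1 / 2))
    (by norm_num)
  rw [h1, ← ofReal_integral_eq_lintegral_ofReal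
    ((intervalIntegrable_iff_integrableOn_Ioc_of_le hR.le).1 hi),
    ← intervalIntegral.integral_of_le hR.le, integral_rpow (Or.inl (by norm_num))]
  · rw [show (2 : ℝ≥0∞) = ENNReal.ofReal 2 by simp, ← ENNReal.ofReal_mul (by norm_num)]
    congr 1
    rw [Real.zero_rpow (by norm_num)]
    norm_num
    ring
  · exact (ae_restrict_mem measurableSet_Ioc).mono fun x hx => Real.rpow_nonneg hx.1.le _

lemma lintegral_enorm_rpow_far {R : ℝ} (hR : 0 < R) :
    ∫⁻ τ : ℝ, (if |τ| ≤ R then 0 else ‖τ‖ₑ ^ (-(1 / 2) : ℝ)) ^ (4 : ℝ)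
      = ENNReal.ofReal (2 * R⁻¹) := by
  rw [lintegral_eq_two_mul_Ioi_of_even (by intro x; simp)]
  have h1 : ∫⁻ τ in Ioi (0 : ℝ), (if |τ| ≤ R then 0 else ‖τ‖ₑ ^ (-(1 / 2) : ℝ)) ^ (4 : ℝ)
      = ∫⁻ τ in Ioi R, ENNReal.ofReal (τ ^ (-2 : ℝ)) := by
    rw [← lintegral_indicator measurableSet_Ioi, ← lintegral_indicator measurableSet_Ioi]
    congr 1
    ext τ
    by_cases h : R < τ
    · have h0 : 0 < τ := hR.trans h
      simp only [indicator, mem_Ioi, h0, h, if_true, abs_of_pos h0, not_le.2 h, if_false]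
      rw [← ENNReal.ofReal_rpow_of_pos h0, Real.enorm_of_nonneg h0.le, ← ENNReal.rpow_mul]
      norm_num
    · by_cases h0 : 0 < τ
      · simp [indicator, h0, h, abs_of_pos h0, not_lt.1 h]
      · simp [indicator, h0, h]
  rw [h1, ← ofReal_integral_eq_lintegral_ofReal
    (integrableOn_Ioi_rpow_of_lt (by norm_num) hR), integral_Ioi_rpow_of_lt (by norm_num) hR]
  · rw [show (2 : ℝ≥0∞) = ENNReal.ofReal 2 by simp, ← ENNReal.ofReal_mul (by norm_num)]
    congr 1
    norm_num
    rw [Real.rpow_neg_one]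
  · exact (ae_restrict_mem measurableSet_Ioi).mono fun x hx =>
      Real.rpow_nonneg (hR.trans hx).le _

/-- The fractional integral of a function truncated at height `l`: near the diagonal the function
is bounded by `l`, away from it Hölder's inequality applies, and the two contributions balance at
the radius `R = (n / l)^{4/3}`. -/
lemma lintegral_truncated_fractional_le {f : ℝ → ℝ≥0∞} (hf : Measurable f) {l n : ℝ} (hl : 0 < l)
    (hn : 0 < n) (hfn : (∫⁻ s, f s ^ (4 / 3 : ℝ)) ^ (3 / 4 : ℝ) = ENNReal.ofReal n) (s : ℝ) :
    ∫⁻ s', ‖s - s'‖ₑ ^ (-(1 / 2) : ℝ) * (if f s' ≤ ENNReal.ofReal l then f s' else 0)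
      ≤ ENNReal.ofReal (6 * l ^ (1 / 3 : ℝ) * n ^ (2 / 3 : ℝ)) := by
  set R : ℝ := (n / l) ^ (4 / 3 : ℝ) with hR
  have hR0 : 0 < R := Real.rpow_pos_of_pos (div_pos hn hl) _
  have hsplit : ∀ s', ‖s - s'‖ₑ ^ (-(1 / 2) : ℝ) * (if f s' ≤ ENNReal.ofReal l then f s' else 0)
      ≤ (if |s - s'| ≤ R then ‖s - s'‖ₑ ^ (-(1 / 2) : ℝ) else 0) * ENNReal.ofReal l
        + f s' * (if |s - s'| ≤ R then 0 else ‖s - s'‖ₑ ^ (-(1 / 2) : ℝ)) := by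
    intro s'
    by_cases h : |s - s'| ≤ R
    · simp only [h, if_true, mul_zero, add_zero]
      gcongr
      split_ifs with h' <;> simp [h']
    · simp only [h, if_false, zero_mul, zero_add]
      rw [mul_comm]
      gcongr
      split_ifs with h' <;> simp
  have mk : Measurable fun s' : ℝ => ‖s - s'‖ₑ ^ (-(1 / 2) : ℝ) := by fun_prop
  have ms : MeasurableSet {s' : ℝ | |s - s'| ≤ R} :=
    measurableSet_le (by fun_prop) measurable_const
  have m1 : Measurable fun s' : ℝ => (if |s - s'| ≤ R then ‖s - s'‖ₑ ^ (-(1 / 2) : ℝ) else 0) :=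
    Measurable.ite ms mk measurable_const
  have m2 : Measurable fun s' : ℝ => (if |s - s'| ≤ R then 0 else ‖s - s'‖ₑ ^ (-(1 / 2) : ℝ)) :=
    Measurable.ite ms measurable_const mk
  have e1 := lintegral_sub_left_eq_self (μ := (volume : Measure ℝ))
    (fun τ => if |τ| ≤ R then ‖τ‖ₑ ^ (-(1 / 2) : ℝ) else 0) s
  have e2 := lintegral_sub_left_eq_self (μ := (volume : Measure ℝ))
    (fun τ => (if |τ| ≤ R then 0 else ‖τ‖ₑ ^ (-(1 / 2) : ℝ)) ^ (4 : ℝ)) s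
  rw [lintegral_enorm_rpow_near hR0] at e1
  rw [lintegral_enorm_rpow_far hR0] at e2
  have hH := ENNReal.lintegral_mul_le_Lp_mul_Lq (volume : Measure ℝ) (p := 4 / 3) (q := 4)
    (by constructor <;> norm_num) hf.aemeasurable m2.aemeasurable
  simp only [Pi.mul_apply] at hH
  rw [e2, show (1 / (4 / 3) : ℝ) = 3 / 4 by norm_num, hfn] at hH
  calc _ ≤ _ := lintegral_mono hsplit
    _ = ENNReal.ofReal (4 * R ^ (1 / 2 : ℝ)) * ENNReal.ofReal l + _ := by
      rw [lintegral_add_left (m1.mul_const _), lintegral_mul_const _ m1, e1]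
    _ ≤ ENNReal.ofReal (4 * R ^ (1 / 2 : ℝ)) * ENNReal.ofReal l
        + ENNReal.ofReal n * ENNReal.ofReal (2 * R⁻¹) ^ (1 / 4 : ℝ) := by gcongr
    _ = ENNReal.ofReal (4 * R ^ (1 / 2 : ℝ) * l + n * (2 * R⁻¹) ^ (1 / 4 : ℝ)) := by
      rw [ENNReal.ofReal_rpow_of_pos (by positivity), ← ENNReal.ofReal_mul (by positivity),
        ← ENNReal.ofReal_mul (by positivity), ← ENNReal.ofReal_add (by positivity) (by positivity)]
    _ ≤ _ := by
      apply ENNReal.ofReal_le_ofReal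
      have a1 : R ^ (1 / 2 : ℝ) * l = l ^ (1 / 3 : ℝ) * n ^ (2 / 3 : ℝ) := by
        rw [hR, ← Real.rpow_mul (by positivity), Real.div_rpow hn.le hl.le]
        norm_num
        have : l = l ^ (1 / 3 : ℝ) * l ^ (2 / 3 : ℝ) := by
          rw [← Real.rpow_add hl]; norm_num
        have h3 : l ^ (2 / 3 : ℝ) ≠ 0 := by positivity
        field_simp
        nth_rewrite 1 [this]
        ring
      have a2 : n * R⁻¹ ^ (1 / 4 : ℝ) = l ^ (1 / 3 : ℝ) * n ^ (2 / 3 : ℝ) := by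
        rw [hR, ← Real.rpow_neg (by positivity), ← Real.rpow_mul (by positivity),
          Real.div_rpow hn.le hl.le]
        norm_num
        rw [Real.rpow_neg hn.le, Real.rpow_neg hl.le]
        have : n = n ^ (1 / 3 : ℝ) * n ^ (2 / 3 : ℝ) := by
          rw [← Real.rpow_add hn]; norm_num
        have h3 : n ^ (1 / 3 : ℝ) ≠ 0 := by positivity
        field_simp
        nth_rewrite 1 [this]
        ring
      have a3 : (2 : ℝ) ^ (1 / 4 : ℝ) ≤ 2 :=
        Real.rpow_le_self_of_one_le (by norm_num) (by norm_num)
      rw [Real.mul_rpow (by norm_num) (by positivity), mul_assoc, a1]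
      have : n * (2 ^ (1 / 4 : ℝ) * R⁻¹ ^ (1 / 4 : ℝ))
          = 2 ^ (1 / 4 : ℝ) * (l ^ (1 / 3 : ℝ) * n ^ (2 / 3 : ℝ)) := by rw [← a2]; ring
      rw [this]
      have : 0 ≤ l ^ (1 / 3 : ℝ) * n ^ (2 / 3 : ℝ) := by positivity
      nlinarith

/-- **Hardy–Littlewood–Sobolev inequality** for the quadratic form with kernel `|s - s'|^{-1/2}`
on `L^{4/3}(ℝ)`. By symmetry only the region `f s' ≤ f s` matters, and there the inner integral is
a fractional integral truncated at height `f s`. -/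
theorem hardyLittlewoodSobolev {f : ℝ → ℝ≥0∞} (hf : Measurable f) :
    ∫⁻ s, ∫⁻ s', ‖s - s'‖ₑ ^ (-(1 / 2) : ℝ) * (f s * f s')
      ≤ 12 * (∫⁻ s, f s ^ (4 / 3 : ℝ)) ^ (3 / 2 : ℝ) := by
  set I := ∫⁻ s, f s ^ (4 / 3 : ℝ) with hI
  have hfm : Measurable fun s => f s ^ (4 / 3 : ℝ) := hf.pow_const _
  by_cases hI0 : I = 0
  · have h0 : f =ᵐ[volume] 0 := by
      filter_upwards [(lintegral_eq_zero_iff hfm).1 hI0] with s hs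
      exact (ENNReal.rpow_eq_zero_iff_of_pos (by norm_num)).1 hs
    have : ∫⁻ s, ∫⁻ s', ‖s - s'‖ₑ ^ (-(1 / 2) : ℝ) * (f s * f s') = ∫⁻ s : ℝ, 0 := by
      apply lintegral_congr_ae
      filter_upwards [h0] with s hs
      simp [hs]
    rw [this]
    simp
  by_cases hIt : I = ∞
  · rw [hIt, ENNReal.top_rpow_of_pos (by norm_num), ENNReal.mul_top (by norm_num)]
    exact le_top
  have hfin : ∀ᵐ s, f s < ∞ := by
    filter_upwards [ae_lt_top hfm hIt] with s hs
    by_contra h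
    simp [not_lt_top_iff.1 h] at hs
  set n : ℝ := (I ^ (3 / 4 : ℝ)).toReal with hn
  have hIr : I ^ (3 / 4 : ℝ) ≠ ∞ := ENNReal.rpow_ne_top_of_nonneg (by norm_num) hIt
  have hn0 : 0 < n := ENNReal.toReal_pos (by simp [hI0, hIt]) hIr
  have hfn : I ^ (3 / 4 : ℝ) = ENNReal.ofReal n := (ENNReal.ofReal_toReal hIr).symm
  have mk : Measurable fun p : ℝ × ℝ => ‖p.1 - p.2‖ₑ ^ (-(1 / 2) : ℝ) := by fun_prop
  have mg : Measurable fun p : ℝ × ℝ => ‖p.1 - p.2‖ₑ ^ (-(1 / 2) : ℝ)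
      * (if f p.2 ≤ f p.1 then f p.1 * f p.2 else 0) :=
    mk.mul (Measurable.ite (measurableSet_le (hf.comp measurable_snd) (hf.comp measurable_fst))
      ((hf.comp measurable_fst).mul (hf.comp measurable_snd)) measurable_const)
  set J := ∫⁻ s, ∫⁻ s', ‖s - s'‖ₑ ^ (-(1 / 2) : ℝ)
      * (if f s' ≤ f s then f s * f s' else 0) with hJ
  have h2 : ∫⁻ s, ∫⁻ s', ‖s - s'‖ₑ ^ (-(1 / 2) : ℝ) * (f s * f s') ≤ J + J := by
    have hswap : J = ∫⁻ s, ∫⁻ s', ‖s' - s‖ₑ ^ (-(1 / 2) : ℝ)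
      * (if f s ≤ f s' then f s' * f s else 0) := by
      rw [hJ, lintegral_lintegral_swap mg.aemeasurable]
    nth_rewrite 2 [hswap]
    rw [hJ, ← lintegral_add_left]
    · refine lintegral_mono fun s => ?_
      have := lintegral_add_left (mg.comp (measurable_prodMk_left (x := s))) (μ := volume)
        fun s' => ‖s' - s‖ₑ ^ (-(1 / 2) : ℝ) * (if f s ≤ f s' then f s' * f s else 0)
      refine le_trans ?_ this.le
      refine lintegral_mono fun s' => ?_
      dsimp only [Function.comp]
      rcases le_total (f s) (f s') with h | h
      · refine le_trans ?_ le_add_self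
        rw [if_pos h, mul_comm (f s), ← neg_sub s s', enorm_neg]
      · refine le_trans ?_ le_self_add
        rw [if_pos h]
    · exact mg.lintegral_prod_right'
  have h3 : J ≤ 6 * I ^ (3 / 2 : ℝ) := by
    have : ∀ᵐ s, ∫⁻ s', ‖s - s'‖ₑ ^ (-(1 / 2) : ℝ) * (if f s' ≤ f s then f s * f s' else 0)
        ≤ 6 * I ^ (1 / 2 : ℝ) * f s ^ (4 / 3 : ℝ) := by
      filter_upwards [hfin] with s hs
      by_cases h0 : f s = 0
      · simp [h0]
      have hl : 0 < (f s).toReal := ENNReal.toReal_pos h0 hs.ne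
      have key := lintegral_truncated_fractional_le hf hl hn0 hfn s
      rw [ENNReal.ofReal_toReal hs.ne] at key
      calc _ = f s * ∫⁻ s', ‖s - s'‖ₑ ^ (-(1 / 2) : ℝ) * (if f s' ≤ f s then f s' else 0) := by
            rw [← lintegral_const_mul' _ _ hs.ne]
            refine lintegral_congr fun s' => ?_
            split_ifs
            · ring
            · simp
        _ ≤ f s * ENNReal.ofReal (6 * (f s).toReal ^ (1 / 3 : ℝ) * n ^ (2 / 3 : ℝ)) := by gcongr
        _ = _ := by
          rw [ENNReal.ofReal_mul (by positivity), ENNReal.ofReal_mul (by positivity),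
            ← ENNReal.ofReal_rpow_of_pos hl, ← ENNReal.ofReal_rpow_of_pos hn0, ← hfn,
            ENNReal.ofReal_toReal hs.ne, ← ENNReal.rpow_mul]
          have : f s ^ (4 / 3 : ℝ) = f s * f s ^ (1 / 3 : ℝ) := by
            rw [show (4 / 3 : ℝ) = 1 + 1 / 3 by norm_num, ENNReal.rpow_add _ _ h0 hs.ne,
              ENNReal.rpow_one]
          rw [this]
          norm_num
          ring
    calc J ≤ _ := lintegral_mono_ae this
      _ = 6 * I ^ (1 / 2 : ℝ) * I := by rw [lintegral_const_mul _ hfm]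
      _ = _ := by
        rw [mul_assoc, show (3 / 2 : ℝ) = 1 / 2 + 1 by norm_num, ENNReal.rpow_add _ _ hI0 hIt,
          ENNReal.rpow_one]
  calc _ ≤ J + J := h2
    _ ≤ 6 * I ^ (3 / 2 : ℝ) + 6 * I ^ (3 / 2 : ℝ) := by gcongr
    _ = _ := by rw [← add_mul]; norm_num

/-! ### Bisection of a retarded form -/

lemma exists_intervalIntegral_eq_half {w : ℝ → ℝ} (hw : ∀ p q, IntervalIntegrable w volume p q)
    (hw0 : ∀ s, 0 ≤ w s) {p q : ℝ} (hpq : p ≤ q) :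
    ∃ c ∈ Icc p q, (∫ s in p..c, w s) = (∫ s in p..q, w s) / 2
      ∧ (∫ s in c..q, w s) = (∫ s in p..q, w s) / 2 := by
  have hc : ContinuousOn (fun c => ∫ s in p..c, w s) (Icc p q) :=
    (intervalIntegral.continuous_primitive hw p).continuousOn
  have h0 : 0 ≤ ∫ s in p..q, w s := intervalIntegral.integral_nonneg hpq fun s _ => hw0 s
  obtain ⟨c, hcm, hc2⟩ := intermediate_value_Icc hpq hc
    (show (∫ s in p..q, w s) / 2 ∈ Icc _ _ by simp; constructor <;> linarith)
  refine ⟨c, hcm, hc2, ?_⟩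
  have := intervalIntegral.integral_add_adjacent_intervals (hw p c) (hw c q)
  dsimp only at hc2
  linarith

lemma rpow_three_quarters_add_le {x y : ℝ} (hx : 0 ≤ x) (hy : 0 ≤ y) :
    x ^ (3 / 4 : ℝ) + y ^ (3 / 4 : ℝ) ≤ 2 ^ (1 / 4 : ℝ) * (x + y) ^ (3 / 4 : ℝ) := by
  lift x to ℝ≥0 using hx
  lift y to ℝ≥0 using hy
  have h := NNReal.rpow_add_le_mul_rpow_add_rpow (x ^ (3 / 4 : ℝ)) (y ^ (3 / 4 : ℝ))
    (p := 4 / 3) (by norm_num)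
  simp only [← NNReal.rpow_mul] at h
  norm_num at h
  have h' := NNReal.rpow_le_rpow h (z := 3 / 4) (by norm_num)
  rw [NNReal.mul_rpow, ← NNReal.rpow_mul, ← NNReal.rpow_mul] at h'
  norm_num at h'
  norm_num
  exact_mod_cast h'

/-- One bisection step gains the factor `2^{-1/2}`, which makes the constant `4` self-reproducing;
the trivial bound `M (q - p)²` is only used to start the iteration and is halved by every step. -/
lemma bisection_step {B : ℝ → ℝ → ℂ} {E : ℝ → ℝ → ℝ → ℂ} {w v : ℝ → ℝ} {A M δ : ℝ}
    (hw : ∀ p q, IntervalIntegrable w volume p q) (hv : ∀ p q, IntervalIntegrable v volume p q)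
    (hδ : 0 < δ) (hw0 : ∀ s, δ ≤ w s) (hv0 : ∀ s, 0 ≤ v s) (hA : 0 ≤ A) (hM : 0 ≤ M)
    (hsplit : ∀ p c q, p ≤ c → c ≤ q → B p q = B p c + B c q + E p c q)
    (hE : ∀ p c q, p ≤ c → c ≤ q → ‖E p c q‖
      ≤ A * (∫ s in p..c, w s) ^ (3 / 4 : ℝ) * (∫ s in c..q, v s) ^ (3 / 4 : ℝ))
    (hB : ∀ p q, p ≤ q → ‖B p q‖ ≤ M * (q - p) ^ 2) (n : ℕ) :
    ∀ p q, p ≤ q → ‖B p q‖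
      ≤ 4 * A * (∫ s in p..q, w s) ^ (3 / 4 : ℝ) * (∫ s in p..q, v s) ^ (3 / 4 : ℝ)
        + M / δ * (q - p) * (∫ s in p..q, w s) * (1 / 2) ^ n := by
  have hw0' : ∀ s, 0 ≤ w s := fun s => hδ.le.trans (hw0 s)
  have hwi : ∀ p q, p ≤ q → 0 ≤ ∫ s in p..q, w s := fun p q h =>
    intervalIntegral.integral_nonneg h fun s _ => hw0' s
  have hvi : ∀ p q, p ≤ q → 0 ≤ ∫ s in p..q, v s := fun p q h =>
    intervalIntegral.integral_nonneg h fun s _ => hv0 s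
  induction n with
  | zero =>
    intro p q hpq
    have h1 : δ * (q - p) ≤ ∫ s in p..q, w s := by
      have := intervalIntegral.integral_mono_on hpq
        (intervalIntegrable_const (c := δ)) (hw p q) fun s _ => hw0 s
      simpa [mul_comm] using this
    have h2 := hwi p q hpq
    have h3 := hvi p q hpq
    have h4 : M * (q - p) ^ 2 ≤ M / δ * (q - p) * (∫ s in p..q, w s) := by
      calc M * (q - p) ^ 2 = M / δ * (q - p) * (δ * (q - p)) := by field_simp
        _ ≤ _ := by
          have : 0 ≤ q - p := by linarith
          gcongr
    have h5 : 0 ≤ 4 * A * (∫ s in p..q, w s) ^ (3 / 4 : ℝ)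
      * (∫ s in p..q, v s) ^ (3 / 4 : ℝ) := by positivity
    have := hB p q hpq
    rw [pow_zero, mul_one]
    linarith
  | succ n ih =>
    intro p q hpq
    obtain ⟨c, ⟨hpc, hcq⟩, e1, e2⟩ := exists_intervalIntegral_eq_half hw hw0' hpq
    have hvadd := intervalIntegral.integral_add_adjacent_intervals (hv p c) (hv c q)
    have i1 := ih p c hpc
    have i2 := ih c q hcq
    have i3 := hE p c q hpc hcq
    have hnorm : ‖B p q‖ ≤ ‖B p c‖ + ‖B c q‖ + ‖E p c q‖ := by
      rw [hsplit p c q hpc hcq]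
      exact norm_add₃_le
    rw [e1] at i1 i3
    rw [e2] at i2
    set α := ∫ s in p..q, w s
    set β₁ := ∫ s in p..c, v s
    set β₂ := ∫ s in c..q, v s
    have hα : 0 ≤ α := hwi p q hpq
    have hβ₁ : 0 ≤ β₁ := hvi p c hpc
    have hβ₂ : 0 ≤ β₂ := hvi c q hcq
    rw [← hvadd]
    have hβ := rpow_three_quarters_add_le hβ₁ hβ₂
    have hβ' : β₂ ^ (3 / 4 : ℝ) ≤ (β₁ + β₂) ^ (3 / 4 : ℝ) :=
      Real.rpow_le_rpow hβ₂ (by linarith) (by norm_num)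
    set a := α ^ (3 / 4 : ℝ)
    set b := (β₁ + β₂) ^ (3 / 4 : ℝ)
    have ha : 0 ≤ a := by positivity
    have hb : 0 ≤ b := by positivity
    have hhalf : (α / 2) ^ (3 / 4 : ℝ) = a * (2 : ℝ) ^ (-(3 / 4) : ℝ) := by
      rw [Real.div_rpow hα (by norm_num), Real.rpow_neg (by norm_num)]; rfl
    rw [hhalf] at i1 i2 i3
    set r := (2 : ℝ) ^ (-(3 / 4) : ℝ) with hr
    have hr0 : 0 ≤ r := by positivity
    have hr1 : r ≤ 1 := Real.rpow_le_one_of_one_le_of_nonpos (by norm_num) (by norm_num)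
    have hr2 : r * 2 ^ (1 / 4 : ℝ) ≤ 3 / 4 := by
      rw [hr, ← Real.rpow_add (by norm_num)]
      have : ((2 : ℝ) ^ (-(3 / 4) + 1 / 4 : ℝ)) ^ 2 = 1 / 2 := by
        rw [← Real.rpow_natCast, ← Real.rpow_mul (by norm_num)]
        norm_num
      nlinarith [Real.rpow_nonneg (show (0 : ℝ) ≤ 2 by norm_num) (-(3 / 4) + 1 / 4)]
    have m1 : 4 * A * (a * r) * (β₁ ^ (3 / 4 : ℝ) + β₂ ^ (3 / 4 : ℝ)) ≤ 3 * (A * a * b) := by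
      calc _ ≤ 4 * A * (a * r) * (2 ^ (1 / 4 : ℝ) * b) := by gcongr
        _ = 4 * (A * a * b) * (r * 2 ^ (1 / 4 : ℝ)) := by ring
        _ ≤ 4 * (A * a * b) * (3 / 4) := by gcongr
        _ = _ := by ring
    have m2 : A * (a * r) * β₂ ^ (3 / 4 : ℝ) ≤ A * a * b := by
      calc _ ≤ A * (a * 1) * b := by gcongr
        _ = _ := by ring
    have m3 : M / δ * (c - p) * (α / 2) * (1 / 2) ^ n + M / δ * (q - c) * (α / 2) * (1 / 2) ^ n
        = M / δ * (q - p) * α * (1 / 2) ^ (n + 1) := by ring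
    nlinarith

/-- **Christ–Kiselev lemma** for a retarded form `B` on `L^{4/3} × L^{4/3}`. Here `B p q` stands for
the part of the form in the time interval `[p, q]`, and `E p c q` for the interaction of `[p, c]`
with the later interval `[c, q]`, to which no causality restriction applies. -/
theorem christKiselev {B : ℝ → ℝ → ℂ} {E : ℝ → ℝ → ℝ → ℂ} {w v : ℝ → ℝ} {A M : ℝ}
    (hw : ∀ p q, IntervalIntegrable w volume p q) (hv : ∀ p q, IntervalIntegrable v volume p q)
    (hw0 : ∀ s, 0 ≤ w s) (hv0 : ∀ s, 0 ≤ v s) (hA : 0 ≤ A) (hM : 0 ≤ M)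
    (hsplit : ∀ p c q, p ≤ c → c ≤ q → B p q = B p c + B c q + E p c q)
    (hE : ∀ p c q, p ≤ c → c ≤ q → ‖E p c q‖
      ≤ A * (∫ s in p..c, w s) ^ (3 / 4 : ℝ) * (∫ s in c..q, v s) ^ (3 / 4 : ℝ))
    (hB : ∀ p q, p ≤ q → ‖B p q‖ ≤ M * (q - p) ^ 2) {p q : ℝ} (hpq : p ≤ q) :
    ‖B p q‖ ≤ 4 * A * (∫ s in p..q, w s) ^ (3 / 4 : ℝ) * (∫ s in p..q, v s) ^ (3 / 4 : ℝ) := by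
  have hwi : ∀ p q, p ≤ q → 0 ≤ ∫ s in p..q, w s := fun p q h =>
    intervalIntegral.integral_nonneg h fun s _ => hw0 s
  have hvi : ∀ p q, p ≤ q → 0 ≤ ∫ s in p..q, v s := fun p q h =>
    intervalIntegral.integral_nonneg h fun s _ => hv0 s
  have hadd : ∀ δ p q : ℝ, (∫ s in p..q, (w s + δ)) = (∫ s in p..q, w s) + δ * (q - p) := by
    intro δ p q
    rw [intervalIntegral.integral_add (hw p q) intervalIntegrable_const]
    simp [mul_comm]
  have key : ∀ δ > 0, ‖B p q‖ ≤ 4 * A * ((∫ s in p..q, w s) + δ * (q - p)) ^ (3 / 4 : ℝ)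
      * (∫ s in p..q, v s) ^ (3 / 4 : ℝ) := by
    intro δ hδ
    have hst := bisection_step (w := fun s => w s + δ) (δ := δ)
      (fun p q => (hw p q).add intervalIntegrable_const) hv hδ
      (fun s => by linarith [hw0 s]) hv0 hA hM hsplit
      (fun p c q h h' => (hE p c q h h').trans (by
        rw [hadd]
        have := hwi p c h
        have := hvi c q h'
        have : 0 ≤ δ * (c - p) := mul_nonneg hδ.le (by linarith)
        gcongr
        linarith)) hB
    rw [← hadd]
    have h := ((tendsto_pow_atTop_nhds_zero_of_lt_one (r := (1 / 2 : ℝ)) (by norm_num)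
      (by norm_num)).const_mul (M / δ * (q - p) * (∫ s in p..q, (w s + δ)))).const_add
      (4 * A * (∫ s in p..q, (w s + δ)) ^ (3 / 4 : ℝ) * (∫ s in p..q, v s) ^ (3 / 4 : ℝ))
    rw [mul_zero, add_zero] at h
    exact ge_of_tendsto' h fun n => hst n p q hpq
  have hcont : Continuous fun δ : ℝ => 4 * A * ((∫ s in p..q, w s) + δ * (q - p)) ^ (3 / 4 : ℝ)
      * (∫ s in p..q, v s) ^ (3 / 4 : ℝ) := by
    refine (continuous_const.mul ?_).mul continuous_const
    exact (Real.continuous_rpow_const (by norm_num)).comp (by fun_prop)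
  have hlim := (hcont.tendsto 0).mono_left (nhdsWithin_le_nhds (s := Ioi (0 : ℝ)))
  rw [zero_mul, add_zero] at hlim
  exact ge_of_tendsto (b := ‖B p q‖) hlim
    (Filter.mem_of_superset self_mem_nhdsWithin fun δ hδ => key δ hδ)

/-! ### The Fourier transform on `L¹ ∩ L²` -/

section Plancherel

variable {V : Type*} [NormedAddCommGroup V] [InnerProductSpace ℝ V] [FiniteDimensional ℝ V]
  [MeasurableSpace V] [BorelSpace V]

lemma integral_fourier_mul_eq_of_integrable {f g : V → ℂ} (hf : Integrable f)
    (hg : Integrable g) : ∫ ξ, 𝓕 f ξ * g ξ = ∫ x, f x * 𝓕 g x := by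
  have h := VectorFourier.integral_fourierIntegral_smul_eq_flip (μ := (volume : Measure V))
    (ν := (volume : Measure V)) (L := innerₗ V) (f := f) (g := g)
    Real.continuous_fourierChar continuous_inner hf hg
  rw [flip_innerₗ] at h
  exact h

lemma continuous_fourier_of_integrable {f : V → ℂ} (hf : Integrable f) : Continuous (𝓕 f) :=
  VectorFourier.fourierIntegral_continuous Real.continuous_fourierChar continuous_inner hf

/-- On `L¹ ∩ L²` the `L²` Fourier transform is given by the Fourier integral, since both agree as
tempered distributions. -/
lemma coeFn_fourier_toLp_ae_eq {f : V → ℂ} (h1 : Integrable f) (h2 : MemLp f 2) :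
    (𝓕 (h2.toLp f) : Lp ℂ 2 (volume : Measure V)) =ᵐ[volume] 𝓕 f := by
  refine ae_eq_of_integral_contDiff_smul_eq
    ((Lp.memLp _).locallyIntegrable (by norm_num))
    (continuous_fourier_of_integrable h1).locallyIntegrable ?_
  intro g hg hgs
  set φ : 𝓢(V, ℂ) := HasCompactSupport.toSchwartzMap (f := fun x => (g x : ℂ))
    (hgs.comp_left (g := fun x : ℝ => (x : ℂ)) (by simp))
    (Complex.ofRealCLM.contDiff.comp hg) with hφ
  have hφe : ∀ x, φ x = g x := fun x => rfl
  have h := congrArg (fun T => T φ) (Lp.fourier_toTemperedDistribution_eq (h2.toLp f))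
  simp only [TemperedDistribution.fourier_apply, Lp.toTemperedDistribution_apply] at h
  have e1 : ∫ x, (𝓕 φ) x • (h2.toLp f) x = ∫ x, φ x * 𝓕 f x := by
    have := integral_fourier_mul_eq_of_integrable (φ.integrable (μ := volume)) h1
    rw [← this]
    apply integral_congr_ae
    filter_upwards [h2.coeFn_toLp] with x hx
    rw [hx, smul_eq_mul]
    rfl
  rw [e1] at h
  simp only [hφe, smul_eq_mul] at h
  simp only [Complex.real_smul]
  exact h.symm

lemma memLp_fourier {f : V → ℂ} (h1 : Integrable f) (h2 : MemLp f 2) : MemLp (𝓕 f) 2 :=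
  (memLp_congr_ae (coeFn_fourier_toLp_ae_eq h1 h2)).1 (Lp.memLp _)

lemma fourier_toLp_eq {f : V → ℂ} (h1 : Integrable f) (h2 : MemLp f 2) :
    𝓕 (h2.toLp f) = (memLp_fourier h1 h2).toLp (𝓕 f) :=
  Lp.ext ((coeFn_fourier_toLp_ae_eq h1 h2).trans (MemLp.coeFn_toLp _).symm)

lemma eLpNorm_fourier {f : V → ℂ} (h1 : Integrable f) (h2 : MemLp f 2) :
    eLpNorm (𝓕 f) 2 volume = eLpNorm f 2 volume := by
  rw [← eLpNorm_congr_ae (coeFn_fourier_toLp_ae_eq h1 h2), ← eLpNorm_congr_ae h2.coeFn_toLp,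
    ← Lp.enorm_def, ← Lp.enorm_def, enorm_eq_iff_norm_eq, Lp.norm_fourier_eq]

lemma eLpNorm_two_eq_lintegral {α : Type*} {m : MeasurableSpace α} {μ : Measure α}
    {E : Type*} [TopologicalSpace E] [ContinuousENorm E] (f : α → E) :
    eLpNorm f 2 μ = (∫⁻ x, ‖f x‖ₑ ^ 2 ∂μ) ^ (1 / 2 : ℝ) := by
  rw [eLpNorm_eq_lintegral_rpow_enorm_toReal (by norm_num) (by norm_num)]
  norm_num

lemma lintegral_enorm_fourier_sq {f : V → ℂ} (h1 : Integrable f) (h2 : MemLp f 2) :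
    ∫⁻ ξ, ‖𝓕 f ξ‖ₑ ^ 2 = ∫⁻ x, ‖f x‖ₑ ^ 2 := by
  have h := eLpNorm_fourier h1 h2
  rw [eLpNorm_two_eq_lintegral, eLpNorm_two_eq_lintegral] at h
  exact ENNReal.rpow_left_injective (by norm_num) h

end Plancherel

/-! ### The one-dimensional dispersive estimate -/

/-- The regularized one-dimensional Schrödinger kernel decays like `|τ|^{-1/2}`, uniformly in the
regularization. -/
lemma enorm_integral_gaussian_oscillatory_le {ε : ℝ} (hε : 0 < ε) (τ σ : ℝ) :
    ‖∫ ρ : ℝ, Complex.exp (-(ε + 4 * Real.pi ^ 2 * τ * Complex.I) * ρ ^ 2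
      + (-(2 * Real.pi * σ) * Complex.I) * ρ)‖ₑ ≤ ‖τ‖ₑ ^ (-(1 / 2) : ℝ) := by
  rcases eq_or_ne τ 0 with rfl | hτ
  · simp
  set b : ℂ := ε + 4 * Real.pi ^ 2 * τ * Complex.I with hb
  have hbre : b.re = ε := by
    simp [hb, ← Complex.ofReal_pow, ← Complex.ofReal_ofNat, ← Complex.ofReal_mul]
  have hbim : b.im = 4 * Real.pi ^ 2 * τ := by
    simp [hb, ← Complex.ofReal_pow, ← Complex.ofReal_ofNat, ← Complex.ofReal_mul]
  have hb0 : b ≠ 0 := fun h => by rw [h] at hbre; simp at hbre; linarith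
  have h := integral_cexp_quadratic (b := -b) (by simp [hbre, hε])
    (-(2 * Real.pi * σ) * Complex.I) 0
  simp only [add_zero] at h
  rw [h, neg_neg]
  have e1 : ‖Complex.exp (0 - (-(2 * Real.pi * σ) * Complex.I) ^ 2 / (4 * -b))‖ ≤ 1 := by
    rw [Complex.norm_exp, Real.exp_le_one_iff]
    have : (0 - (-(2 * Real.pi * σ) * Complex.I) ^ 2 / (4 * -b) : ℂ)
        = ((-(Real.pi * σ) ^ 2 : ℝ) : ℂ) * b⁻¹ := by
      push_cast
      field_simp
      rw [Complex.I_sq]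
      ring
    rw [this, Complex.re_ofReal_mul, Complex.inv_re, hbre]
    have : 0 ≤ ε / Complex.normSq b := div_nonneg hε.le (Complex.normSq_nonneg b)
    nlinarith [sq_nonneg (Real.pi * σ)]
  have e2 : ‖((Real.pi : ℂ) / b) ^ (1 / 2 : ℂ)‖ ≤ |τ| ^ (-(1 / 2) : ℝ) := by
    rw [show (1 / 2 : ℂ) = ((1 / 2 : ℝ) : ℂ) by push_cast; rfl, Complex.norm_cpow_real,
      Real.rpow_neg (abs_nonneg τ), ← Real.inv_rpow (abs_nonneg τ)]
    apply Real.rpow_le_rpow (norm_nonneg _) _ (by norm_num)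
    rw [norm_div, Complex.norm_real, Real.norm_of_nonneg Real.pi_pos.le, inv_eq_one_div]
    have h1 := Complex.abs_im_le_norm b
    rw [hbim, abs_mul, abs_of_pos (by positivity)] at h1
    have hτ' : 0 < |τ| := abs_pos.2 hτ
    rw [div_le_div_iff₀ (norm_pos_iff.2 hb0) hτ']
    have : Real.pi ≤ 4 * Real.pi ^ 2 := by nlinarith [Real.pi_gt_three]
    nlinarith
  have hτ' : 0 < |τ| := abs_pos.2 hτ
  rw [← Real.enorm_abs, Real.enorm_of_nonneg hτ'.le, ENNReal.ofReal_rpow_of_pos hτ',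
    ← ofReal_norm]
  apply ENNReal.ofReal_le_ofReal
  rw [norm_mul]
  calc _ ≤ |τ| ^ (-(1 / 2) : ℝ) * 1 := by gcongr
    _ = _ := mul_one _

/-- The weighted `L²` norm of an oscillatory integral, expanded by Fubini's theorem into a double
integral against the kernel obtained by carrying out the frequency integral first. -/
lemma lintegral_weighted_enorm_sq_le {Z : Type*} [MeasurableSpace Z] {μ : Measure Z} [SFinite μ]
    {e : ℝ → Z → ℂ} (hem : Measurable (Function.uncurry e)) (hen : ∀ ρ z, ‖e ρ z‖ = 1)
    {k : Z → ℂ} (hk : Integrable k μ) {χ : ℝ → ℝ} (hχ : Integrable χ) (hχ0 : ∀ ρ, 0 ≤ χ ρ) :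
    ∫⁻ ρ, ENNReal.ofReal (χ ρ) * ‖∫ z, e ρ z * k z ∂μ‖ₑ ^ 2
      ≤ ∫⁻ p : Z × Z, ‖∫ ρ, (χ ρ : ℂ) * (e ρ p.1 * (starRingEnd ℂ) (e ρ p.2))‖ₑ
          * (‖k p.1‖ₑ * ‖k p.2‖ₑ) ∂(μ.prod μ) := by
  set Φ : ℝ → ℂ := fun ρ => ∫ z, e ρ z * k z ∂μ with hΦ
  have hΦm : AEStronglyMeasurable Φ volume :=
    (AEStronglyMeasurable.integral_prod_right' (f := fun p : ℝ × Z => e p.1 p.2 * k p.2)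
      (hem.aestronglyMeasurable.mul hk.1.comp_snd) :)
  have hΦb : ∀ ρ, ‖Φ ρ‖ ≤ ∫ z, ‖k z‖ ∂μ := fun ρ => by
    refine (norm_integral_le_integral_norm _).trans (le_of_eq ?_)
    simp [hen]
  have hkk : Integrable (fun p : Z × Z => k p.1 * (starRingEnd ℂ) (k p.2)) (μ.prod μ) :=
    hk.mul_prod (f := k) (g := fun z => (starRingEnd ℂ) (k z))
      ((Complex.conjLIE.toContinuousLinearEquiv : ℂ →L[ℝ] ℂ).integrable_comp hk)
  have m1 : Measurable fun q : ℝ × (Z × Z) => e q.1 q.2.1 :=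
    hem.comp (measurable_fst.prodMk (measurable_fst.comp measurable_snd))
  have m2 : Measurable fun q : ℝ × (Z × Z) => e q.1 q.2.2 :=
    hem.comp (measurable_fst.prodMk (measurable_snd.comp measurable_snd))
  set W : ℝ → Z × Z → ℂ := fun ρ p => (χ ρ : ℂ) * (e ρ p.1 * (starRingEnd ℂ) (e ρ p.2)) with hW
  have hHi : Integrable (Function.uncurry fun ρ (p : Z × Z) =>
      W ρ p * (k p.1 * (starRingEnd ℂ) (k p.2))) (volume.prod (μ.prod μ)) := by
    have h0 : Integrable (fun q : ℝ × (Z × Z) =>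
        (χ q.1 : ℂ) * (k q.2.1 * (starRingEnd ℂ) (k q.2.2)))
        (volume.prod (μ.prod μ)) := Integrable.mul_prod hχ.ofReal hkk
    have h1 : Measurable fun q : ℝ × (Z × Z) => e q.1 q.2.1 * (starRingEnd ℂ) (e q.1 q.2.2) :=
      m1.mul (Complex.continuous_conj.measurable.comp m2)
    have h2 := h0.bdd_mul h1.aestronglyMeasurable (c := 1)
      (Filter.Eventually.of_forall fun q => by simp [hen])
    refine h2.congr (Filter.Eventually.of_forall fun q => ?_)
    simp only [Function.uncurry, hW]
    ring
  have hsq : ∀ ρ, ((χ ρ * ‖Φ ρ‖ ^ 2 : ℝ) : ℂ)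
      = ∫ p : Z × Z, W ρ p * (k p.1 * (starRingEnd ℂ) (k p.2)) ∂(μ.prod μ) := by
    intro ρ
    have h1 : ((‖Φ ρ‖ ^ 2 : ℝ) : ℂ) = Φ ρ * (starRingEnd ℂ) (Φ ρ) := by
      rw [Complex.mul_conj, Complex.normSq_eq_norm_sq]
    rw [Complex.ofReal_mul, h1, hΦ]
    simp only
    rw [← integral_conj, ← integral_prod_mul, ← integral_const_mul]
    refine integral_congr_ae (Filter.Eventually.of_forall fun p => ?_)
    simp only [hW, map_mul]
    ring
  have hint : Integrable fun ρ => χ ρ * ‖Φ ρ‖ ^ 2 := by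
    refine hχ.mul_bdd (c := (∫ z, ‖k z‖ ∂μ) ^ 2) (hΦm.norm.pow 2)
      (Filter.Eventually.of_forall fun ρ => ?_)
    rw [Real.norm_of_nonneg (by positivity)]
    have := hΦb ρ
    gcongr
  have h0 : ∀ ρ, 0 ≤ χ ρ * ‖Φ ρ‖ ^ 2 := fun ρ => mul_nonneg (hχ0 ρ) (by positivity)
  calc ∫⁻ ρ, ENNReal.ofReal (χ ρ) * ‖Φ ρ‖ₑ ^ 2
      = ∫⁻ ρ, ENNReal.ofReal (χ ρ * ‖Φ ρ‖ ^ 2) := by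
        refine lintegral_congr fun ρ => ?_
        rw [ENNReal.ofReal_mul (hχ0 ρ), ENNReal.ofReal_pow (norm_nonneg _), ofReal_norm]
    _ = ENNReal.ofReal (∫ ρ, χ ρ * ‖Φ ρ‖ ^ 2) :=
        (ofReal_integral_eq_lintegral_ofReal hint (Filter.Eventually.of_forall h0)).symm
    _ = ‖((∫ ρ, χ ρ * ‖Φ ρ‖ ^ 2 : ℝ) : ℂ)‖ₑ := by
        rw [← ofReal_norm, Complex.norm_real, Real.norm_of_nonneg (integral_nonneg h0)]
    _ = ‖∫ p : Z × Z, (∫ ρ, W ρ p * (k p.1 * (starRingEnd ℂ) (k p.2))) ∂(μ.prod μ)‖ₑ := by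
        rw [← integral_complex_ofReal, integral_congr_ae (Filter.Eventually.of_forall hsq),
          integral_integral_swap hHi]
    _ ≤ ∫⁻ p : Z × Z, ‖∫ ρ, W ρ p * (k p.1 * (starRingEnd ℂ) (k p.2))‖ₑ ∂(μ.prod μ) :=
        enorm_integral_le_lintegral_enorm _
    _ = _ := by
        refine lintegral_congr fun p => ?_
        have h3 : ‖(starRingEnd ℂ) (k p.2)‖ₑ = ‖k p.2‖ₑ := by
          rw [enorm_eq_iff_norm_eq]; exact RCLike.norm_conj _
        rw [integral_mul_const, enorm_mul, enorm_mul, h3]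

/-- The phase of the one-dimensional Schrödinger extension operator at frequency `ρ` and space-time
point `z = (s, r)`. -/
noncomputable def extensionPhase (ρ : ℝ) (z : ℝ × ℝ) : ℂ :=
  Complex.exp (-((4 * Real.pi ^ 2 * ρ ^ 2 * z.1 + 2 * Real.pi * ρ * z.2 : ℝ) : ℂ) * Complex.I)

lemma measurable_extensionPhase : Measurable (Function.uncurry extensionPhase) := by
  unfold extensionPhase Function.uncurry
  fun_prop

lemma norm_extensionPhase (ρ : ℝ) (z : ℝ × ℝ) : ‖extensionPhase ρ z‖ = 1 := by
  rw [extensionPhase, ← Complex.ofReal_neg, Complex.norm_exp_ofReal_mul_I]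

lemma enorm_integral_extensionPhase_le {ε : ℝ} (hε : 0 < ε) (z z' : ℝ × ℝ) :
    ‖∫ ρ : ℝ, ((Real.exp (-ε * ρ ^ 2) : ℝ) : ℂ)
      * (extensionPhase ρ z * (starRingEnd ℂ) (extensionPhase ρ z'))‖ₑ
      ≤ ‖z.1 - z'.1‖ₑ ^ (-(1 / 2) : ℝ) := by
  refine le_trans (le_of_eq ?_)
    (enorm_integral_gaussian_oscillatory_le hε (z.1 - z'.1) (z.2 - z'.2))
  congr 2
  ext ρ
  simp only [extensionPhase]
  rw [← Complex.exp_conj, Complex.ofReal_exp, ← Complex.exp_add, ← Complex.exp_add]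
  congr 1
  simp only [map_mul, map_neg, Complex.conj_ofReal, Complex.conj_I]
  push_cast
  ring

/-- The square of the `L²` norm of the adjoint of the one-dimensional Schrödinger evolution is
controlled by the dispersive kernel. -/
lemma lintegral_enorm_sq_extension_le {k : ℝ × ℝ → ℂ} (hk : Integrable k) :
    ∫⁻ ρ : ℝ, ‖∫ z : ℝ × ℝ, extensionPhase ρ z * k z‖ₑ ^ 2
      ≤ ∫⁻ z : ℝ × ℝ, ∫⁻ z' : ℝ × ℝ,
          ‖z.1 - z'.1‖ₑ ^ (-(1 / 2) : ℝ) * (‖k z‖ₑ * ‖k z'‖ₑ) := by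
  set Φ : ℝ → ℂ := fun ρ => ∫ z, extensionPhase ρ z * k z with hΦ
  have hΦm : AEStronglyMeasurable Φ volume :=
    (AEStronglyMeasurable.integral_prod_right'
      (f := fun p : ℝ × (ℝ × ℝ) => extensionPhase p.1 p.2 * k p.2)
      (measurable_extensionPhase.aestronglyMeasurable.mul hk.1.comp_snd) :)
  set RHS := ∫⁻ z : ℝ × ℝ, ∫⁻ z' : ℝ × ℝ,
    ‖z.1 - z'.1‖ₑ ^ (-(1 / 2) : ℝ) * (‖k z‖ₑ * ‖k z'‖ₑ) with hRHS
  have key : ∀ ε : ℝ, 0 < ε →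
      ∫⁻ ρ, ENNReal.ofReal (Real.exp (-ε * ρ ^ 2)) * ‖Φ ρ‖ₑ ^ 2 ≤ RHS := by
    intro ε hε
    refine (lintegral_weighted_enorm_sq_le measurable_extensionPhase norm_extensionPhase hk
      (integrable_exp_neg_mul_sq hε) fun ρ => (Real.exp_pos _).le).trans ?_
    have h1 : Measurable fun p : (ℝ × ℝ) × (ℝ × ℝ) =>
      ‖p.1.1 - p.2.1‖ₑ ^ (-(1 / 2) : ℝ) := by fun_prop
    have m1 : AEMeasurable (fun p : (ℝ × ℝ) × (ℝ × ℝ) => ‖k p.1‖ₑ)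
      (volume.prod volume) := (hk.1.comp_fst).enorm
    have m2 : AEMeasurable (fun p : (ℝ × ℝ) × (ℝ × ℝ) => ‖k p.2‖ₑ)
      (volume.prod volume) := (hk.1.comp_snd).enorm
    calc _ ≤ ∫⁻ p : (ℝ × ℝ) × (ℝ × ℝ), ‖p.1.1 - p.2.1‖ₑ ^ (-(1 / 2) : ℝ)
          * (‖k p.1‖ₑ * ‖k p.2‖ₑ) ∂(volume.prod volume) :=
          lintegral_mono fun p => by
            dsimp only
            gcongr
            exact enorm_integral_extensionPhase_le hε p.1 p.2
      _ = RHS := lintegral_prod _ (h1.aemeasurable.mul (m1.mul m2))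
  have hm : ∀ n : ℕ, AEMeasurable (fun ρ : ℝ =>
      ENNReal.ofReal (Real.exp (-(1 / ((n : ℝ) + 1)) * ρ ^ 2)) * ‖Φ ρ‖ₑ ^ 2) volume := fun n =>
    AEMeasurable.mul (by fun_prop) (hΦm.enorm.pow_const 2)
  -- Fatou's lemma removes the regularizing factor
  have hlim : ∀ ρ : ℝ, Filter.Tendsto (fun n : ℕ =>
      ENNReal.ofReal (Real.exp (-(1 / ((n : ℝ) + 1)) * ρ ^ 2)) * ‖Φ ρ‖ₑ ^ 2)
      Filter.atTop (nhds (‖Φ ρ‖ₑ ^ 2)) := by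
    intro ρ
    have h1 : Filter.Tendsto (fun n : ℕ => Real.exp (-(1 / ((n : ℝ) + 1)) * ρ ^ 2))
        Filter.atTop (nhds 1) := by
      have := ((tendsto_one_div_add_atTop_nhds_zero_nat (𝕜 := ℝ)).neg.mul_const (ρ ^ 2)).rexp
      simpa using this
    have h2 := ENNReal.Tendsto.mul_const (b := ‖Φ ρ‖ₑ ^ 2) (ENNReal.tendsto_ofReal h1)
      (Or.inr (by simp))
    simpa using h2
  calc ∫⁻ ρ, ‖Φ ρ‖ₑ ^ 2
      = ∫⁻ ρ, Filter.liminf (fun n : ℕ =>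
          ENNReal.ofReal (Real.exp (-(1 / ((n : ℝ) + 1)) * ρ ^ 2)) * ‖Φ ρ‖ₑ ^ 2) Filter.atTop :=
        lintegral_congr fun ρ => (hlim ρ).liminf_eq.symm
    _ ≤ Filter.liminf (fun n : ℕ => ∫⁻ ρ,
          ENNReal.ofReal (Real.exp (-(1 / ((n : ℝ) + 1)) * ρ ^ 2)) * ‖Φ ρ‖ₑ ^ 2) Filter.atTop :=
        lintegral_liminf_le' hm
    _ ≤ RHS := by
        refine Filter.liminf_le_of_le ?_ fun b hb => ?_
        · isBoundedDefault
        · obtain ⟨n, hn⟩ := hb.exists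
          exact hn.trans (key _ (by positivity))

/-! ### Coordinates adapted to a direction -/

/-- The plane `ω^⊥`. -/
noncomputable abbrev Plane (ω : sphere (0 : R3) 1) : Submodule ℝ R3 :=
  (Submodule.span ℝ {(ω : R3)})ᗮ

/-- The coordinates `(r, y) ↦ r ω + y` on `ℝ³`. -/
noncomputable def dirCoord (ω : sphere (0 : R3) 1) : ℝ × Plane ω ≃ᵐ R3 :=
  ((LinearIsometryEquiv.toSpanUnitSingleton (𝕜 := ℝ) (ω : R3)
      (by simp)).toHomeomorph.toMeasurableEquiv.prodCongr (MeasurableEquiv.refl (Plane ω))).trans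
    ((MeasurableEquiv.toLp 2 (Submodule.span ℝ {(ω : R3)} × Plane ω)).trans
      (Submodule.span ℝ {(ω : R3)}).orthogonalDecomposition.symm.toHomeomorph.toMeasurableEquiv)

lemma dirCoord_apply (ω : sphere (0 : R3) 1) (p : ℝ × Plane ω) :
    dirCoord ω p = p.1 • (ω : R3) + (p.2 : R3) := by
  simp [dirCoord]
  rfl

lemma measurePreserving_dirCoord (ω : sphere (0 : R3) 1) :
    MeasurePreserving (dirCoord ω) (volume.prod volume) volume := by
  refine MeasurePreserving.trans (e := MeasurableEquiv.prodCongr _ _) (μb := volume.prod volume)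
    (MeasurePreserving.prod ?_ (MeasurePreserving.id _)) ?_
  · exact LinearIsometryEquiv.measurePreserving _
  · exact MeasurePreserving.trans (WithLp.volume_preserving_symm_measurableEquiv_toLp_prod _ _).symm
      (LinearIsometryEquiv.measurePreserving _)

lemma inner_plane (ω : sphere (0 : R3) 1) (y : Plane ω) : inner ℝ (ω : R3) (y : R3) = 0 :=
  (Submodule.mem_orthogonal_singleton_iff_inner_right).1 y.2

lemma inner_dirCoord (ω : sphere (0 : R3) 1) (r ρ : ℝ) (y η : Plane ω) :
    inner ℝ (dirCoord ω (r, y)) (dirCoord ω (ρ, η)) = r * ρ + inner ℝ y η := by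
  have h1 := inner_plane ω y
  have h2 := inner_plane ω η
  have h3 : inner ℝ (ω : R3) (ω : R3) = (1 : ℝ) := by simp
  rw [real_inner_comm] at h1
  simp only [dirCoord_apply, inner_add_left, inner_add_right, real_inner_smul_left,
    real_inner_smul_right, h1, h2, h3, Submodule.coe_inner]
  ring

lemma inner_direction_dirCoord (ω : sphere (0 : R3) 1) (r : ℝ) (y : Plane ω) :
    inner ℝ (ω : R3) (dirCoord ω (r, y)) = r := by
  have h2 := inner_plane ω y
  simp [dirCoord_apply, inner_add_right, real_inner_smul_right, h2]

lemma norm_sq_dirCoord (ω : sphere (0 : R3) 1) (ρ : ℝ) (η : Plane ω) :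
    ‖dirCoord ω (ρ, η)‖ ^ 2 = ρ ^ 2 + ‖η‖ ^ 2 := by
  rw [← real_inner_self_eq_norm_sq, inner_dirCoord, real_inner_self_eq_norm_sq]
  ring

lemma lintegral_dirCoord (ω : sphere (0 : R3) 1) {g : R3 → ℝ≥0∞} (hg : Measurable g) :
    ∫⁻ x, g x = ∫⁻ r : ℝ, ∫⁻ y : Plane ω, g (dirCoord ω (r, y)) := by
  rw [← (measurePreserving_dirCoord ω).lintegral_comp hg]
  exact lintegral_prod _ (hg.comp (dirCoord ω).measurable).aemeasurable

/-! ### The norm of `L^{4/3}_t L^1_ω L^2_{ω^⊥}` -/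

/-- The `L²` norm of a nonnegative function on the plane `r ω + ω^⊥`. -/
noncomputable def sliceNorm (ω : sphere (0 : R3) 1) (h : R3 → ℝ≥0∞) (r : ℝ) : ℝ≥0∞ :=
  (∫⁻ y : Plane ω, h (dirCoord ω (r, y)) ^ 2) ^ (1 / 2 : ℝ)

/-- The norm of `L^{4/3}_t L^1_ω L^2_{ω^⊥}` of a nonnegative function. -/
noncomputable def dualNorm (ω : sphere (0 : R3) 1) (g : ℝ → R3 → ℝ≥0∞) : ℝ≥0∞ :=
  (∫⁻ t, (∫⁻ r, sliceNorm ω (g t) r) ^ (4 / 3 : ℝ)) ^ (3 / 4 : ℝ)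

lemma sliceNorm_mono {ω : sphere (0 : R3) 1} {h h' : R3 → ℝ≥0∞} (hh : ∀ x, h x ≤ h' x) (r : ℝ) :
    sliceNorm ω h r ≤ sliceNorm ω h' r := by
  unfold sliceNorm
  gcongr
  exact hh _

lemma dualNorm_mono {ω : sphere (0 : R3) 1} {g g' : ℝ → R3 → ℝ≥0∞}
    (hh : ∀ t x, g t x ≤ g' t x) : dualNorm ω g ≤ dualNorm ω g' := by
  unfold dualNorm
  gcongr
  exact sliceNorm_mono (hh _) _

lemma measurable_sliceNorm {ω : sphere (0 : R3) 1} {g : ℝ → R3 → ℝ≥0∞}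
    (hg : Measurable (Function.uncurry g)) :
    Measurable fun p : ℝ × ℝ => sliceNorm ω (g p.1) p.2 := by
  unfold sliceNorm
  refine Measurable.pow_const ?_ _
  refine Measurable.lintegral_prod_right' (f := fun q : (ℝ × ℝ) × Plane ω =>
    g q.1.1 (dirCoord ω (q.1.2, q.2)) ^ 2) ?_
  refine Measurable.pow_const ?_ _
  exact hg.comp ((measurable_fst.comp measurable_fst).prodMk ((dirCoord ω).measurable.comp
    ((measurable_snd.comp measurable_fst).prodMk measurable_snd)))

lemma measurable_lintegral_sliceNorm {ω : sphere (0 : R3) 1} {g : ℝ → R3 → ℝ≥0∞}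
    (hg : Measurable (Function.uncurry g)) :
    Measurable fun t : ℝ => ∫⁻ r, sliceNorm ω (g t) r :=
  (measurable_sliceNorm hg).lintegral_prod_right'

/-- Bounded measurable functions on space-time with bounded support. -/
structure IsTestSource (G : ℝ → R3 → ℂ) : Prop where
  measurable : Measurable (Function.uncurry G)
  bounded : ∃ M, ∀ t x, ‖G t x‖ ≤ M
  support : ∃ T, ∀ t x, G t x ≠ 0 → |t| ≤ T ∧ ‖x‖ ≤ T

lemma memLp_of_bounded_of_support {V E : Type*} [NormedAddCommGroup V] [ProperSpace V]
    [MeasurableSpace V] [BorelSpace V] {μ : Measure V} [IsFiniteMeasureOnCompacts μ]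
    [NormedAddCommGroup E] {f : V → E} {p : ℝ≥0∞}
    (hf : AEStronglyMeasurable f μ) {M T : ℝ} (hM : ∀ x, ‖f x‖ ≤ M)
    (hT : ∀ x, f x ≠ 0 → ‖x‖ ≤ T) : MemLp f p μ := by
  have h1 : (closedBall (0 : V) T).indicator f = f := by
    refine indicator_eq_self.2 fun x hx => ?_
    simpa using hT x hx
  rw [← h1, memLp_indicator_iff_restrict measurableSet_closedBall]
  have : IsFiniteMeasure (μ.restrict (closedBall (0 : V) T)) :=
    ⟨by simpa using (isCompact_closedBall (0 : V) T).measure_lt_top⟩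
  exact MemLp.of_bound hf.restrict M (Filter.Eventually.of_forall hM)

namespace IsTestSource

variable {G H : ℝ → R3 → ℂ}

lemma measurable_slice (hG : IsTestSource G) (t : ℝ) : Measurable (G t) :=
  hG.measurable.comp measurable_prodMk_left

lemma memLp (hG : IsTestSource G) (t : ℝ) (p : ℝ≥0∞) : MemLp (G t) p := by
  obtain ⟨M, hM⟩ := hG.bounded
  obtain ⟨T, hT⟩ := hG.support
  exact memLp_of_bounded_of_support (hG.measurable_slice t).aestronglyMeasurable (hM t)
    fun x hx => (hT t x hx).2

lemma integrable_slice (hG : IsTestSource G) (t : ℝ) : Integrable (G t) :=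
  memLp_one_iff_integrable.1 (hG.memLp t 1)

lemma memLp_uncurry (hG : IsTestSource G) (p : ℝ≥0∞) :
    MemLp (Function.uncurry G) p (volume.prod volume) := by
  obtain ⟨M, hM⟩ := hG.bounded
  obtain ⟨T, hT⟩ := hG.support
  exact memLp_of_bounded_of_support hG.measurable.aestronglyMeasurable
    (fun q => hM q.1 q.2) fun q hq => max_le (hT q.1 q.2 hq).1 (hT q.1 q.2 hq).2

lemma integrable_uncurry (hG : IsTestSource G) :
    Integrable (Function.uncurry G) (volume.prod volume) :=
  memLp_one_iff_integrable.1 (hG.memLp_uncurry 1)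

lemma memLp_plane (hG : IsTestSource G) (ω : sphere (0 : R3) 1) (t r : ℝ) (p : ℝ≥0∞) :
    MemLp (fun y : Plane ω => G t (dirCoord ω (r, y))) p := by
  obtain ⟨M, hM⟩ := hG.bounded
  obtain ⟨T, hT⟩ := hG.support
  refine memLp_of_bounded_of_support (T := T) ((hG.measurable_slice t).comp
    ((dirCoord ω).measurable.comp measurable_prodMk_left)).aestronglyMeasurable
    (fun y => hM t _) fun y hy => le_trans ?_ (hT t _ hy).2
  refine le_of_sq_le_sq ?_ (norm_nonneg _)
  rw [norm_sq_dirCoord]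
  nlinarith [sq_nonneg r]

lemma mul_of_bounded (hG : IsTestSource G) {m : ℝ → R3 → ℂ}
    (hm : Measurable (Function.uncurry m)) {C : ℝ} (hC : ∀ t x, ‖m t x‖ ≤ C) :
    IsTestSource fun t x => m t x * G t x := by
  obtain ⟨M, hM⟩ := hG.bounded
  obtain ⟨T, hT⟩ := hG.support
  refine ⟨hm.mul hG.measurable, ⟨C * M, fun t x => ?_⟩, ⟨T, fun t x hx => hT t x ?_⟩⟩
  · rw [norm_mul]
    exact mul_le_mul (hC t x) (hM t x) (norm_nonneg _) ((norm_nonneg _).trans (hC t x))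
  · exact right_ne_zero_of_mul hx

lemma indicator_time (hG : IsTestSource G) {s : Set ℝ} (hs : MeasurableSet s) :
    IsTestSource (s.indicator G) := by
  have h : s.indicator G = fun t x => (s.indicator (fun _ => (1 : ℂ)) t) * G t x := by
    ext t x
    by_cases ht : t ∈ s <;> simp [ht]
  rw [h]
  refine hG.mul_of_bounded (m := fun t _ => s.indicator (fun _ => (1 : ℂ)) t) (C := 1)
    ((measurable_const.indicator hs).comp measurable_fst) fun t x => ?_
  by_cases ht : t ∈ s <;> simp [ht]

lemma conj (hG : IsTestSource G) : IsTestSource fun t x => (starRingEnd ℂ) (G t x) := by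
  obtain ⟨M, hM⟩ := hG.bounded
  obtain ⟨T, hT⟩ := hG.support
  exact ⟨Complex.continuous_conj.measurable.comp hG.measurable,
    ⟨M, fun t x => by simpa using hM t x⟩, ⟨T, fun t x hx => hT t x (by simpa using hx)⟩⟩

lemma sub (hG : IsTestSource G) (hH : IsTestSource H) : IsTestSource fun t x => G t x - H t x := by
  obtain ⟨M, hM⟩ := hG.bounded
  obtain ⟨T, hT⟩ := hG.support
  obtain ⟨M', hM'⟩ := hH.bounded
  obtain ⟨T', hT'⟩ := hH.support
  refine ⟨hG.measurable.sub hH.measurable, ⟨M + M', fun t x =>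
    (norm_sub_le _ _).trans (add_le_add (hM t x) (hM' t x))⟩, ⟨max T T', fun t x hx => ?_⟩⟩
  by_cases h : G t x = 0
  · have h' : H t x ≠ 0 := fun h' => hx (by rw [h, h', sub_zero])
    exact ⟨(hT' t x h').1.trans (le_max_right _ _), (hT' t x h').2.trans (le_max_right _ _)⟩
  · exact ⟨(hT t x h).1.trans (le_max_left _ _), (hT t x h).2.trans (le_max_left _ _)⟩

end IsTestSource

/-! ### The dual Strichartz estimate -/

/-- The symbol of `e^{isΔ}`. -/
noncomputable def backwardPhase (s : ℝ) (ξ : R3) : ℂ :=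
  Complex.exp (-((s * (2 * Real.pi * ‖ξ‖) ^ 2 : ℝ) : ℂ) * Complex.I)

lemma norm_backwardPhase (s : ℝ) (ξ : R3) : ‖backwardPhase s ξ‖ = 1 := by
  rw [backwardPhase, ← Complex.ofReal_neg, Complex.norm_exp_ofReal_mul_I]

lemma continuous_backwardPhase : Continuous (Function.uncurry backwardPhase) := by
  unfold backwardPhase Function.uncurry
  fun_prop

/-- The Fourier transform of `e^{isΔ} G(s)`. -/
noncomputable def profile (G : ℝ → R3 → ℂ) (s : ℝ) (ξ : R3) : ℂ :=
  backwardPhase s ξ * 𝓕 (G s) ξ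

lemma measurable_fourier_parametric {Z V : Type*} [MeasurableSpace Z] [NormedAddCommGroup V]
    [InnerProductSpace ℝ V] [FiniteDimensional ℝ V] [MeasurableSpace V] [BorelSpace V]
    {G : Z → V → ℂ} (hG : Measurable (Function.uncurry G)) :
    Measurable fun p : Z × V => 𝓕 (G p.1) p.2 := by
  have h : StronglyMeasurable fun q : (Z × V) × V => Real.fourierChar (-inner ℝ q.2 q.1.2)
      • G q.1.1 q.2 := by
    refine Measurable.stronglyMeasurable ?_
    have h1 : Measurable fun q : (Z × V) × V =>
        ((Real.fourierChar (-inner ℝ q.2 q.1.2) : Circle) : ℂ) :=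
      (continuous_subtype_val.comp Real.continuous_fourierChar).measurable.comp
        ((measurable_snd.inner (measurable_snd.comp measurable_fst)).neg)
    have h2 : Measurable fun q : (Z × V) × V => G q.1.1 q.2 :=
      hG.comp ((measurable_fst.comp measurable_fst).prodMk measurable_snd)
    exact h1.smul h2
  simp_rw [Real.fourier_eq]
  exact h.integral_prod_right'.measurable

lemma IsTestSource.measurable_profile {G : ℝ → R3 → ℂ} (hG : IsTestSource G) :
    Measurable (Function.uncurry (profile G)) :=
  continuous_backwardPhase.measurable.mul (measurable_fourier_parametric hG.measurable)

lemma enorm_profile (G : ℝ → R3 → ℂ) (s : ℝ) (ξ : R3) : ‖profile G s ξ‖ₑ = ‖𝓕 (G s) ξ‖ₑ := by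
  rw [enorm_eq_iff_norm_eq, profile, norm_mul, norm_backwardPhase, one_mul]

lemma norm_profile_le (F : ℝ → R3 → ℂ) (s : ℝ) (ξ : R3) : ‖profile F s ξ‖ ≤ ∫ x, ‖F s x‖ := by
  rw [profile, norm_mul, norm_backwardPhase, one_mul, Real.fourier_eq]
  refine (norm_integral_le_integral_norm _).trans (le_of_eq ?_)
  simp

/-- The one-dimensional space-time density whose extension is the restriction of the dual
Schrödinger evolution to the line of frequencies `ρ ω + η`, `ρ ∈ ℝ`. -/
noncomputable def lineDensity (ω : sphere (0 : R3) 1) (G : ℝ → R3 → ℂ) (η : Plane ω)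
    (z : ℝ × ℝ) : ℂ :=
  Complex.exp (-((4 * Real.pi ^ 2 * ‖η‖ ^ 2 * z.1 : ℝ) : ℂ) * Complex.I)
    * 𝓕 (fun y : Plane ω => G z.1 (dirCoord ω (z.2, y))) η

lemma enorm_lineDensity (ω : sphere (0 : R3) 1) (G : ℝ → R3 → ℂ) (η : Plane ω) (z : ℝ × ℝ) :
    ‖lineDensity ω G η z‖ₑ = ‖𝓕 (fun y : Plane ω => G z.1 (dirCoord ω (z.2, y))) η‖ₑ := by
  rw [enorm_eq_iff_norm_eq, lineDensity, norm_mul, ← Complex.ofReal_neg,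
    Complex.norm_exp_ofReal_mul_I, one_mul]

lemma measurable_planeSlices (ω : sphere (0 : R3) 1) {G : ℝ → R3 → ℂ} (hG : IsTestSource G) :
    Measurable (Function.uncurry fun (z : ℝ × ℝ) (y : Plane ω) =>
      G z.1 (dirCoord ω (z.2, y))) :=
  hG.measurable.comp ((measurable_fst.comp measurable_fst).prodMk ((dirCoord ω).measurable.comp
    ((measurable_snd.comp measurable_fst).prodMk measurable_snd)))

lemma integrable_planeSlices (ω : sphere (0 : R3) 1) {G : ℝ → R3 → ℂ} (hG : IsTestSource G) :
    Integrable (Function.uncurry fun (z : ℝ × ℝ) (y : Plane ω) => G z.1 (dirCoord ω (z.2, y)))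
      (volume.prod volume) := by
  have h1 : MeasurePreserving (fun q : ℝ × (ℝ × Plane ω) => (q.1, dirCoord ω q.2))
      (volume.prod (volume.prod volume)) (volume.prod volume) :=
    (MeasurePreserving.id volume).prod (measurePreserving_dirCoord ω)
  have h2 := measurePreserving_prodAssoc (volume : Measure ℝ) (volume : Measure ℝ)
    (volume : Measure (Plane ω))
  exact (h1.comp h2).integrable_comp_of_integrable hG.integrable_uncurry

lemma integrable_lineDensity (ω : sphere (0 : R3) 1) {G : ℝ → R3 → ℂ} (hG : IsTestSource G)
    (η : Plane ω) : Integrable (lineDensity ω G η) := by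
  have hm : Measurable (lineDensity ω G η) := by
    have h1 := (measurable_fourier_parametric (measurable_planeSlices ω hG)).comp
      (measurable_prodMk_right (y := η))
    have h2 : Measurable fun z : ℝ × ℝ =>
      Complex.exp (-((4 * Real.pi ^ 2 * ‖η‖ ^ 2 * z.1 : ℝ) : ℂ) * Complex.I) := by fun_prop
    exact h2.mul h1
  refine (integrable_planeSlices ω hG).norm.integral_prod_left.mono hm.aestronglyMeasurable
    (Filter.Eventually.of_forall fun z => ?_)
  rw [Real.norm_of_nonneg (integral_nonneg fun y => norm_nonneg _)]
  rw [← toReal_enorm, enorm_lineDensity, toReal_enorm, Real.fourier_eq]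
  refine (norm_integral_le_integral_norm _).trans (le_of_eq ?_)
  simp [Function.uncurry]

lemma integral_profile_dirCoord (ω : sphere (0 : R3) 1) {G : ℝ → R3 → ℂ} (hG : IsTestSource G)
    (ρ : ℝ) (η : Plane ω) :
    ∫ s, profile G s (dirCoord ω (ρ, η)) = ∫ z, extensionPhase ρ z * lineDensity ω G η z := by
  have hint : Integrable (fun z => extensionPhase ρ z * lineDensity ω G η z)
      (volume.prod volume) :=
    (integrable_lineDensity ω hG η).bdd_mul (c := 1) (measurable_extensionPhase.comp
      measurable_prodMk_left).aestronglyMeasurable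
      (Filter.Eventually.of_forall fun z => (norm_extensionPhase ρ z).le)
  rw [Measure.volume_eq_prod, integral_prod _ hint]
  refine integral_congr_ae (Filter.Eventually.of_forall fun s => ?_)
  have h1 : 𝓕 (G s) (dirCoord ω (ρ, η)) = ∫ r, Real.fourierChar (-(r * ρ))
      • 𝓕 (fun y : Plane ω => G s (dirCoord ω (r, y))) η := by
    rw [Real.fourier_eq, ← (measurePreserving_dirCoord ω).integral_comp'
      (g := fun x => Real.fourierChar (-inner ℝ x (dirCoord ω (ρ, η))) • G s x)]
    rw [integral_prod]
    · refine integral_congr_ae (Filter.Eventually.of_forall fun r => ?_)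
      dsimp only
      simp only [Real.fourier_eq, Circle.smul_def]
      rw [← integral_smul]
      refine integral_congr_ae (Filter.Eventually.of_forall fun y => ?_)
      dsimp only
      rw [inner_dirCoord, neg_add, AddChar.map_add_eq_mul, Circle.coe_mul, mul_smul]
    · refine (measurePreserving_dirCoord ω).integrable_comp_of_integrable
        (g := fun x => Real.fourierChar (-inner ℝ x (dirCoord ω (ρ, η))) • G s x) ?_
      exact (Real.fourierIntegral_convergent_iff _).2 (hG.integrable_slice s)
  simp only [profile, h1]
  rw [← integral_const_mul]
  refine integral_congr_ae (Filter.Eventually.of_forall fun r => ?_)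
  simp only [extensionPhase, lineDensity, backwardPhase, Circle.smul_def, Real.fourierChar_apply,
    smul_eq_mul, mul_pow, norm_sq_dirCoord, ← mul_assoc, ← Complex.exp_add]
  congr 2
  push_cast
  ring

lemma lintegral_double_kernel_swap {Z V : Type*} [MeasurableSpace Z] [MeasurableSpace V]
    {μ : Measure Z} [SFinite μ] {ν : Measure V} [SFinite ν] {κ : Z → Z → ℝ≥0∞}
    (hκ : Measurable (Function.uncurry κ)) {P : Z → V → ℝ≥0∞}
    (hP : Measurable (Function.uncurry P)) :
    ∫⁻ η, ∫⁻ z, ∫⁻ z', κ z z' * (P z η * P z' η) ∂μ ∂μ ∂ν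
      = ∫⁻ z, ∫⁻ z', κ z z' * ∫⁻ η, P z η * P z' η ∂ν ∂μ ∂μ := by
  have hm3 : Measurable fun q : (V × Z) × Z => κ q.1.2 q.2 * (P q.1.2 q.1.1 * P q.2 q.1.1) := by
    have h1 := hκ.comp ((measurable_snd.comp measurable_fst).prodMk measurable_snd :
      Measurable fun q : (V × Z) × Z => (q.1.2, q.2))
    have h2 := hP.comp ((measurable_snd.comp measurable_fst).prodMk
      (measurable_fst.comp measurable_fst) : Measurable fun q : (V × Z) × Z => (q.1.2, q.1.1))
    have h3 := hP.comp (measurable_snd.prodMk (measurable_fst.comp measurable_fst) :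
      Measurable fun q : (V × Z) × Z => (q.2, q.1.1))
    exact h1.mul (h2.mul h3)
  rw [lintegral_lintegral_swap hm3.lintegral_prod_right'.aemeasurable]
  refine lintegral_congr fun z => ?_
  have hz := hm3.comp ((measurable_fst.prodMk measurable_const).prodMk measurable_snd :
    Measurable fun q : V × Z => ((q.1, z), q.2))
  have hsw := lintegral_lintegral_swap (μ := ν) (ν := μ)
    (f := fun η z' => κ z z' * (P z η * P z' η)) hz.aemeasurable
  rw [hsw]
  refine lintegral_congr fun z' => ?_
  have h4 : Measurable fun η => P z η * P z' η :=
    (hP.comp measurable_prodMk_left).mul (hP.comp measurable_prodMk_left)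
  rw [lintegral_const_mul _ h4]

lemma lintegral_timeKernel {Y : ℝ × ℝ → ℝ≥0∞} (hY : Measurable Y) :
    ∫⁻ z : ℝ × ℝ, ∫⁻ z' : ℝ × ℝ, ‖z.1 - z'.1‖ₑ ^ (-(1 / 2) : ℝ) * (Y z * Y z')
      = ∫⁻ s, ∫⁻ s', ‖s - s'‖ₑ ^ (-(1 / 2) : ℝ)
          * ((∫⁻ r, Y (s, r)) * (∫⁻ r, Y (s', r))) := by
  have hs : ∀ s, Measurable fun r => Y (s, r) := fun s => hY.comp measurable_prodMk_left
  have hYi : Measurable fun s => ∫⁻ r, Y (s, r) := hY.lintegral_prod_right'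
  have mk : Measurable fun p : ℝ × ℝ => ‖p.1 - p.2‖ₑ ^ (-(1 / 2) : ℝ) := by fun_prop
  have mks : ∀ s, Measurable fun s' : ℝ => ‖s - s'‖ₑ ^ (-(1 / 2) : ℝ) := fun s => by fun_prop
  have hin : ∀ z : ℝ × ℝ,
      ∫⁻ z' : ℝ × ℝ, ‖z.1 - z'.1‖ₑ ^ (-(1 / 2) : ℝ) * (Y z * Y z')
        = (∫⁻ s', ‖z.1 - s'‖ₑ ^ (-(1 / 2) : ℝ) * (∫⁻ r', Y (s', r'))) * Y z := by
    intro z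
    have hm : Measurable fun z' : ℝ × ℝ => ‖z.1 - z'.1‖ₑ ^ (-(1 / 2) : ℝ) * (Y z * Y z') :=
      ((mks z.1).comp measurable_fst).mul (hY.const_mul _)
    have hm' : Measurable fun s' : ℝ => ‖z.1 - s'‖ₑ ^ (-(1 / 2) : ℝ) * ∫⁻ r', Y (s', r') :=
      (mks z.1).mul hYi
    rw [Measure.volume_eq_prod, lintegral_prod _ hm.aemeasurable, ← lintegral_mul_const _ hm']
    refine lintegral_congr fun s' => ?_
    dsimp only
    rw [lintegral_const_mul _ ((hs s').const_mul _), lintegral_const_mul _ (hs s')]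
    ring
  simp_rw [hin]
  have hI : Measurable fun s => ∫⁻ s', ‖s - s'‖ₑ ^ (-(1 / 2) : ℝ) * (∫⁻ r', Y (s', r')) :=
    Measurable.lintegral_prod_right' (f := fun q : ℝ × ℝ =>
      ‖q.1 - q.2‖ₑ ^ (-(1 / 2) : ℝ) * (∫⁻ r', Y (q.2, r'))) (mk.mul (hYi.comp measurable_snd))
  have hm : Measurable fun z : ℝ × ℝ =>
      (∫⁻ s', ‖z.1 - s'‖ₑ ^ (-(1 / 2) : ℝ) * (∫⁻ r', Y (s', r'))) * Y z :=
    (hI.comp measurable_fst).mul hY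
  rw [Measure.volume_eq_prod, lintegral_prod _ hm.aemeasurable]
  refine lintegral_congr fun s => ?_
  have hm' : Measurable fun s' : ℝ => ‖s - s'‖ₑ ^ (-(1 / 2) : ℝ) * ∫⁻ r', Y (s', r') :=
    (mks s).mul hYi
  dsimp only
  rw [lintegral_const_mul _ (hs s), ← lintegral_mul_const _ hm']
  refine lintegral_congr fun s' => ?_
  ring

/-- **Dual Strichartz estimate** `L^{4/3}_t L^1_ω L^2_{ω^⊥} → L²` for the adjoint evolution, stated
on the Fourier side. In the frequency variable dual to `ω` this is the `T T^*` argument with the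
one-dimensional dispersive estimate; in the remaining variables it is Plancherel's theorem. -/
theorem lintegral_enorm_sq_integral_profile_le (ω : sphere (0 : R3) 1) {G : ℝ → R3 → ℂ}
    (hG : IsTestSource G) :
    ∫⁻ ξ, ‖∫ s, profile G s ξ‖ₑ ^ 2 ≤ 12 * dualNorm ω (fun t x => ‖G t x‖ₑ) ^ 2 := by
  set Y : ℝ × ℝ → ℝ≥0∞ := fun z => sliceNorm ω (fun x => ‖G z.1 x‖ₑ) z.2 with hY
  have hYm : Measurable Y :=
    measurable_sliceNorm (g := fun t x => ‖G t x‖ₑ) hG.measurable.enorm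
  have hmA : Measurable fun ξ => ‖∫ s, profile G s ξ‖ₑ ^ 2 := by
    have h := (hG.measurable_profile.comp measurable_swap).stronglyMeasurable.integral_prod_right'
      (ν := (volume : Measure ℝ))
    exact h.measurable.enorm.pow_const 2
  have hL : ∀ z : ℝ × ℝ, ∫⁻ η, ‖𝓕 (fun y : Plane ω => G z.1 (dirCoord ω (z.2, y))) η‖ₑ ^ 2
      = Y z ^ 2 := by
    intro z
    rw [lintegral_enorm_fourier_sq (memLp_one_iff_integrable.1 (hG.memLp_plane ω z.1 z.2 1))
      (hG.memLp_plane ω z.1 z.2 2)]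
    simp only [hY, sliceNorm]
    rw [← ENNReal.rpow_natCast, ← ENNReal.rpow_mul]
    norm_num
  have hFm := measurable_fourier_parametric (measurable_planeSlices ω hG)
  set P : ℝ × ℝ → Plane ω → ℝ≥0∞ := fun z η =>
    ‖𝓕 (fun y : Plane ω => G z.1 (dirCoord ω (z.2, y))) η‖ₑ with hP
  have hPm : Measurable (Function.uncurry P) := hFm.enorm
  have hCS : ∀ z z' : ℝ × ℝ, ∫⁻ η, P z η * P z' η ≤ Y z * Y z' := by
    intro z z'
    have h := ENNReal.lintegral_mul_le_Lp_mul_Lq volume Real.HolderConjugate.two_two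
      (hPm.comp (measurable_prodMk_left (x := z))).aemeasurable
      (hPm.comp (measurable_prodMk_left (x := z'))).aemeasurable
    simp only [Pi.mul_apply, Function.comp, Function.uncurry, ENNReal.rpow_two] at h
    rw [hL z, hL z'] at h
    have e : ∀ c : ℝ≥0∞, (c ^ 2) ^ (1 / 2 : ℝ) = c := fun c => by
      rw [← ENNReal.rpow_natCast, ← ENNReal.rpow_mul]; norm_num
    rwa [e, e] at h
  have mk' : Measurable (Function.uncurry fun z z' : ℝ × ℝ =>
    ‖z.1 - z'.1‖ₑ ^ (-(1 / 2) : ℝ)) := by unfold Function.uncurry; fun_prop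
  calc ∫⁻ ξ, ‖∫ s, profile G s ξ‖ₑ ^ 2
      = ∫⁻ η : Plane ω, ∫⁻ ρ : ℝ, ‖∫ s, profile G s (dirCoord ω (ρ, η))‖ₑ ^ 2 := by
        rw [lintegral_dirCoord ω hmA, lintegral_lintegral_swap]
        exact (hmA.comp (dirCoord ω).measurable).aemeasurable
    _ ≤ ∫⁻ η : Plane ω, ∫⁻ z : ℝ × ℝ, ∫⁻ z' : ℝ × ℝ,
          ‖z.1 - z'.1‖ₑ ^ (-(1 / 2) : ℝ) * (P z η * P z' η) := by
        refine lintegral_mono fun η => ?_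
        simp_rw [integral_profile_dirCoord ω hG]
        refine (lintegral_enorm_sq_extension_le (integrable_lineDensity ω hG η)).trans (le_of_eq ?_)
        simp_rw [enorm_lineDensity]
        rfl
    _ = ∫⁻ z : ℝ × ℝ, ∫⁻ z' : ℝ × ℝ, ‖z.1 - z'.1‖ₑ ^ (-(1 / 2) : ℝ)
          * ∫⁻ η : Plane ω, P z η * P z' η :=
        lintegral_double_kernel_swap (κ := fun z z' : ℝ × ℝ =>
          ‖z.1 - z'.1‖ₑ ^ (-(1 / 2) : ℝ)) mk' hPm
    _ ≤ ∫⁻ z : ℝ × ℝ, ∫⁻ z' : ℝ × ℝ, ‖z.1 - z'.1‖ₑ ^ (-(1 / 2) : ℝ) * (Y z * Y z') := by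
        refine lintegral_mono fun z => lintegral_mono fun z' => ?_
        dsimp only
        gcongr
        exact hCS z z'
    _ = ∫⁻ s, ∫⁻ s', ‖s - s'‖ₑ ^ (-(1 / 2) : ℝ)
          * ((∫⁻ r, Y (s, r)) * (∫⁻ r, Y (s', r))) := lintegral_timeKernel hYm
    _ ≤ 12 * (∫⁻ s, (∫⁻ r, Y (s, r)) ^ (4 / 3 : ℝ)) ^ (3 / 2 : ℝ) :=
        hardyLittlewoodSobolev hYm.lintegral_prod_right'
    _ = _ := by
        rw [dualNorm, ← ENNReal.rpow_natCast, ← ENNReal.rpow_mul]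
        norm_num
        rfl

/-! ### The retarded bilinear form -/

section RetardedForm

variable {X : Type*} [MeasurableSpace X] {μ : Measure X} {a b : ℝ → X → ℂ}

lemma lintegral_enorm_conj_mul_le {f g : X → ℂ} (hf : AEMeasurable f μ) (hg : AEMeasurable g μ) :
    ∫⁻ x, ‖(starRingEnd ℂ) (f x) * g x‖ₑ ∂μ
      ≤ (∫⁻ x, ‖f x‖ₑ ^ 2 ∂μ) ^ (1 / 2 : ℝ) * (∫⁻ x, ‖g x‖ₑ ^ 2 ∂μ) ^ (1 / 2 : ℝ) := by
  have h := ENNReal.lintegral_mul_le_Lp_mul_Lq μ Real.HolderConjugate.two_two hf.enorm hg.enorm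
  simp only [Pi.mul_apply, ENNReal.rpow_two] at h
  refine le_trans (le_of_eq ?_) h
  refine lintegral_congr fun x => ?_
  rw [enorm_mul]
  congr 1
  rw [enorm_eq_iff_norm_eq]
  exact RCLike.norm_conj _

lemma enorm_integral_conj_mul_le {f g : X → ℂ} (hf : AEMeasurable f μ) (hg : AEMeasurable g μ) :
    ‖∫ x, (starRingEnd ℂ) (f x) * g x ∂μ‖ₑ
      ≤ (∫⁻ x, ‖f x‖ₑ ^ 2 ∂μ) ^ (1 / 2 : ℝ) * (∫⁻ x, ‖g x‖ₑ ^ 2 ∂μ) ^ (1 / 2 : ℝ) :=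
  (enorm_integral_le_lintegral_enorm _).trans (lintegral_enorm_conj_mul_le hf hg)

/-- The interaction at times `t` and `s`. -/
noncomputable def timeCorrelation (μ : Measure X) (a b : ℝ → X → ℂ) (t s : ℝ) : ℂ :=
  ∫ x, (starRingEnd ℂ) (b t x) * a s x ∂μ

lemma measurable_timeCorrelation_integrand (ha : Measurable (Function.uncurry a))
    (hb : Measurable (Function.uncurry b)) :
    Measurable fun q : (ℝ × ℝ) × X => (starRingEnd ℂ) (b q.1.1 q.2) * a q.1.2 q.2 := by
  have h1 := ha.comp ((measurable_snd.comp measurable_fst).prodMk measurable_snd :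
    Measurable fun q : (ℝ × ℝ) × X => (q.1.2, q.2))
  have h2 := hb.comp ((measurable_fst.comp measurable_fst).prodMk measurable_snd :
    Measurable fun q : (ℝ × ℝ) × X => (q.1.1, q.2))
  exact (Complex.continuous_conj.measurable.comp h2).mul h1

lemma stronglyMeasurable_timeCorrelation [SFinite μ]
    (ha : Measurable (Function.uncurry a))
    (hb : Measurable (Function.uncurry b)) :
    StronglyMeasurable (Function.uncurry (timeCorrelation μ a b)) :=
  (measurable_timeCorrelation_integrand ha hb).stronglyMeasurable.integral_prod_right'

lemma norm_timeCorrelation_le (ha : Measurable (Function.uncurry a))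
    (hb : Measurable (Function.uncurry b)) {Ma Mb : ℝ≥0}
    (hMa : ∀ s, (∫⁻ x, ‖a s x‖ₑ ^ 2 ∂μ) ^ (1 / 2 : ℝ) ≤ Ma)
    (hMb : ∀ s, (∫⁻ x, ‖b s x‖ₑ ^ 2 ∂μ) ^ (1 / 2 : ℝ) ≤ Mb) (t s : ℝ) :
    ‖timeCorrelation μ a b t s‖ ≤ Mb * Ma := by
  have h := enorm_integral_conj_mul_le (μ := μ)
    (hb.comp (measurable_prodMk_left (x := t))).aemeasurable
    (ha.comp (measurable_prodMk_left (x := s))).aemeasurable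
  have h2 := h.trans (mul_le_mul' (hMb t) (hMa s))
  rw [← ENNReal.coe_mul, enorm_le_coe] at h2
  exact_mod_cast h2

lemma intervalIntegrable_timeCorrelation [SFinite μ]
    (ha : Measurable (Function.uncurry a))
    (hb : Measurable (Function.uncurry b)) {Ma Mb : ℝ≥0}
    (hMa : ∀ s, (∫⁻ x, ‖a s x‖ₑ ^ 2 ∂μ) ^ (1 / 2 : ℝ) ≤ Ma)
    (hMb : ∀ s, (∫⁻ x, ‖b s x‖ₑ ^ 2 ∂μ) ^ (1 / 2 : ℝ) ≤ Mb) (t p q : ℝ) :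
    IntervalIntegrable (timeCorrelation μ a b t) volume p q := by
  rw [intervalIntegrable_iff]
  refine IntegrableOn.of_bound (by simp) ((stronglyMeasurable_timeCorrelation ha hb).comp_measurable
    measurable_prodMk_left).aestronglyMeasurable (Mb * Ma) (Filter.Eventually.of_forall fun s =>
    norm_timeCorrelation_le ha hb hMa hMb t s)

/-- The interaction at time `t` with an interval of times. -/
lemma integral_timeCorrelation [SFinite μ] (ha : Measurable (Function.uncurry a))
    (hb : Measurable (Function.uncurry b)) {Ma Mb : ℝ≥0}
    (hMa : ∀ s, (∫⁻ x, ‖a s x‖ₑ ^ 2 ∂μ) ^ (1 / 2 : ℝ) ≤ Ma)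
    (hMb : ∀ s, (∫⁻ x, ‖b s x‖ₑ ^ 2 ∂μ) ^ (1 / 2 : ℝ) ≤ Mb) {t p q : ℝ} (hpq : p ≤ q) :
    ∫ s in p..q, timeCorrelation μ a b t s
      = ∫ x, (starRingEnd ℂ) (b t x) * (∫ s in p..q, a s x) ∂μ := by
  have hmeas : Measurable fun z : ℝ × X => (starRingEnd ℂ) (b t z.2) * a z.1 z.2 :=
    (measurable_timeCorrelation_integrand ha hb).comp
      ((measurable_const.prodMk measurable_fst).prodMk measurable_snd)
  have hint : Integrable (Function.uncurry fun s x => (starRingEnd ℂ) (b t x) * a s x)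
      ((volume.restrict (Ioc p q)).prod μ) := by
    refine ⟨hmeas.aestronglyMeasurable, ?_⟩
    rw [hasFiniteIntegral_iff_enorm]
    have e := lintegral_prod (μ := volume.restrict (Ioc p q)) (ν := μ)
      (fun z : ℝ × X => ‖(starRingEnd ℂ) (b t z.2) * a z.1 z.2‖ₑ) hmeas.enorm.aemeasurable
    refine lt_of_le_of_lt (le_of_eq e) ?_
    calc _ ≤ ∫⁻ s in Ioc p q, ((Mb : ℝ≥0∞) * Ma) := lintegral_mono fun s =>
          (lintegral_enorm_conj_mul_le (hb.comp (measurable_prodMk_left (x := t))).aemeasurable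
            (ha.comp (measurable_prodMk_left (x := s))).aemeasurable).trans
            (mul_le_mul' (hMb _) (hMa _))
      _ < ∞ := by
        rw [lintegral_const]
        exact ENNReal.mul_lt_top (ENNReal.mul_lt_top ENNReal.coe_lt_top ENNReal.coe_lt_top)
          (measure_lt_top _ univ)
  rw [intervalIntegral.integral_of_le hpq]
  unfold timeCorrelation
  rw [integral_integral_swap hint]
  refine integral_congr_ae (Filter.Eventually.of_forall fun x => ?_)
  dsimp only
  rw [integral_const_mul, intervalIntegral.integral_of_le hpq]

/-- The time integrals of the correlation over a product of intervals decouple. -/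
lemma integral_integral_timeCorrelation [SFinite μ]
    (ha : Measurable (Function.uncurry a))
    (hb : Measurable (Function.uncurry b)) {Ma Mb : ℝ≥0}
    (hMa : ∀ s, (∫⁻ x, ‖a s x‖ₑ ^ 2 ∂μ) ^ (1 / 2 : ℝ) ≤ Ma)
    (hMb : ∀ s, (∫⁻ x, ‖b s x‖ₑ ^ 2 ∂μ) ^ (1 / 2 : ℝ) ≤ Mb)
    {p q p' q' : ℝ} (hpq : p ≤ q) (hpq' : p' ≤ q') :
    ∫ t in p'..q', ∫ s in p..q, timeCorrelation μ a b t s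
      = ∫ x, (starRingEnd ℂ) (∫ t in p'..q', b t x) * (∫ s in p..q, a s x) ∂μ := by
  set m := (volume.restrict (Ioc p' q')).prod (volume.restrict (Ioc p q)) with hm
  have hint : Integrable (Function.uncurry fun (z : ℝ × ℝ) (x : X) =>
      (starRingEnd ℂ) (b z.1 x) * a z.2 x) (m.prod μ) := by
    have hmeas := measurable_timeCorrelation_integrand ha hb
    refine ⟨hmeas.aestronglyMeasurable, ?_⟩
    rw [hasFiniteIntegral_iff_enorm]
    have e := lintegral_prod (μ := m) (ν := μ)
      (fun q : (ℝ × ℝ) × X => ‖(starRingEnd ℂ) (b q.1.1 q.2) * a q.1.2 q.2‖ₑ)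
      hmeas.enorm.aemeasurable
    refine lt_of_le_of_lt (le_of_eq e) ?_
    calc _ ≤ ∫⁻ z : ℝ × ℝ, ((Mb : ℝ≥0∞) * Ma) ∂m := lintegral_mono fun z =>
          (lintegral_enorm_conj_mul_le (hb.comp (measurable_prodMk_left (x := z.1))).aemeasurable
            (ha.comp (measurable_prodMk_left (x := z.2))).aemeasurable).trans
            (mul_le_mul' (hMb _) (hMa _))
      _ < ∞ := by
        rw [lintegral_const]
        exact ENNReal.mul_lt_top (ENNReal.mul_lt_top ENNReal.coe_lt_top ENNReal.coe_lt_top)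
          (measure_lt_top m univ)
  have h1 : ∫ t in p'..q', ∫ s in p..q, timeCorrelation μ a b t s
      = ∫ z : ℝ × ℝ, ∫ x, (starRingEnd ℂ) (b z.1 x) * a z.2 x ∂μ ∂m := by
    have h0 : Integrable (fun z : ℝ × ℝ => ∫ x, (starRingEnd ℂ) (b z.1 x) * a z.2 x ∂μ) m :=
      hint.integral_prod_left
    rw [integral_prod (μ := volume.restrict (Ioc p' q')) (ν := volume.restrict (Ioc p q)) _ h0,
      intervalIntegral.integral_of_le hpq']
    refine integral_congr_ae (Filter.Eventually.of_forall fun t => ?_)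
    dsimp only
    rw [intervalIntegral.integral_of_le hpq]
    rfl
  rw [h1, integral_integral_swap hint]
  refine integral_congr_ae (Filter.Eventually.of_forall fun x => ?_)
  dsimp only
  rw [hm, integral_prod_mul (fun t => (starRingEnd ℂ) (b t x)) fun s => a s x, integral_conj,
    intervalIntegral.integral_of_le hpq, intervalIntegral.integral_of_le hpq']

/-- Square-function bounds for `∫ a` and `∫ b` over all time intervals bound the retarded form. -/
lemma norm_retarded_form_le [SFinite μ]
    (ha : Measurable (Function.uncurry a))
    (hb : Measurable (Function.uncurry b)) {Ma Mb : ℝ≥0}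
    (hMa : ∀ s, (∫⁻ x, ‖a s x‖ₑ ^ 2 ∂μ) ^ (1 / 2 : ℝ) ≤ Ma)
    (hMb : ∀ s, (∫⁻ x, ‖b s x‖ₑ ^ 2 ∂μ) ^ (1 / 2 : ℝ) ≤ Mb)
    {w v : ℝ → ℝ} (hw : ∀ p q, IntervalIntegrable w volume p q)
    (hv : ∀ p q, IntervalIntegrable v volume p q) (hw0 : ∀ s, 0 ≤ w s) (hv0 : ∀ s, 0 ≤ v s)
    {A : ℝ} (hA : 0 ≤ A)
    (hIa : ∀ p q, p ≤ q → (∫⁻ x, ‖∫ s in p..q, a s x‖ₑ ^ 2 ∂μ) ^ (1 / 2 : ℝ)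
      ≤ ENNReal.ofReal (A * (∫ s in p..q, w s) ^ (3 / 4 : ℝ)))
    (hIb : ∀ p q, p ≤ q → (∫⁻ x, ‖∫ s in p..q, b s x‖ₑ ^ 2 ∂μ) ^ (1 / 2 : ℝ)
      ≤ ENNReal.ofReal (A * (∫ s in p..q, v s) ^ (3 / 4 : ℝ))) {p q : ℝ} (hpq : p ≤ q) :
    ‖∫ t in p..q, ∫ s in p..t, timeCorrelation μ a b t s‖
      ≤ 4 * A ^ 2 * (∫ s in p..q, w s) ^ (3 / 4 : ℝ) * (∫ s in p..q, v s) ^ (3 / 4 : ℝ) := by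
  have hwi : ∀ p q, p ≤ q → 0 ≤ ∫ s in p..q, w s := fun p q h =>
    intervalIntegral.integral_nonneg h fun s _ => hw0 s
  have hvi : ∀ p q, p ≤ q → 0 ≤ ∫ s in p..q, v s := fun p q h =>
    intervalIntegral.integral_nonneg h fun s _ => hv0 s
  have hk := intervalIntegrable_timeCorrelation ha hb hMa hMb
  have hkm := stronglyMeasurable_timeCorrelation (μ := μ) ha hb
  have hkb := norm_timeCorrelation_le ha hb hMa hMb
  have hbound : ∀ p t, p ≤ t → ‖∫ s in p..t, timeCorrelation μ a b t s‖ ≤ Mb * Ma * (t - p) := by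
    intro p t hpt
    have := intervalIntegral.norm_integral_le_of_norm_le_const (a := p) (b := t)
      fun s _ => hkb t s
    rwa [abs_of_nonneg (by linarith)] at this
  -- measurability of the inner integral in the outer time
  have hmeas : ∀ p, AEStronglyMeasurable (fun t => ∫ s in p..t, timeCorrelation μ a b t s)
      volume := by
    intro p
    have h1 : ∀ t u v : ℝ, (∫ s in Ioc u v, timeCorrelation μ a b t s)
        = ∫ s, (Ioc u v).indicator (timeCorrelation μ a b t) s := fun t u v =>
      (integral_indicator measurableSet_Ioc).symm
    simp only [intervalIntegral, h1]
    refine StronglyMeasurable.aestronglyMeasurable (StronglyMeasurable.sub ?_ ?_)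
    · have hs : MeasurableSet {z : ℝ × ℝ | p < z.2 ∧ z.2 ≤ z.1} :=
        (measurableSet_lt measurable_const measurable_snd).inter
          (measurableSet_le measurable_snd measurable_fst)
      exact (hkm.indicator hs).integral_prod_right'
    · have hs : MeasurableSet {z : ℝ × ℝ | z.1 < z.2 ∧ z.2 ≤ p} :=
        (measurableSet_lt measurable_fst measurable_snd).inter
          (measurableSet_le measurable_snd measurable_const)
      exact (hkm.indicator hs).integral_prod_right'
  have hout : ∀ p c q, p ≤ c → c ≤ q →
      IntervalIntegrable (fun t => ∫ s in p..t, timeCorrelation μ a b t s) volume c q := by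
    intro p c q hpc hcq
    rw [intervalIntegrable_iff_integrableOn_Ioc_of_le hcq]
    refine IntegrableOn.of_bound (by simp) (hmeas p).restrict (Mb * Ma * (q - p))
      ((ae_restrict_mem measurableSet_Ioc).mono fun t ht => ?_)
    refine (hbound p t (hpc.trans ht.1.le)).trans ?_
    have := ht.2
    gcongr
  refine christKiselev (B := fun p q => ∫ t in p..q, ∫ s in p..t, timeCorrelation μ a b t s)
    (E := fun p c q => ∫ t in c..q, ∫ s in p..c, timeCorrelation μ a b t s)
    (M := Mb * Ma) hw hv hw0 hv0 (by positivity) (by positivity) ?_ ?_ ?_ hpq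
  · intro p c q hpc hcq
    rw [← intervalIntegral.integral_add_adjacent_intervals (hout p p c le_rfl hpc)
      (hout p c q hpc hcq), add_assoc]
    congr 1
    rw [← intervalIntegral.integral_add (hout c c q le_rfl hcq)]
    · refine intervalIntegral.integral_congr fun t _ => ?_
      rw [add_comm, intervalIntegral.integral_add_adjacent_intervals (hk t p c) (hk t c t)]
    · have hd := (hout p c q hpc hcq).sub (hout c c q le_rfl hcq)
      refine hd.congr fun t _ => ?_
      rw [← intervalIntegral.integral_add_adjacent_intervals (hk t p c) (hk t c t)]
      ring
  · intro p c q hpc hcq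
    rw [integral_integral_timeCorrelation ha hb hMa hMb hpc hcq]
    have hma : AEMeasurable (fun x => ∫ s in p..c, a s x) μ := by
      simp only [intervalIntegral.integral_of_le hpc]
      exact (ha.comp measurable_swap).stronglyMeasurable.integral_prod_right'.measurable.aemeasurable
    have hmb : AEMeasurable (fun x => ∫ t in c..q, b t x) μ := by
      simp only [intervalIntegral.integral_of_le hcq]
      exact (hb.comp measurable_swap).stronglyMeasurable.integral_prod_right'.measurable.aemeasurable
    have h := (enorm_integral_conj_mul_le hmb hma).trans (mul_le_mul' (hIb c q hcq) (hIa p c hpc))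
    have h1 := hwi p c hpc
    have h2 := hvi c q hcq
    rw [← ENNReal.ofReal_mul (by positivity), ← ofReal_norm,
      ENNReal.ofReal_le_ofReal_iff (by positivity)] at h
    refine h.trans (le_of_eq ?_)
    ring
  · intro p q hpq
    have := intervalIntegral.norm_integral_le_of_norm_le_const (a := p) (b := q)
      (f := fun t => ∫ s in p..t, timeCorrelation μ a b t s) (C := Mb * Ma * (q - p)) fun t ht => by
        rw [uIoc_of_le hpq] at ht
        refine (hbound p t ht.1.le).trans ?_
        have := ht.2
        gcongr
    rw [abs_of_nonneg (by linarith)] at this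
    refine this.trans (le_of_eq ?_)
    ring

end RetardedForm

/-! ### The norm of `L^4_t L^∞_ω L^2_{ω^⊥}` by duality -/

/-- The norm of `L^4_t L^∞_ω L^2_{ω^⊥}` of a nonnegative function. -/
noncomputable def strichartzNorm (ω : sphere (0 : R3) 1) (h : ℝ → R3 → ℝ≥0∞) : ℝ≥0∞ :=
  (∫⁻ t, essSup (sliceNorm ω (h t)) volume ^ (4 : ℝ)) ^ (1 / 4 : ℝ)

lemma lt_essSup_iff {α : Type*} {m : MeasurableSpace α} {μ : Measure α} {f : α → ℝ≥0∞}
    {c : ℝ≥0∞} : c < essSup f μ ↔ μ {x | c < f x} ≠ 0 := by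
  rw [← not_le, not_iff_comm, not_not]
  constructor
  · intro h
    refine essSup_le_of_ae_le c ?_
    rw [Filter.EventuallyLE, ae_iff]
    simpa using h
  · intro h
    have h1 : ∀ᵐ x ∂μ, f x ≤ c := by
      filter_upwards [ae_le_essSup (f := f) (μ := μ)] with x hx using hx.trans h
    rw [ae_iff] at h1
    simpa using h1

lemma measurable_essSup_right {f : ℝ × ℝ → ℝ≥0∞} (hf : Measurable f) :
    Measurable fun t => essSup (fun r => f (t, r)) volume := by
  refine measurable_of_Ioi fun c => ?_
  have h1 : MeasurableSet {p : ℝ × ℝ | c < f p} := measurableSet_lt measurable_const hf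
  have h2 := measurable_measure_prodMk_left (ν := (volume : Measure ℝ)) h1
  have h3 : (fun t => essSup (fun r => f (t, r)) volume) ⁻¹' Ioi c
      = (fun t => volume (Prod.mk t ⁻¹' {p : ℝ × ℝ | c < f p})) ⁻¹' {0}ᶜ := by
    ext t
    simp only [mem_preimage, mem_Ioi, lt_essSup_iff, mem_compl_iff, mem_singleton_iff]
    rfl
  rw [h3]
  exact h2 (measurableSet_singleton 0).compl

section ConverseHolder

variable {ω : sphere (0 : R3) 1} {h : ℝ → R3 → ℝ≥0∞} {M : ℝ≥0∞}

lemma lintegral_mul_le_of_test (hh : Measurable (Function.uncurry h))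
    (htest : ∀ g : ℝ → R3 → ℝ≥0∞, Measurable (Function.uncurry g) →
      (∃ K : ℝ≥0, ∀ t x, g t x ≤ K) → (∃ T : ℝ, ∀ t x, g t x ≠ 0 → |t| ≤ T ∧ ‖x‖ ≤ T) →
      ∫⁻ t, ∫⁻ x, h t x * g t x ≤ M * dualNorm ω g)
    {g : ℝ → R3 → ℝ≥0∞} (hg : Measurable (Function.uncurry g)) (hgt : ∀ t x, g t x ≠ ∞) :
    ∫⁻ t, ∫⁻ x, h t x * g t x ≤ M * dualNorm ω g := by
  set K : ℕ → Set (ℝ × R3) := fun n => {p | g p.1 p.2 ≤ n ∧ |p.1| ≤ n ∧ ‖p.2‖ ≤ n} with hK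
  have hKm : ∀ n, MeasurableSet (K n) := fun n =>
    (measurableSet_le hg measurable_const).inter
      ((measurableSet_le measurable_fst.norm measurable_const).inter
        (measurableSet_le measurable_snd.norm measurable_const))
  set gn : ℕ → ℝ → R3 → ℝ≥0∞ := fun n t x => (K n).indicator (Function.uncurry g) (t, x) with hgn
  have hgnm : ∀ n, Measurable (Function.uncurry (gn n)) := fun n => hg.indicator (hKm n)
  have hle : ∀ n t x, gn n t x ≤ g t x := fun n t x => indicator_le_self _ _ (t, x)
  have hbd : ∀ n, ∫⁻ t, ∫⁻ x, h t x * gn n t x ≤ M * dualNorm ω g := by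
    intro n
    refine (htest (gn n) (hgnm n) ⟨n, fun t x => ?_⟩ ⟨n, fun t x hx => ?_⟩).trans ?_
    · by_cases hm : (t, x) ∈ K n
      · simp only [hgn, indicator_of_mem hm]
        simpa using hm.1
      · simp [hgn, indicator_of_notMem hm]
    · have hm : (t, x) ∈ K n := by
        by_contra hm
        exact hx (by simp [hgn, indicator_of_notMem hm])
      exact hm.2
    · gcongr
      exact dualNorm_mono (hle n)
  have hprod : ∀ f : ℝ → R3 → ℝ≥0∞, Measurable (Function.uncurry f) →
      ∫⁻ t, ∫⁻ x, h t x * f t x = ∫⁻ p : ℝ × R3, h p.1 p.2 * f p.1 p.2 ∂(volume.prod volume) :=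
    fun f hf => (lintegral_prod (fun p : ℝ × R3 => h p.1 p.2 * f p.1 p.2)
      (hh.mul hf).aemeasurable).symm
  have hlim : ∀ p : ℝ × R3, Filter.Tendsto (fun n => h p.1 p.2 * gn n p.1 p.2) Filter.atTop
      (nhds (h p.1 p.2 * g p.1 p.2)) := by
    intro p
    obtain ⟨n, hn⟩ := exists_nat_ge (max (g p.1 p.2).toReal (max |p.1| ‖p.2‖))
    refine tendsto_const_nhds.congr' ((Filter.eventually_ge_atTop n).mono fun k hk => ?_)
    have hkn : (n : ℝ) ≤ k := by exact_mod_cast hk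
    have hm : p ∈ K k := by
      refine ⟨?_, ?_, ?_⟩
      · rw [← ENNReal.ofReal_toReal (hgt p.1 p.2), ← ENNReal.ofReal_natCast]
        exact ENNReal.ofReal_le_ofReal (((le_max_left _ _).trans hn).trans hkn)
      · exact (((le_max_left _ _).trans (le_max_right _ _)).trans hn).trans hkn
      · exact (((le_max_right _ _).trans (le_max_right _ _)).trans hn).trans hkn
    simp only [hgn, indicator_of_mem hm, Function.uncurry]
  rw [hprod g hg]
  calc _ = ∫⁻ p : ℝ × R3, Filter.liminf (fun n => h p.1 p.2 * gn n p.1 p.2) Filter.atTop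
          ∂(volume.prod volume) := lintegral_congr fun p => (hlim p).liminf_eq.symm
    _ ≤ Filter.liminf (fun n => ∫⁻ p : ℝ × R3, h p.1 p.2 * gn n p.1 p.2 ∂(volume.prod volume))
          Filter.atTop := lintegral_liminf_le fun n => hh.mul (hgnm n)
    _ ≤ M * dualNorm ω g := by
        refine Filter.liminf_le_of_le ?_ fun b hb => ?_
        · isBoundedDefault
        · obtain ⟨n, hn⟩ := hb.exists
          rw [← hprod _ (hgnm n)] at hn
          exact hn.trans (hbd n)

/-- The test function is concentrated, for each time `t`, on the set of those `r` at which the slice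
norm exceeds `l t`, and normalized there by a Gaussian probability measure. -/
lemma lintegral_rpow_four_le_of_lt_essSup (hh : Measurable (Function.uncurry h))
    (hhf : ∀ t x, h t x ≠ ∞) (hh2 : ∀ t, ∫⁻ x, h t x ^ 2 ≠ ∞)
    (hall : ∀ g : ℝ → R3 → ℝ≥0∞, Measurable (Function.uncurry g) → (∀ t x, g t x ≠ ∞) →
      ∫⁻ t, ∫⁻ x, h t x * g t x ≤ M * dualNorm ω g)
    {l : ℝ → ℝ≥0∞} (hl : Measurable l)
    (hlt : ∀ t, l t = 0 ∨ l t < essSup (sliceNorm ω (h t)) volume)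
    (hl4 : ∫⁻ t, l t ^ (4 : ℝ) ≠ ∞) :
    (∫⁻ t, l t ^ (4 : ℝ)) ^ (1 / 4 : ℝ) ≤ M := by
  set H : ℝ × ℝ → ℝ≥0∞ := fun p => sliceNorm ω (h p.1) p.2 with hH
  have hHm : Measurable H := measurable_sliceNorm hh
  set E : Set (ℝ × ℝ) := {p | l p.1 < H p} with hE
  have hEm : MeasurableSet E := measurableSet_lt (hl.comp measurable_fst) hHm
  set ν : Measure ℝ := ProbabilityTheory.gaussianReal 0 1 with hν
  set θ : ℝ → ℝ≥0∞ := ProbabilityTheory.gaussianPDF 0 1 with hθ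
  have hθm : Measurable θ := ProbabilityTheory.measurable_gaussianPDF 0 1
  have hνθ : ν = volume.withDensity θ :=
    ProbabilityTheory.gaussianReal_of_var_ne_zero 0 one_ne_zero
  set n : ℝ → ℝ≥0∞ := fun t => ν (Prod.mk t ⁻¹' E) with hn
  have hnm : Measurable n := measurable_measure_prodMk_left hEm
  have hEt : ∀ t, MeasurableSet (Prod.mk t ⁻¹' E) := fun t => measurable_prodMk_left hEm
  have hnθ : ∀ t, n t = ∫⁻ r, (Prod.mk t ⁻¹' E).indicator θ r := fun t => by
    rw [lintegral_indicator (hEt t), hn]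
    simp only
    rw [hνθ, withDensity_apply _ (hEt t)]
  have hn1 : ∀ t, n t ≠ ∞ := fun t => measure_ne_top _ _
  have hn0 : ∀ t, l t ≠ 0 → n t ≠ 0 := fun t ht h0 => by
    have h1 := (hlt t).resolve_left ht
    rw [lt_essSup_iff] at h1
    exact h1 ((ProbabilityTheory.gaussianReal_absolutelyContinuous' 0 one_ne_zero) h0)
  set c : ℝ × ℝ → ℝ≥0∞ := fun p =>
    l p.1 ^ (3 : ℝ) * (n p.1)⁻¹ * (E.indicator (fun p => θ p.2) p * (H p)⁻¹) with hc
  have hcm : Measurable c := by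
    have h1 : Measurable fun p : ℝ × ℝ => l p.1 ^ (3 : ℝ) := (hl.comp measurable_fst).pow_const _
    have h2 : Measurable fun p : ℝ × ℝ => (n p.1)⁻¹ := (hnm.comp measurable_fst).inv
    have h3 : Measurable (E.indicator fun p : ℝ × ℝ => θ p.2) :=
      (hθm.comp measurable_snd).indicator hEm
    exact (h1.mul h2).mul (h3.mul hHm.inv)
  have hctop : ∀ p, c p ≠ ∞ := by
    intro p
    by_cases hp : p ∈ E
    · by_cases hl0 : l p.1 = 0
      · simp [hc, hl0]
      · have h1 : l p.1 ≠ ∞ := ne_top_of_lt hp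
        have h2 : H p ≠ 0 := ne_bot_of_gt hp
        simp only [hc, indicator_of_mem hp]
        refine ENNReal.mul_ne_top (ENNReal.mul_ne_top
          (ENNReal.rpow_ne_top_of_nonneg (by norm_num) h1) (ENNReal.inv_ne_top.2 (hn0 _ hl0)))
          (ENNReal.mul_ne_top ENNReal.ofReal_ne_top (ENNReal.inv_ne_top.2 h2))
    · simp [hc, indicator_of_notMem hp]
  set g : ℝ → R3 → ℝ≥0∞ := fun t x => c (t, inner ℝ (ω : R3) x) * h t x with hg
  have hgm : Measurable (Function.uncurry g) := by
    have h1 : Measurable fun p : ℝ × R3 => (p.1, (inner ℝ (ω : R3) p.2 : ℝ)) := by fun_prop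
    exact (hcm.comp h1).mul hh
  have hhs : ∀ t, Measurable (h t) := fun t => hh.comp measurable_prodMk_left
  have hhp : ∀ t r, Measurable fun y : Plane ω => h t (dirCoord ω (r, y)) ^ 2 := fun t r =>
    ((hhs t).comp ((dirCoord ω).measurable.comp measurable_prodMk_left)).pow_const 2
  have hHsq : ∀ p, H p ^ 2 = ∫⁻ y : Plane ω, h p.1 (dirCoord ω (p.2, y)) ^ 2 := fun p => by
    simp only [hH, sliceNorm]
    rw [← ENNReal.rpow_natCast, ← ENNReal.rpow_mul]
    norm_num
  have hslice : ∀ t r, sliceNorm ω (g t) r = c (t, r) * H (t, r) := by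
    intro t r
    simp only [sliceNorm, hg, inner_direction_dirCoord, mul_pow]
    rw [lintegral_const_mul _ (hhp t r), ENNReal.mul_rpow_of_nonneg _ _ (by norm_num),
      ← ENNReal.rpow_natCast, ← ENNReal.rpow_mul]
    norm_num
    rfl
  have hnorm : dualNorm ω g ≤ (∫⁻ t, l t ^ (4 : ℝ)) ^ (3 / 4 : ℝ) := by
    unfold dualNorm
    gcongr with t
    have h1 : ∫⁻ r, sliceNorm ω (g t) r ≤ l t ^ (3 : ℝ) := by
      calc _ ≤ ∫⁻ r, l t ^ (3 : ℝ) * (n t)⁻¹ * (Prod.mk t ⁻¹' E).indicator θ r := by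
            refine lintegral_mono fun r => ?_
            rw [hslice]
            simp only [hc]
            rw [mul_assoc (l t ^ (3 : ℝ) * (n t)⁻¹)]
            gcongr
            rw [mul_assoc]
            calc _ ≤ E.indicator (fun p => θ p.2) (t, r) * 1 := by
                  gcongr; exact ENNReal.inv_mul_le_one _
              _ = _ := by rw [mul_one]; rfl
        _ = l t ^ (3 : ℝ) * ((n t)⁻¹ * n t) := by
            rw [lintegral_const_mul _ (hθm.indicator (hEt t)), ← hnθ, mul_assoc]
        _ ≤ l t ^ (3 : ℝ) * 1 := by gcongr; exact ENNReal.inv_mul_le_one _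
        _ = _ := mul_one _
    calc _ ≤ (l t ^ (3 : ℝ)) ^ (4 / 3 : ℝ) := by gcongr
      _ = _ := by rw [← ENNReal.rpow_mul]; norm_num
  have hpair : ∫⁻ t, l t ^ (4 : ℝ) ≤ ∫⁻ t, ∫⁻ x, h t x * g t x := by
    refine lintegral_mono fun t => ?_
    dsimp only
    have hgs : Measurable (g t) := hgm.comp measurable_prodMk_left
    have hhg : Measurable fun x => h t x * g t x := (hhs t).mul hgs
    rw [lintegral_dirCoord ω hhg]
    have h1 : ∀ r, ∫⁻ y : Plane ω, h t (dirCoord ω (r, y)) * g t (dirCoord ω (r, y))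
        = c (t, r) * H (t, r) ^ 2 := by
      intro r
      rw [hHsq, ← lintegral_const_mul _ (hhp t r)]
      refine lintegral_congr fun y => ?_
      simp only [hg, inner_direction_dirCoord]
      ring
    simp_rw [h1]
    by_cases hl0 : l t = 0
    · simp [hl0]
    have hHfin : ∀ᵐ r, H (t, r) < ∞ := by
      have h2 := hh2 t
      rw [lintegral_dirCoord ω ((hhs t).pow_const 2)] at h2
      have h3 : Measurable fun r => ∫⁻ y : Plane ω, h t (dirCoord ω (r, y)) ^ 2 :=
        (((hhs t).comp (dirCoord ω).measurable).pow_const 2).lintegral_prod_right'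
      filter_upwards [ae_lt_top h3 h2] with r hr
      exact ENNReal.rpow_lt_top_of_nonneg (by norm_num) hr.ne
    calc l t ^ (4 : ℝ) = l t ^ (3 : ℝ) * (n t)⁻¹ * (n t * l t) := by
          have : l t ^ (4 : ℝ) = l t ^ (3 : ℝ) * l t := by
            rw [show (4 : ℝ) = ((4 : ℕ) : ℝ) by norm_num, show (3 : ℝ) = ((3 : ℕ) : ℝ) by norm_num,
              ENNReal.rpow_natCast, ENNReal.rpow_natCast, pow_succ]
          rw [this, mul_assoc, ← mul_assoc (n t)⁻¹, ENNReal.inv_mul_cancel (hn0 t hl0) (hn1 t),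
            one_mul]
      _ = ∫⁻ r, l t ^ (3 : ℝ) * (n t)⁻¹ * ((Prod.mk t ⁻¹' E).indicator θ r * l t) := by
          rw [lintegral_const_mul _ ((hθm.indicator (hEt t)).mul_const _),
            lintegral_mul_const _ (hθm.indicator (hEt t)), ← hnθ]
      _ ≤ ∫⁻ r, c (t, r) * H (t, r) ^ 2 := by
          refine lintegral_mono_ae ?_
          filter_upwards [hHfin] with r hr
          by_cases hm : (t, r) ∈ E
          · have hm' : r ∈ Prod.mk t ⁻¹' E := hm
            simp only [hc, indicator_of_mem hm, indicator_of_mem hm']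
            have hlt' : l t < H (t, r) := hm
            have h4 : (H (t, r))⁻¹ * H (t, r) ^ 2 = H (t, r) := by
              rw [pow_two, ← mul_assoc, ENNReal.inv_mul_cancel (ne_bot_of_gt hlt') hr.ne, one_mul]
            rw [mul_assoc _ (θ r * _), mul_assoc (θ r), h4]
            gcongr
          · have hm' : r ∉ Prod.mk t ⁻¹' E := hm
            simp [indicator_of_notMem hm']
  have hmain : ∫⁻ t, l t ^ (4 : ℝ) ≤ M * (∫⁻ t, l t ^ (4 : ℝ)) ^ (3 / 4 : ℝ) :=
    hpair.trans ((hall g hgm fun t x => ENNReal.mul_ne_top (hctop _) (hhf t x)).trans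
      (by gcongr))
  set X := ∫⁻ t, l t ^ (4 : ℝ)
  by_cases hX0 : X = 0
  · simp [hX0]
  have h5 : X = X ^ (1 / 4 : ℝ) * X ^ (3 / 4 : ℝ) := by
    rw [← ENNReal.rpow_add _ _ hX0 hl4]; norm_num
  have h6 : X ^ (3 / 4 : ℝ) ≠ 0 := by simp [hX0, hl4]
  have h7 : X ^ (3 / 4 : ℝ) ≠ ∞ := ENNReal.rpow_ne_top_of_nonneg (by norm_num) hl4
  nth_rewrite 1 [h5] at hmain
  exact (ENNReal.mul_le_mul_iff_left h6 h7).1 hmain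

/-- **Converse Hölder inequality**: a function that pairs boundedly with bounded functions of
bounded support in `L^{4/3}_t L^1_ω L^2_{ω^⊥}` lies in `L^4_t L^∞_ω L^2_{ω^⊥}`. -/
theorem strichartzNorm_le_of_test (hh : Measurable (Function.uncurry h))
    (hhf : ∀ t x, h t x ≠ ∞) (hh2 : ∀ t, ∫⁻ x, h t x ^ 2 ≠ ∞)
    (htest : ∀ g : ℝ → R3 → ℝ≥0∞, Measurable (Function.uncurry g) →
      (∃ K : ℝ≥0, ∀ t x, g t x ≤ K) → (∃ T : ℝ, ∀ t x, g t x ≠ 0 → |t| ≤ T ∧ ‖x‖ ≤ T) →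
      ∫⁻ t, ∫⁻ x, h t x * g t x ≤ M * dualNorm ω g) :
    strichartzNorm ω h ≤ M := by
  set m : ℝ → ℝ≥0∞ := fun t => essSup (sliceNorm ω (h t)) volume with hm
  have hmm : Measurable m :=
    measurable_essSup_right (f := fun p : ℝ × ℝ => sliceNorm ω (h p.1) p.2)
      (measurable_sliceNorm hh)
  set κ : ℕ → ℝ≥0∞ := fun n => 1 - ((n : ℝ≥0∞) + 1)⁻¹ with hκ
  -- bounded functions of bounded support that increase strictly from below to the slice norm
  set l : ℕ → ℝ → ℝ≥0∞ := fun n => (Icc (-(n : ℝ)) n).indicator fun t => min (n : ℝ≥0∞) (κ n * m t)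
    with hl
  have hlm : ∀ n, Measurable (l n) := fun n =>
    (measurable_const.min (hmm.const_mul _)).indicator measurableSet_Icc
  have hll : ∀ n t, l n t = 0 ∨ l n t < m t := by
    intro n t
    by_cases ht : t ∈ Icc (-(n : ℝ)) n
    · simp only [hl, indicator_of_mem ht]
      by_cases h0 : m t = 0
      · left; simp [h0]
      right
      by_cases htop : m t = ∞
      · rw [htop]
        exact (min_le_left _ _).trans_lt (ENNReal.natCast_lt_top n)
      · refine (min_le_right _ _).trans_lt ?_
        have h1 : κ n < 1 := ENNReal.sub_lt_self (by simp) (by simp) (by simp)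
        calc κ n * m t < 1 * m t := by
              rw [ENNReal.mul_lt_mul_iff_left h0 htop]; exact h1
          _ = m t := one_mul _
    · left; simp [hl, indicator_of_notMem ht]
  have hl4 : ∀ n, ∫⁻ t, l n t ^ (4 : ℝ) ≠ ∞ := by
    intro n
    have h1 : ∫⁻ t, l n t ^ (4 : ℝ)
        ≤ ∫⁻ t, (Icc (-(n : ℝ)) n).indicator (fun _ => (n : ℝ≥0∞) ^ (4 : ℝ)) t := by
      refine lintegral_mono fun t => ?_
      by_cases ht : t ∈ Icc (-(n : ℝ)) n
      · simp only [hl, indicator_of_mem ht]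
        gcongr
        exact min_le_left _ _
      · simp [hl, indicator_of_notMem ht]
    refine ne_top_of_le_ne_top ?_ h1
    rw [lintegral_indicator measurableSet_Icc, setLIntegral_const]
    exact ENNReal.mul_ne_top (ENNReal.rpow_ne_top_of_nonneg (by norm_num)
      (ENNReal.natCast_ne_top n)) (by simp)
  have hbd : ∀ n, ∫⁻ t, l n t ^ (4 : ℝ) ≤ M ^ (4 : ℝ) := by
    intro n
    have h1 := lintegral_rpow_four_le_of_lt_essSup hh hhf hh2
      (fun g hg hgt => lintegral_mul_le_of_test hh htest hg hgt) (hlm n) (hll n) (hl4 n)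
    have h2 := ENNReal.rpow_le_rpow h1 (show (0 : ℝ) ≤ 4 by norm_num)
    rwa [← ENNReal.rpow_mul, show (1 / 4 * 4 : ℝ) = 1 by norm_num, ENNReal.rpow_one] at h2
  have hκ1 : Filter.Tendsto κ Filter.atTop (nhds 1) := by
    have h1 := (Filter.tendsto_add_atTop_iff_nat 1).2 ENNReal.tendsto_inv_nat_nhds_zero
    have h2 := ENNReal.Tendsto.sub (tendsto_const_nhds (x := (1 : ℝ≥0∞)) (f := Filter.atTop)) h1
      (Or.inl ENNReal.one_ne_top)
    simpa [hκ] using h2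
  have hlim : ∀ t, Filter.Tendsto (fun n => l n t ^ (4 : ℝ)) Filter.atTop
      (nhds (m t ^ (4 : ℝ))) := by
    intro t
    refine (ENNReal.continuous_rpow_const.tendsto _).comp ?_
    have h1 : Filter.Tendsto (fun n : ℕ => min (n : ℝ≥0∞) (κ n * m t)) Filter.atTop
        (nhds (m t)) := by
      have h2 := ENNReal.tendsto_nat_nhds_top.min
        (ENNReal.Tendsto.mul_const (b := m t) hκ1 (Or.inl one_ne_zero))
      simpa using h2
    obtain ⟨N, hN⟩ := exists_nat_ge |t|
    refine h1.congr' ((Filter.eventually_ge_atTop N).mono fun k hk => ?_)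
    have hkn : (N : ℝ) ≤ k := by exact_mod_cast hk
    have ht : t ∈ Icc (-(k : ℝ)) k := abs_le.1 (hN.trans hkn)
    simp only [hl, indicator_of_mem ht]
  have hfin : ∫⁻ t, m t ^ (4 : ℝ) ≤ M ^ (4 : ℝ) := by
    calc _ = ∫⁻ t, Filter.liminf (fun n => l n t ^ (4 : ℝ)) Filter.atTop :=
          lintegral_congr fun t => (hlim t).liminf_eq.symm
      _ ≤ Filter.liminf (fun n => ∫⁻ t, l n t ^ (4 : ℝ)) Filter.atTop :=
          lintegral_liminf_le fun n => (hlm n).pow_const _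
      _ ≤ _ := by
          refine Filter.liminf_le_of_le ?_ fun b hb => ?_
          · isBoundedDefault
          · obtain ⟨n, hn⟩ := hb.exists
            exact hn.trans (hbd n)
  calc strichartzNorm ω h ≤ (M ^ (4 : ℝ)) ^ (1 / 4 : ℝ) := by
        unfold strichartzNorm
        gcongr
    _ = M := by rw [← ENNReal.rpow_mul]; norm_num

end ConverseHolder

/-! ### Jointly measurable representatives -/

/-- A measurable `L²`-valued function of time is represented by a jointly measurable function: it is
approximated, uniformly in time, by functions with values in a countable dense set. -/
lemma exists_jointly_measurable_rep {X : Type*} [MeasurableSpace X] {μ : Measure X}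
    [TopologicalSpace.SeparableSpace (Lp ℂ 2 μ)] (U : ℝ → Lp ℂ 2 μ)
    (hU : ∀ d : Lp ℂ 2 μ, Measurable fun t => ‖d - U t‖) :
    ∃ u : ℝ → X → ℂ, StronglyMeasurable (Function.uncurry u) ∧ ∀ t, u t =ᵐ[μ] U t := by
  classical
  set d : ℕ → Lp ℂ 2 μ := TopologicalSpace.denseSeq _ with hd
  have hex : ∀ (k : ℕ) (t : ℝ), ∃ i, ‖d i - U t‖ < (1 / 2) ^ k := fun k t => by
    obtain ⟨i, hi⟩ := (TopologicalSpace.denseRange_denseSeq (Lp ℂ 2 μ)).exists_dist_lt (U t)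
      (show (0 : ℝ) < (1 / 2) ^ k by positivity)
    exact ⟨i, by rwa [dist_comm, dist_eq_norm] at hi⟩
  set j : ℕ → ℝ → ℕ := fun k t => Nat.find (hex k t) with hj
  have hjm : ∀ k, Measurable (j k) := fun k =>
    measurable_find (hex k) fun i => measurableSet_lt (hU (d i)) measurable_const
  have hjs : ∀ k t, ‖d (j k t) - U t‖ < (1 / 2) ^ k := fun k t => Nat.find_spec (hex k t)
  set v : ℕ → ℝ → X → ℂ := fun k t x => d (j k t) x with hv
  have hD : Measurable fun p : ℕ × X => d p.1 p.2 :=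
    measurable_from_prod_countable_right fun i => (Lp.stronglyMeasurable (d i)).measurable
  have hvm : ∀ k, StronglyMeasurable (Function.uncurry (v k)) := fun k =>
    (hD.comp (((hjm k).comp measurable_fst).prodMk measurable_snd)).stronglyMeasurable
  have hlm : StronglyMeasurable fun p : ℝ × X =>
      Filter.limUnder Filter.atTop fun k => Function.uncurry (v k) p :=
    StronglyMeasurable.limUnder hvm
  refine ⟨fun t x => Filter.limUnder Filter.atTop fun k => v k t x, hlm, ?_⟩
  intro t
  have hnorm : ∀ k, eLpNorm (v k t - (U t : X → ℂ)) 2 μ ≤ ENNReal.ofReal ((1 / 2) ^ k) := by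
    intro k
    have h1 : eLpNorm (v k t - (U t : X → ℂ)) 2 μ = ‖d (j k t) - U t‖ₑ := by
      rw [Lp.enorm_def]
      exact eLpNorm_congr_ae (Lp.coeFn_sub _ _).symm
    rw [h1, ← ofReal_norm]
    exact ENNReal.ofReal_le_ofReal (hjs k t).le
  have hvs : ∀ k, AEStronglyMeasurable (v k t) μ := fun k => Lp.aestronglyMeasurable _
  have hsum : Summable fun k : ℕ => (3 : ℝ) * (1 / 2) ^ k :=
    (summable_geometric_of_lt_one (by norm_num) (by norm_num)).mul_left 3
  have hlim : ∀ᵐ x ∂μ, ∃ l, Filter.Tendsto (fun n => v n t x) Filter.atTop (nhds l) := by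
    refine Lp.ae_tendsto_of_cauchy_eLpNorm (p := 2) (f := fun n => v n t) hvs (by norm_num)
      (B := fun k => ENNReal.ofReal (3 * (1 / 2) ^ k)) hsum.tsum_ofReal_ne_top ?_
    intro N n m hn hm
    have e : v n t - v m t = (v n t - (U t : X → ℂ)) - (v m t - (U t : X → ℂ)) := by abel
    have p1 : ((1 / 2 : ℝ)) ^ n ≤ (1 / 2) ^ N :=
      pow_le_pow_of_le_one (by norm_num) (by norm_num) hn
    have p2 : ((1 / 2 : ℝ)) ^ m ≤ (1 / 2) ^ N :=
      pow_le_pow_of_le_one (by norm_num) (by norm_num) hm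
    calc eLpNorm (v n t - v m t) 2 μ
        ≤ eLpNorm (v n t - (U t : X → ℂ)) 2 μ + eLpNorm (v m t - (U t : X → ℂ)) 2 μ := by
          rw [e]
          exact eLpNorm_sub_le ((hvs n).sub (Lp.aestronglyMeasurable _))
            ((hvs m).sub (Lp.aestronglyMeasurable _)) (by norm_num)
      _ ≤ ENNReal.ofReal ((1 / 2) ^ n) + ENNReal.ofReal ((1 / 2) ^ m) :=
          add_le_add (hnorm n) (hnorm m)
      _ = ENNReal.ofReal ((1 / 2) ^ n + (1 / 2) ^ m) :=
          (ENNReal.ofReal_add (by positivity) (by positivity)).symm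
      _ < _ := by
          have p3 : (0 : ℝ) < (1 / 2) ^ N := by positivity
          rw [ENNReal.ofReal_lt_ofReal_iff (by positivity)]
          linarith
  have hmeas : TendstoInMeasure μ (fun k => v k t) Filter.atTop (U t : X → ℂ) := by
    refine tendstoInMeasure_of_tendsto_eLpNorm (p := 2) (by norm_num) hvs
      (Lp.aestronglyMeasurable _) ?_
    refine tendsto_of_tendsto_of_tendsto_of_le_of_le tendsto_const_nhds ?_
      (fun _ => zero_le) hnorm
    have := ENNReal.tendsto_ofReal (tendsto_pow_atTop_nhds_zero_of_lt_one (r := (1 / 2 : ℝ))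
      (by norm_num) (by norm_num))
    simpa using this
  obtain ⟨ns, hns, hae⟩ := hmeas.exists_seq_tendsto_ae
  filter_upwards [hlim, hae] with x hx1 hx2
  obtain ⟨l, hl⟩ := hx1
  have h1 : l = U t x := tendsto_nhds_unique (hl.comp hns.tendsto_atTop) hx2
  rw [← h1]
  exact hl.limUnder_eq

/-! ### Test sources restricted in time -/

/-- The density in time of the power `4/3` of the norm of `L^{4/3}_t L^1_ω L^2_{ω^⊥}`. -/
noncomputable def timeDensity (ω : sphere (0 : R3) 1) (g : ℝ → R3 → ℝ≥0∞) (t : ℝ) : ℝ≥0∞ :=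
  (∫⁻ r, sliceNorm ω (g t) r) ^ (4 / 3 : ℝ)

lemma dualNorm_eq (ω : sphere (0 : R3) 1) (g : ℝ → R3 → ℝ≥0∞) :
    dualNorm ω g = (∫⁻ t, timeDensity ω g t) ^ (3 / 4 : ℝ) := rfl

lemma measurable_timeDensity {ω : sphere (0 : R3) 1} {g : ℝ → R3 → ℝ≥0∞}
    (hg : Measurable (Function.uncurry g)) : Measurable (timeDensity ω g) :=
  (measurable_lintegral_sliceNorm hg).pow_const _

lemma dualNorm_indicator (ω : sphere (0 : R3) 1) (G : ℝ → R3 → ℂ) {S : Set ℝ}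
    (hS : MeasurableSet S) :
    dualNorm ω (fun t x => ‖S.indicator G t x‖ₑ)
      = (∫⁻ t in S, timeDensity ω (fun t x => ‖G t x‖ₑ) t) ^ (3 / 4 : ℝ) := by
  rw [dualNorm_eq, ← lintegral_indicator hS]
  congr 2
  ext t
  by_cases ht : t ∈ S
  · simp [timeDensity, ht]
  · simp [timeDensity, ht, sliceNorm]

lemma profile_indicator (G : ℝ → R3 → ℂ) (S : Set ℝ) (s : ℝ) (ξ : R3) :
    profile (S.indicator G) s ξ = S.indicator (fun s => profile G s ξ) s := by
  by_cases hs : s ∈ S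
  · simp [profile, hs]
  · simp [profile, hs, Real.fourier_eq]

namespace IsTestSource

variable {G F : ℝ → R3 → ℂ} {ω : sphere (0 : R3) 1}

lemma sqrt_lintegral_integral_profile_le (hG : IsTestSource G) (ω : sphere (0 : R3) 1) {S : Set ℝ}
    (hS : MeasurableSet S) :
    (∫⁻ ξ, ‖∫ s in S, profile G s ξ‖ₑ ^ 2) ^ (1 / 2 : ℝ)
      ≤ 4 * (∫⁻ t in S, timeDensity ω (fun t x => ‖G t x‖ₑ) t) ^ (3 / 4 : ℝ) := by
  have h := lintegral_enorm_sq_integral_profile_le ω (hG.indicator_time hS)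
  simp only [profile_indicator, integral_indicator hS] at h
  rw [dualNorm_indicator ω G hS] at h
  set D := (∫⁻ t in S, timeDensity ω (fun t x => ‖G t x‖ₑ) t) ^ (3 / 4 : ℝ)
  calc _ ≤ ((4 * D) ^ 2) ^ (1 / 2 : ℝ) := by
        gcongr
        refine h.trans ?_
        rw [mul_pow]
        gcongr
        norm_num
    _ = _ := by
        rw [← ENNReal.rpow_natCast, ← ENNReal.rpow_mul]
        norm_num

lemma lintegral_enorm_profile_sq (hG : IsTestSource G) (s : ℝ) :
    ∫⁻ ξ, ‖profile G s ξ‖ₑ ^ 2 = ∫⁻ x, ‖G s x‖ₑ ^ 2 := by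
  simp_rw [enorm_profile]
  exact lintegral_enorm_fourier_sq (hG.integrable_slice s) (hG.memLp s 2)

lemma exists_bound_L2 (hG : IsTestSource G) :
    ∃ M : ℝ≥0, ∀ s, (∫⁻ x, ‖G s x‖ₑ ^ 2) ^ (1 / 2 : ℝ) ≤ M := by
  obtain ⟨M, hM⟩ := hG.bounded
  obtain ⟨T, hT⟩ := hG.support
  have hfin : (ENNReal.ofReal M ^ 2 * volume (closedBall (0 : R3) T)) ^ (1 / 2 : ℝ) ≠ ∞ :=
    ENNReal.rpow_ne_top_of_nonneg (by norm_num) (ENNReal.mul_ne_top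
      (ENNReal.pow_ne_top ENNReal.ofReal_ne_top) measure_closedBall_lt_top.ne)
  refine ⟨((ENNReal.ofReal M ^ 2 * volume (closedBall (0 : R3) T)) ^ (1 / 2 : ℝ)).toNNReal,
    fun s => ?_⟩
  rw [ENNReal.coe_toNNReal hfin]
  gcongr
  rw [← setLIntegral_const, ← lintegral_indicator measurableSet_closedBall]
  refine lintegral_mono fun x => ?_
  by_cases hx : x ∈ closedBall (0 : R3) T
  · rw [indicator_of_mem hx, ← ofReal_norm]
    gcongr
    exact hM s x
  · have h0 : G s x = 0 := by
      by_contra h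
      exact hx (by simpa using (hT s x h).2)
    simp [h0]

lemma exists_profile_bound_L2 (hG : IsTestSource G) :
    ∃ M : ℝ≥0, ∀ s, (∫⁻ ξ, ‖profile G s ξ‖ₑ ^ 2) ^ (1 / 2 : ℝ) ≤ M := by
  obtain ⟨M, hM⟩ := hG.exists_bound_L2
  exact ⟨M, fun s => by rw [hG.lintegral_enorm_profile_sq]; exact hM s⟩

lemma exists_profile_support (hG : IsTestSource G) :
    ∃ T, 0 < T ∧ ∀ s ξ, T ≤ |s| → profile G s ξ = 0 := by
  obtain ⟨T, hT⟩ := hG.support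
  refine ⟨|T| + 1, by positivity, fun s ξ hs => ?_⟩
  have h0 : G s = fun _ => 0 := by
    ext x
    by_contra h
    have := (hT s x h).1
    have := le_abs_self T
    linarith
  simp [profile, h0, Real.fourier_eq]

/-- The retarded form of two test sources, bounded by their norms in two arbitrary directions. -/
lemma enorm_retarded_pairing_le (hF : IsTestSource F) (hG : IsTestSource G)
    (ω₁ ω₂ : sphere (0 : R3) 1) (hFt : dualNorm ω₁ (fun t x => ‖F t x‖ₑ) ≠ ∞)
    (hGt : dualNorm ω₂ (fun t x => ‖G t x‖ₑ) ≠ ∞) :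
    ‖∫ t, ∫ ξ, (starRingEnd ℂ) (profile G t ξ) * ∫ s in Iio t, profile F s ξ‖ₑ
      ≤ 64 * dualNorm ω₁ (fun t x => ‖F t x‖ₑ) * dualNorm ω₂ (fun t x => ‖G t x‖ₑ) := by
  obtain ⟨TF, hTF0, hTF⟩ := hF.exists_profile_support
  obtain ⟨TG, hTG0, hTG⟩ := hG.exists_profile_support
  obtain ⟨Ma, hMa⟩ := hF.exists_profile_bound_L2
  obtain ⟨Mb, hMb⟩ := hG.exists_profile_bound_L2
  have ha := hF.measurable_profile
  have hb := hG.measurable_profile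
  set T := max TF TG with hT
  have hTT : -T ≤ T := by have := le_max_left TF TG; linarith
  -- the densities as real functions
  have dens : ∀ {K : ℝ → R3 → ℂ} (_ : IsTestSource K) (ω : sphere (0 : R3) 1)
      (_ : dualNorm ω (fun t x => ‖K t x‖ₑ) ≠ ∞), ∃ w : ℝ → ℝ,
      (∀ p q, IntervalIntegrable w volume p q) ∧ (∀ s, 0 ≤ w s) ∧
      (∀ p q, p ≤ q → ENNReal.ofReal ((∫ s in p..q, w s) ^ (3 / 4 : ℝ))
        = (∫⁻ s in Ioc p q, timeDensity ω (fun t x => ‖K t x‖ₑ) s) ^ (3 / 4 : ℝ)) := by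
    intro K hK ω hKt
    have hm := measurable_timeDensity (ω := ω) (g := fun t x => ‖K t x‖ₑ) hK.measurable.enorm
    have hI : ∫⁻ t, timeDensity ω (fun t x => ‖K t x‖ₑ) t ≠ ∞ := by
      intro h
      rw [dualNorm_eq, h, ENNReal.top_rpow_of_pos (by norm_num)] at hKt
      exact hKt rfl
    have hi := integrable_toReal_of_lintegral_ne_top hm.aemeasurable hI
    refine ⟨fun s => (timeDensity ω (fun t x => ‖K t x‖ₑ) s).toReal,
      fun p q => hi.intervalIntegrable, fun s => ENNReal.toReal_nonneg, fun p q hpq => ?_⟩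
    have hfin : ∫⁻ s in Ioc p q, timeDensity ω (fun t x => ‖K t x‖ₑ) s ≠ ∞ :=
      ne_top_of_le_ne_top hI (setLIntegral_le_lintegral _ _)
    rw [intervalIntegral.integral_of_le hpq, integral_toReal hm.aemeasurable
      (ae_restrict_of_ae (ae_lt_top hm hI)), ← ENNReal.ofReal_rpow_of_nonneg
      ENNReal.toReal_nonneg (by norm_num), ENNReal.ofReal_toReal hfin]
  obtain ⟨w, hw, hw0, hwe⟩ := dens hF ω₁ hFt
  obtain ⟨v, hv, hv0, hve⟩ := dens hG ω₂ hGt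
  have hI : ∀ {K : ℝ → R3 → ℂ} (_ : IsTestSource K) (ω : sphere (0 : R3) 1) (w : ℝ → ℝ)
      (_ : ∀ p q, p ≤ q → ENNReal.ofReal ((∫ s in p..q, w s) ^ (3 / 4 : ℝ))
        = (∫⁻ s in Ioc p q, timeDensity ω (fun t x => ‖K t x‖ₑ) s) ^ (3 / 4 : ℝ)) (p q : ℝ)
      (_ : p ≤ q), (∫⁻ ξ, ‖∫ s in p..q, profile K s ξ‖ₑ ^ 2) ^ (1 / 2 : ℝ)
        ≤ ENNReal.ofReal (4 * (∫ s in p..q, w s) ^ (3 / 4 : ℝ)) := by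
    intro K hK ω w hwe p q hpq
    rw [ENNReal.ofReal_mul (by norm_num), hwe p q hpq]
    simp only [intervalIntegral.integral_of_le hpq]
    simpa using hK.sqrt_lintegral_integral_profile_le ω measurableSet_Ioc
  have key := norm_retarded_form_le ha hb hMa hMb hw hv hw0 hv0 (A := 4) (by norm_num)
    (hI hF ω₁ w hwe) (hI hG ω₂ v hve) hTT
  have hinner : ∀ t, -T ≤ t → ∫ ξ, (starRingEnd ℂ) (profile G t ξ) * ∫ s in Iio t, profile F s ξ
      = ∫ s in (-T)..t, timeCorrelation volume (profile F) (profile G) t s := by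
    intro t ht
    rw [integral_timeCorrelation ha hb hMa hMb ht]
    refine integral_congr_ae (Filter.Eventually.of_forall fun ξ => ?_)
    dsimp only
    congr 1
    rw [intervalIntegral.integral_of_le ht, ← integral_Iic_eq_integral_Iio,
      ← integral_indicator measurableSet_Iic, ← integral_indicator measurableSet_Ioc]
    refine integral_congr_ae (Filter.Eventually.of_forall fun s => ?_)
    by_cases hs : s ≤ t
    · by_cases hs' : -T < s
      · simp [indicator, hs, hs']
      · have h0 : profile F s ξ = 0 := by
          refine hTF s ξ ?_
          have h1 := neg_le_abs s
          have h2 := le_max_left TF TG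
          linarith
        simp [indicator, h0]
    · simp [indicator, hs]
  have houter : ∫ t, ∫ ξ, (starRingEnd ℂ) (profile G t ξ) * ∫ s in Iio t, profile F s ξ
      = ∫ t in (-T)..T, ∫ s in (-T)..t, timeCorrelation volume (profile F) (profile G) t s := by
    rw [intervalIntegral.integral_of_le hTT, ← integral_indicator measurableSet_Ioc]
    refine integral_congr_ae (Filter.Eventually.of_forall fun t => ?_)
    dsimp only
    by_cases ht : t ∈ Ioc (-T) T
    · rw [indicator_of_mem ht, hinner t ht.1.le]
    · rw [indicator_of_notMem ht]
      have h0 : ∀ ξ, profile G t ξ = 0 := fun ξ => by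
        refine hTG t ξ ((le_max_right TF TG).trans ?_)
        rw [mem_Ioc, not_and_or, not_lt, not_le] at ht
        rcases ht with ht | ht
        · have := neg_le_abs t; linarith
        · exact ht.le.trans (le_abs_self t)
      simp [h0]
  rw [houter, ← ofReal_norm]
  refine (ENNReal.ofReal_le_ofReal key).trans ?_
  have i1 : 0 ≤ ∫ s in (-T)..T, w s := intervalIntegral.integral_nonneg hTT fun s _ => hw0 s
  rw [ENNReal.ofReal_mul (by positivity), ENNReal.ofReal_mul (by positivity), hwe _ _ hTT,
    hve _ _ hTT, dualNorm_eq, dualNorm_eq]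
  gcongr
  · norm_num
  · exact Measure.restrict_le_self
  · exact Measure.restrict_le_self

end IsTestSource

/-! ### Mixed-norm inequalities -/

/-- Hölder's inequality in the mixed norms. -/
lemma lintegral_mul_le_dualNorm_mul_strichartzNorm {ω : sphere (0 : R3) 1}
    {g h : ℝ → R3 → ℝ≥0∞} (hg : Measurable (Function.uncurry g))
    (hh : Measurable (Function.uncurry h)) :
    ∫⁻ t, ∫⁻ x, g t x * h t x ≤ dualNorm ω g * strichartzNorm ω h := by
  have hgs : ∀ t, Measurable (g t) := fun t => hg.comp measurable_prodMk_left
  have hhs : ∀ t, Measurable (h t) := fun t => hh.comp measurable_prodMk_left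
  have hplane : ∀ {k : R3 → ℝ≥0∞} (_ : Measurable k) (r : ℝ),
      Measurable fun y : Plane ω => k (dirCoord ω (r, y)) := fun hk r =>
    hk.comp ((dirCoord ω).measurable.comp measurable_prodMk_left)
  have h1 : ∀ t r, ∫⁻ y : Plane ω, g t (dirCoord ω (r, y)) * h t (dirCoord ω (r, y))
      ≤ sliceNorm ω (g t) r * sliceNorm ω (h t) r := by
    intro t r
    have := ENNReal.lintegral_mul_le_Lp_mul_Lq volume Real.HolderConjugate.two_two
      (hplane (hgs t) r).aemeasurable (hplane (hhs t) r).aemeasurable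
    simp only [Pi.mul_apply, ENNReal.rpow_two] at this
    exact this
  have hmG : Measurable fun t => ∫⁻ r, sliceNorm ω (g t) r := measurable_lintegral_sliceNorm hg
  have hmH : Measurable fun t => essSup (sliceNorm ω (h t)) volume :=
    measurable_essSup_right (f := fun p : ℝ × ℝ => sliceNorm ω (h p.1) p.2)
      (measurable_sliceNorm hh)
  have h2 : ∀ t, ∫⁻ x, g t x * h t x
      ≤ (∫⁻ r, sliceNorm ω (g t) r) * essSup (sliceNorm ω (h t)) volume := by
    intro t
    have hm : Measurable fun x => g t x * h t x := (hgs t).mul (hhs t)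
    have hms : Measurable fun r => sliceNorm ω (g t) r :=
      (measurable_sliceNorm hg).comp (measurable_prodMk_left (x := t))
    rw [lintegral_dirCoord ω hm, ← lintegral_mul_const _ hms]
    refine lintegral_mono_ae ?_
    filter_upwards [ae_le_essSup (f := sliceNorm ω (h t)) (μ := volume)] with r hr
    exact (h1 t r).trans (by gcongr)
  refine (lintegral_mono h2).trans ?_
  have := ENNReal.lintegral_mul_le_Lp_mul_Lq (volume : Measure ℝ) (p := 4 / 3) (q := 4)
    (by constructor <;> norm_num) hmG.aemeasurable hmH.aemeasurable
  simp only [Pi.mul_apply] at this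
  refine this.trans (le_of_eq ?_)
  rw [dualNorm, strichartzNorm]
  norm_num

lemma IsTestSource.dualNorm_ne_top {G : ℝ → R3 → ℂ} (hG : IsTestSource G)
    (ω : sphere (0 : R3) 1) : dualNorm ω (fun t x => ‖G t x‖ₑ) ≠ ∞ := by
  obtain ⟨M, hM⟩ := hG.bounded
  obtain ⟨T, hT⟩ := hG.support
  have hT' : ∀ t r (y : Plane ω), G t (dirCoord ω (r, y)) ≠ 0 → |t| ≤ T ∧ |r| ≤ T ∧ ‖y‖ ≤ T := by
    intro t r y h
    obtain ⟨h1, h2⟩ := hT t _ h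
    have h3 := norm_sq_dirCoord ω r y
    have h0 : 0 ≤ T := (abs_nonneg t).trans h1
    refine ⟨h1, abs_le_of_sq_le_sq
      (by nlinarith [norm_nonneg (dirCoord ω (r, y)), sq_nonneg ‖y‖]) h0, ?_⟩
    exact le_of_sq_le_sq (by nlinarith [norm_nonneg (dirCoord ω (r, y)), sq_nonneg r]) h0
  set S : ℝ≥0∞ := (ENNReal.ofReal M ^ 2 * volume (closedBall (0 : Plane ω) T)) ^ (1 / 2 : ℝ) with hS
  have hStop : S ≠ ∞ := ENNReal.rpow_ne_top_of_nonneg (by norm_num) (ENNReal.mul_ne_top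
    (ENNReal.pow_ne_top ENNReal.ofReal_ne_top) measure_closedBall_lt_top.ne)
  have h1 : ∀ t r, sliceNorm ω (fun x => ‖G t x‖ₑ) r ≤ (Icc (-T) T).indicator (fun _ => S) r := by
    intro t r
    by_cases hr : r ∈ Icc (-T) T
    · rw [indicator_of_mem hr]
      unfold sliceNorm
      rw [hS]
      gcongr
      rw [← setLIntegral_const, ← lintegral_indicator measurableSet_closedBall]
      refine lintegral_mono fun y => ?_
      by_cases hy : y ∈ closedBall (0 : Plane ω) T
      · rw [indicator_of_mem hy]
        dsimp only
        rw [← ofReal_norm]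
        gcongr
        exact hM t _
      · have h0 : G t (dirCoord ω (r, y)) = 0 := by
          by_contra h
          exact hy (by simpa using (hT' t r y h).2.2)
        simp [h0]
    · have h0 : ∀ y : Plane ω, G t (dirCoord ω (r, y)) = 0 := fun y => by
        by_contra h
        exact hr (abs_le.1 (hT' t r y h).2.1)
      simp [sliceNorm, h0]
  have h2 : ∀ t, ∫⁻ r, sliceNorm ω (fun x => ‖G t x‖ₑ) r
      ≤ (Icc (-T) T).indicator (fun _ => S * volume (Icc (-T) T)) t := by
    intro t
    by_cases ht : t ∈ Icc (-T) T
    · rw [indicator_of_mem ht, ← setLIntegral_const, ← lintegral_indicator measurableSet_Icc]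
      exact lintegral_mono (h1 t)
    · have h0 : ∀ r (y : Plane ω), G t (dirCoord ω (r, y)) = 0 := fun r y => by
        by_contra h
        exact ht (abs_le.1 (hT' t r y h).1)
      simp [sliceNorm, h0]
  refine ENNReal.rpow_ne_top_of_nonneg (by norm_num) ?_
  refine ne_top_of_le_ne_top (b := ∫⁻ t in Icc (-T) T,
    (S * volume (Icc (-T) T)) ^ (4 / 3 : ℝ)) ?_ ?_
  · rw [setLIntegral_const]
    exact ENNReal.mul_ne_top (ENNReal.rpow_ne_top_of_nonneg (by norm_num)
      (ENNReal.mul_ne_top hStop (by simp))) (by simp)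
  · rw [← lintegral_indicator measurableSet_Icc]
    refine lintegral_mono fun t => ?_
    dsimp only
    refine (ENNReal.rpow_le_rpow (h2 t) (by norm_num)).trans (le_of_eq ?_)
    by_cases ht : t ∈ Icc (-T) T
    · rw [indicator_of_mem ht, indicator_of_mem ht]
    · rw [indicator_of_notMem ht, indicator_of_notMem ht]
      norm_num

/-- The converse Hölder inequality for complex-valued functions: the test functions carry the
phase conjugate to that of `U`. -/
lemma strichartzNorm_le_of_pairing {ω : sphere (0 : R3) 1} {U : ℝ → R3 → ℂ} {M : ℝ≥0∞}
    (hU : Measurable (Function.uncurry U)) (hU2 : ∀ t, ∫⁻ x, ‖U t x‖ₑ ^ 2 ≠ ∞)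
    (hint : ∀ G, IsTestSource G →
      Integrable (fun p : ℝ × R3 => U p.1 p.2 * G p.1 p.2) (volume.prod volume))
    (hpair : ∀ G, IsTestSource G →
      ‖∫ t, ∫ x, U t x * G t x‖ₑ ≤ M * dualNorm ω fun t x => ‖G t x‖ₑ) :
    strichartzNorm ω (fun t x => ‖U t x‖ₑ) ≤ M := by
  refine strichartzNorm_le_of_test hU.enorm (fun t x => by simp) hU2 ?_
  rintro g hg ⟨K, hK⟩ ⟨T, hT⟩
  have hgt : ∀ t x, g t x ≠ ∞ := fun t x => ne_top_of_le_ne_top ENNReal.coe_ne_top (hK t x)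
  set m : ℝ → R3 → ℂ := fun t x => (starRingEnd ℂ) (U t x) * ((‖U t x‖⁻¹ : ℝ) : ℂ) with hm
  have hmm : Measurable (Function.uncurry m) :=
    (Complex.continuous_conj.measurable.comp hU).mul
      (Complex.continuous_ofReal.measurable.comp hU.norm.inv)
  have hm1 : ∀ t x, ‖m t x‖ ≤ 1 := fun t x => by
    simp only [hm, norm_mul, RCLike.norm_conj, Complex.norm_real, norm_inv, norm_norm]
    exact mul_inv_le_one
  have hmU : ∀ t x, U t x * m t x = (‖U t x‖ : ℂ) := fun t x => by
    by_cases h0 : U t x = 0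
    · simp [h0]
    · simp only [hm]
      rw [← mul_assoc, Complex.mul_conj, Complex.normSq_eq_norm_sq, ← Complex.ofReal_mul, pow_two,
        mul_assoc, mul_inv_cancel₀ (norm_ne_zero_iff.2 h0), mul_one]
  have hg' : IsTestSource fun t x => (((g t x).toReal : ℝ) : ℂ) := by
    refine ⟨Complex.continuous_ofReal.measurable.comp hg.ennreal_toReal, ⟨K, fun t x => ?_⟩,
      ⟨T, fun t x hx => hT t x fun h => hx (by simp [h])⟩⟩
    rw [Complex.norm_real, Real.norm_of_nonneg ENNReal.toReal_nonneg]
    exact ENNReal.toReal_le_coe_of_le_coe (hK t x)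
  have hG := hg'.mul_of_bounded hmm hm1
  set G : ℝ → R3 → ℂ := fun t x => m t x * (((g t x).toReal : ℝ) : ℂ) with hGdef
  have hUG : ∀ t x, U t x * G t x = ((‖U t x‖ * (g t x).toReal : ℝ) : ℂ) := fun t x => by
    simp only [hGdef]
    rw [← mul_assoc, hmU, Complex.ofReal_mul]
  have hGle : ∀ t x, ‖G t x‖ₑ ≤ g t x := fun t x => by
    rw [← ofReal_norm, ← ENNReal.ofReal_toReal (hgt t x)]
    refine ENNReal.ofReal_le_ofReal ?_
    simp only [hGdef, norm_mul, Complex.norm_real, Real.norm_of_nonneg ENNReal.toReal_nonneg]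
    exact mul_le_of_le_one_left ENNReal.toReal_nonneg (hm1 t x)
  have hI := hint G hG
  have hIr : Integrable (fun p : ℝ × R3 => ‖U p.1 p.2‖ * (g p.1 p.2).toReal)
      (volume.prod volume) := by
    refine hI.norm.congr (Filter.Eventually.of_forall fun p => ?_)
    dsimp only
    rw [hUG, Complex.norm_real, Real.norm_of_nonneg (by positivity)]
  have e1 : ∫⁻ t, ∫⁻ x, ‖U t x‖ₑ * g t x = ‖∫ t, ∫ x, U t x * G t x‖ₑ := by
    have h1 := lintegral_prod (μ := (volume : Measure ℝ)) (ν := (volume : Measure R3))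
      (fun p : ℝ × R3 => ‖U p.1 p.2‖ₑ * g p.1 p.2) (hU.enorm.mul hg).aemeasurable
    have h2 := integral_prod (μ := (volume : Measure ℝ)) (ν := (volume : Measure R3)) _ hI
    dsimp only at h1 h2
    rw [← h1, ← h2]
    simp only [hUG]
    rw [integral_complex_ofReal, ← ofReal_norm, Complex.norm_real,
      Real.norm_of_nonneg (integral_nonneg fun p => by positivity),
      ofReal_integral_eq_lintegral_ofReal hIr (Filter.Eventually.of_forall fun p => by positivity)]
    refine lintegral_congr fun p => ?_
    rw [ENNReal.ofReal_mul (norm_nonneg _), ofReal_norm, ENNReal.ofReal_toReal (hgt _ _)]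
  rw [e1]
  refine (hpair G hG).trans ?_
  gcongr
  exact dualNorm_mono hGle

/-! ### The free evolution of Schwartz functions -/

lemma conj_fourier_conj (f : R3 → ℂ) (ξ : R3) :
    (starRingEnd ℂ) (𝓕 (fun x => (starRingEnd ℂ) (f x)) ξ) = 𝓕 f (-ξ) := by
  rw [Real.fourier_eq, Real.fourier_eq, ← integral_conj]
  refine integral_congr_ae (Filter.Eventually.of_forall fun x => ?_)
  simp only [Circle.smul_def, smul_eq_mul, map_mul, Complex.conj_conj, inner_neg_right, neg_neg]
  rw [← Circle.coe_inv_eq_conj, ← AddChar.map_neg_eq_inv, neg_neg]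

lemma conj_backwardPhase (s : ℝ) (ξ : R3) :
    (starRingEnd ℂ) (backwardPhase s ξ)
      = Complex.exp (Complex.I * ((s * (2 * Real.pi * ‖ξ‖) ^ 2 : ℝ) : ℂ)) := by
  rw [backwardPhase, ← Complex.exp_conj]
  simp only [map_mul, map_neg, Complex.conj_ofReal, Complex.conj_I]
  congr 1
  ring

lemma conj_backwardPhase_mul (t s : ℝ) (ξ : R3) :
    (starRingEnd ℂ) (backwardPhase t ξ) * backwardPhase s ξ
      = (starRingEnd ℂ) (backwardPhase (t - s) ξ) := by
  rw [conj_backwardPhase, conj_backwardPhase, backwardPhase, ← Complex.exp_add]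
  congr 1
  push_cast
  ring

lemma backwardPhase_neg (s : ℝ) (ξ : R3) : backwardPhase s (-ξ) = backwardPhase s ξ := by
  simp [backwardPhase]

lemma conj_profile_conj (G : ℝ → R3 → ℂ) (t : ℝ) (ξ : R3) :
    (starRingEnd ℂ) (profile (fun t x => (starRingEnd ℂ) (G t x)) t ξ)
      = (starRingEnd ℂ) (backwardPhase t ξ) * 𝓕 (G t) (-ξ) := by
  rw [profile, map_mul, conj_fourier_conj]

/-- The Fourier transform of the free evolution. -/
noncomputable def evolvedSymbol (φ : 𝓢(R3, ℂ)) (t : ℝ) (ξ : R3) : ℂ :=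
  (starRingEnd ℂ) (backwardPhase t ξ) * 𝓕 (φ : R3 → ℂ) ξ

lemma freeSchrodinger_eq (t : ℝ) (φ : 𝓢(R3, ℂ)) (x : R3) :
    freeSchrodinger t φ x = 𝓕 (evolvedSymbol φ t) (-x) := by
  have h : (fun ξ : R3 => Complex.exp (Complex.I * ((t * (2 * Real.pi * ‖ξ‖) ^ 2 : ℝ) : ℂ))
      * 𝓕 (φ : R3 → ℂ) ξ) = evolvedSymbol φ t := by
    ext ξ
    rw [evolvedSymbol, conj_backwardPhase]
  rw [freeSchrodinger, h, Real.fourierInv_eq_fourier_neg]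

lemma measurable_evolvedSymbol (φ : 𝓢(R3, ℂ)) : Measurable (Function.uncurry (evolvedSymbol φ)) :=
  (Complex.continuous_conj.measurable.comp continuous_backwardPhase.measurable).mul
    ((𝓕 φ : 𝓢(R3, ℂ)).continuous.measurable.comp measurable_snd)

lemma memLp_fourier_schwartz (φ : 𝓢(R3, ℂ)) (p : ℝ≥0∞) : MemLp (𝓕 (φ : R3 → ℂ)) p := by
  rw [← SchwartzMap.fourier_coe]
  exact (𝓕 φ : 𝓢(R3, ℂ)).memLp p volume

lemma norm_evolvedSymbol (φ : 𝓢(R3, ℂ)) (t : ℝ) (ξ : R3) :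
    ‖evolvedSymbol φ t ξ‖ = ‖𝓕 (φ : R3 → ℂ) ξ‖ := by
  rw [evolvedSymbol, norm_mul, RCLike.norm_conj, norm_backwardPhase, one_mul]

lemma memLp_evolvedSymbol (φ : 𝓢(R3, ℂ)) (t : ℝ) (p : ℝ≥0∞) : MemLp (evolvedSymbol φ t) p :=
  (memLp_fourier_schwartz φ p).of_le
    ((measurable_evolvedSymbol φ).comp measurable_prodMk_left).aestronglyMeasurable
    (Filter.Eventually.of_forall fun ξ => (norm_evolvedSymbol φ t ξ).le)

lemma integrable_evolvedSymbol (φ : 𝓢(R3, ℂ)) (t : ℝ) : Integrable (evolvedSymbol φ t) :=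
  memLp_one_iff_integrable.1 (memLp_evolvedSymbol φ t 1)

lemma measurable_freeSchrodinger (φ : 𝓢(R3, ℂ)) :
    Measurable (Function.uncurry fun t x => freeSchrodinger t φ x) := by
  have h := (measurable_fourier_parametric (measurable_evolvedSymbol φ)).comp
    (measurable_fst.prodMk measurable_snd.neg : Measurable fun p : ℝ × R3 => (p.1, -p.2))
  have e : (Function.uncurry fun t x => freeSchrodinger t φ x)
      = fun p : ℝ × R3 => 𝓕 (evolvedSymbol φ p.1) (-p.2) := by
    ext p
    exact freeSchrodinger_eq p.1 φ p.2
  rw [e]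
  exact h

lemma norm_freeSchrodinger_le (φ : 𝓢(R3, ℂ)) (t : ℝ) (x : R3) :
    ‖freeSchrodinger t φ x‖ ≤ ∫ ξ, ‖𝓕 (φ : R3 → ℂ) ξ‖ := by
  rw [freeSchrodinger_eq, Real.fourier_eq]
  refine (norm_integral_le_integral_norm _).trans (le_of_eq ?_)
  simp [norm_evolvedSymbol]

lemma lintegral_freeSchrodinger_sq_ne_top (φ : 𝓢(R3, ℂ)) (t : ℝ) :
    ∫⁻ x, ‖freeSchrodinger t φ x‖ₑ ^ 2 ≠ ∞ := by
  simp_rw [freeSchrodinger_eq]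
  rw [lintegral_neg_eq_self (fun x => ‖𝓕 (evolvedSymbol φ t) x‖ₑ ^ 2),
    lintegral_enorm_fourier_sq (integrable_evolvedSymbol φ t) (memLp_evolvedSymbol φ t 2)]
  have h := (memLp_evolvedSymbol φ t 2).2
  rw [eLpNorm_two_eq_lintegral] at h
  intro h'
  rw [h', ENNReal.top_rpow_of_pos (by norm_num)] at h
  exact lt_irrefl _ h

lemma integral_freeSchrodinger_mul (φ : 𝓢(R3, ℂ)) (t : ℝ) {f : R3 → ℂ} (hf : Integrable f) :
    ∫ x, freeSchrodinger t φ x * f x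
      = ∫ ξ, 𝓕 (φ : R3 → ℂ) ξ * ((starRingEnd ℂ) (backwardPhase t ξ) * 𝓕 f (-ξ)) := by
  have h1 : ∫ x, freeSchrodinger t φ x * f x = ∫ x, 𝓕 (evolvedSymbol φ t) x * f (-x) := by
    rw [← integral_neg_eq_self]
    simp [freeSchrodinger_eq]
  rw [h1, integral_fourier_mul_eq_of_integrable (integrable_evolvedSymbol φ t) hf.comp_neg]
  refine integral_congr_ae (Filter.Eventually.of_forall fun ξ => ?_)
  have h2 : 𝓕 (fun x => f (-x)) ξ = 𝓕 f (-ξ) := by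
    rw [← Real.fourierInv_eq_fourier_neg, Real.fourierInv_eq_fourier_comp_neg]
  dsimp only
  rw [h2, evolvedSymbol]
  ring

/-- The homogeneous Strichartz estimate for a Schwartz function, by duality. -/
lemma strichartzNorm_freeSchrodinger_ne_top (ω : sphere (0 : R3) 1) (φ : 𝓢(R3, ℂ)) :
    strichartzNorm ω (fun t x => ‖freeSchrodinger t φ x‖ₑ) ≠ ∞ := by
  set N : ℝ≥0∞ := (∫⁻ ξ, ‖𝓕 (φ : R3 → ℂ) ξ‖ₑ ^ 2) ^ (1 / 2 : ℝ) with hN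
  have hNt : N ≠ ∞ := by
    have h := (memLp_fourier_schwartz φ 2).2
    rw [eLpNorm_two_eq_lintegral] at h
    exact h.ne
  have hm := measurable_freeSchrodinger φ
  have hint : ∀ G, IsTestSource G → Integrable
      (fun p : ℝ × R3 => freeSchrodinger p.1 φ p.2 * G p.1 p.2) (volume.prod volume) := fun G hG =>
    hG.integrable_uncurry.bdd_mul hm.aestronglyMeasurable
      (Filter.Eventually.of_forall fun p => norm_freeSchrodinger_le φ p.1 p.2)
  refine ne_top_of_le_ne_top (b := N * 4) (ENNReal.mul_ne_top hNt (by norm_num))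
    (strichartzNorm_le_of_pairing hm (lintegral_freeSchrodinger_sq_ne_top φ) hint ?_)
  intro G hG
  have hGc := hG.conj
  have hmp := hGc.measurable_profile
  have e1 : ∀ t, ∫ x, freeSchrodinger t φ x * G t x = ∫ ξ, 𝓕 (φ : R3 → ℂ) ξ
      * (starRingEnd ℂ) (profile (fun t x => (starRingEnd ℂ) (G t x)) t ξ) := fun t => by
    simp_rw [conj_profile_conj]
    exact integral_freeSchrodinger_mul φ t (hG.integrable_slice t)
  simp_rw [e1]
  have hFi : Integrable (Function.uncurry fun t ξ => 𝓕 (φ : R3 → ℂ) ξ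
      * (starRingEnd ℂ) (profile (fun t x => (starRingEnd ℂ) (G t x)) t ξ))
      (volume.prod volume) := by
    have h1 : Integrable (fun p : ℝ × R3 => (∫ x, ‖G p.1 x‖) * ‖𝓕 (φ : R3 → ℂ) p.2‖)
        (volume.prod volume) := by
      refine Integrable.mul_prod (f := fun t => ∫ x, ‖G t x‖) ?_
        (memLp_one_iff_integrable.1 (memLp_fourier_schwartz φ 1)).norm
      exact hG.integrable_uncurry.norm.integral_prod_left
    refine h1.mono ?_ (Filter.Eventually.of_forall fun p => ?_)
    · exact (((𝓕 φ : 𝓢(R3, ℂ)).continuous.measurable.comp measurable_snd).mul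
        (Complex.continuous_conj.measurable.comp hmp)).aestronglyMeasurable
    · rw [Real.norm_of_nonneg (by positivity), mul_comm (∫ x, _)]
      simp only [Function.uncurry, norm_mul, RCLike.norm_conj]
      gcongr
      refine (norm_profile_le _ _ _).trans (le_of_eq ?_)
      simp
  rw [integral_integral_swap hFi]
  simp_rw [integral_const_mul, integral_conj]
  have hmA : AEMeasurable (fun ξ => ∫ t, profile (fun t x => (starRingEnd ℂ) (G t x)) t ξ)
      volume :=
    (hmp.comp measurable_swap).stronglyMeasurable.integral_prod_right'.measurable.aemeasurable
  have h2 := enorm_integral_conj_mul_le hmA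
    (memLp_fourier_schwartz φ 2).1.aemeasurable (μ := volume)
  have h3 := hGc.sqrt_lintegral_integral_profile_le ω MeasurableSet.univ
  rw [setLIntegral_univ, ← dualNorm_eq] at h3
  simp only [Measure.restrict_univ, RCLike.enorm_conj] at h3
  simp_rw [mul_comm (𝓕 (φ : R3 → ℂ) _)]
  refine h2.trans ?_
  rw [mul_comm, mul_assoc]
  gcongr

lemma measurable_reflected {E : ℝ → R3 → ℂ} (hE : Measurable (Function.uncurry E)) (t : ℝ) :
    Measurable fun p : ℝ × R3 => E (t - p.1) p.2 := by
  have h : Measurable fun p : ℝ × R3 => (t - p.1, p.2) :=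
    (measurable_const.sub measurable_fst).prodMk measurable_snd
  exact hE.comp h

/-- Hölder's inequality for a source and a reflected time translate of a Strichartz function. -/
lemma integrable_mul_reflected {ω : sphere (0 : R3) 1} {F E : ℝ → R3 → ℂ}
    (hF : Measurable (Function.uncurry F)) (hE : Measurable (Function.uncurry E))
    (hFt : dualNorm ω (fun t x => ‖F t x‖ₑ) ≠ ∞)
    (hEt : strichartzNorm ω (fun t x => ‖E t x‖ₑ) ≠ ∞) (t : ℝ) :
    Integrable (fun p : ℝ × R3 => F p.1 p.2 * E (t - p.1) p.2) (volume.prod volume) := by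
  have hm : Measurable (Function.uncurry fun s x => E (t - s) x) := measurable_reflected hE t
  refine ⟨(hF.mul hm).aestronglyMeasurable, ?_⟩
  rw [hasFiniteIntegral_iff_enorm]
  have e := lintegral_prod (μ := (volume : Measure ℝ)) (ν := (volume : Measure R3))
    (fun p : ℝ × R3 => ‖F p.1 p.2 * E (t - p.1) p.2‖ₑ) (hF.mul hm).enorm.aemeasurable
  refine lt_of_le_of_lt (le_of_eq e) ?_
  simp_rw [enorm_mul]
  refine lt_of_le_of_lt (lintegral_mul_le_dualNorm_mul_strichartzNorm (ω := ω)
    (g := fun s x => ‖F s x‖ₑ) (h := fun s x => ‖E (t - s) x‖ₑ) hF.enorm hm.enorm) ?_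
  have e2 : strichartzNorm ω (fun s x => ‖E (t - s) x‖ₑ)
      = strichartzNorm ω (fun s x => ‖E s x‖ₑ) := by
    unfold strichartzNorm
    rw [lintegral_sub_left_eq_self (fun s : ℝ =>
      essSup (sliceNorm ω fun x => ‖E s x‖ₑ) volume ^ (4 : ℝ)) t]
  rw [e2]
  exact ENNReal.mul_lt_top hFt.lt_top hEt.lt_top

/-- The integrand of the weak Duhamel integral is absolutely integrable in space-time. -/
lemma integrable_source_mul_freeSchrodinger {ω : sphere (0 : R3) 1} {F : ℝ → R3 → ℂ}
    (hF : Measurable (Function.uncurry F)) (hFt : dualNorm ω (fun t x => ‖F t x‖ₑ) ≠ ∞)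
    (φ : 𝓢(R3, ℂ)) (t : ℝ) :
    Integrable (fun p : ℝ × R3 => F p.1 p.2 * freeSchrodinger (t - p.1) φ p.2)
      (volume.prod volume) :=
  integrable_mul_reflected (E := fun t => freeSchrodinger t φ) hF (measurable_freeSchrodinger φ)
    hFt (strichartzNorm_freeSchrodinger_ne_top ω φ) t

/-! ### The Fourier transform of the retarded integral of a test source -/

lemma measurable_integral_Iio {X : Type*} [MeasurableSpace X] {a : ℝ → X → ℂ}
    (ha : Measurable (Function.uncurry a)) :
    Measurable fun p : ℝ × X => ∫ s in Iio p.1, a s p.2 := by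
  have h1 : Measurable fun q : (ℝ × X) × ℝ => (Iio q.1.1).indicator (fun s => a s q.1.2) q.2 := by
    have h2 : Measurable fun q : (ℝ × X) × ℝ => a q.2 q.1.2 :=
      ha.comp (measurable_snd.prodMk (measurable_snd.comp measurable_fst))
    exact h2.indicator (measurableSet_lt measurable_snd (measurable_fst.comp measurable_fst))
  simp_rw [← integral_indicator measurableSet_Iio]
  exact h1.stronglyMeasurable.integral_prod_right'.measurable

/-- The Fourier transform of `∫_{s < t} e^{-i(t-s)Δ} F(s) ds`. -/
noncomputable def retardedSymbol (F : ℝ → R3 → ℂ) (t : ℝ) (ξ : R3) : ℂ :=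
  (starRingEnd ℂ) (backwardPhase t ξ) * ∫ s in Iio t, profile F s ξ

lemma enorm_retardedSymbol (F : ℝ → R3 → ℂ) (t : ℝ) (ξ : R3) :
    ‖retardedSymbol F t ξ‖ₑ = ‖∫ s in Iio t, profile F s ξ‖ₑ := by
  rw [enorm_eq_iff_norm_eq, retardedSymbol, norm_mul, RCLike.norm_conj, norm_backwardPhase, one_mul]

namespace IsTestSource

variable {F H : ℝ → R3 → ℂ}

lemma integrable_profile (hF : IsTestSource F) (ξ : R3) : Integrable fun s => profile F s ξ :=
  (show Integrable (fun s : ℝ => ∫ x, ‖F s x‖) volume from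
    hF.integrable_uncurry.norm.integral_prod_left).mono'
    (hF.measurable_profile.comp measurable_prodMk_right).aestronglyMeasurable
    (Filter.Eventually.of_forall fun s => norm_profile_le F s ξ)

lemma profile_sub (hF : IsTestSource F) (hH : IsTestSource H) (s : ℝ) (ξ : R3) :
    profile (fun t x => F t x - H t x) s ξ = profile F s ξ - profile H s ξ := by
  have e : 𝓕 (fun x => F s x - H s x) ξ = 𝓕 (F s) ξ - 𝓕 (H s) ξ := by
    have h1 := (Real.fourierIntegral_convergent_iff ξ).2 (hF.integrable_slice s)
    have h2 := (Real.fourierIntegral_convergent_iff ξ).2 (hH.integrable_slice s)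
    simp_rw [Real.fourier_eq, smul_sub]
    exact integral_sub h1 h2
  rw [profile, e, mul_sub, profile, profile]

lemma retardedSymbol_sub (hF : IsTestSource F) (hH : IsTestSource H) (t : ℝ) (ξ : R3) :
    retardedSymbol (fun t x => F t x - H t x) t ξ = retardedSymbol F t ξ - retardedSymbol H t ξ := by
  simp_rw [retardedSymbol, profile_sub hF hH]
  rw [integral_sub (hF.integrable_profile ξ).integrableOn (hH.integrable_profile ξ).integrableOn,
    mul_sub]

lemma measurable_retardedSymbol (hF : IsTestSource F) :
    Measurable (Function.uncurry (retardedSymbol F)) := by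
  refine (Complex.continuous_conj.measurable.comp continuous_backwardPhase.measurable).mul ?_
  exact measurable_integral_Iio hF.measurable_profile

lemma sqrt_lintegral_retardedSymbol_le (hF : IsTestSource F) (ω : sphere (0 : R3) 1) (t : ℝ) :
    (∫⁻ ξ, ‖retardedSymbol F t ξ‖ₑ ^ 2) ^ (1 / 2 : ℝ)
      ≤ 4 * dualNorm ω (fun t x => ‖F t x‖ₑ) := by
  simp_rw [enorm_retardedSymbol]
  refine (hF.sqrt_lintegral_integral_profile_le ω measurableSet_Iio).trans ?_
  rw [dualNorm_eq]
  gcongr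
  exact Measure.restrict_le_self

lemma memLp_retardedSymbol (hF : IsTestSource F) (t : ℝ) : MemLp (retardedSymbol F t) 2 := by
  refine ⟨(hF.measurable_retardedSymbol.comp measurable_prodMk_left).aestronglyMeasurable, ?_⟩
  rw [eLpNorm_two_eq_lintegral]
  -- the estimate in any one direction will do
  have ω : sphere (0 : R3) 1 :=
    Classical.choice (NormedSpace.sphere_nonempty.2 zero_le_one).to_subtype
  exact (hF.sqrt_lintegral_retardedSymbol_le ω t).trans_lt
    (ENNReal.mul_lt_top (by norm_num) (hF.dualNorm_ne_top ω).lt_top)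

/-- The weak Duhamel formula for a test source, on the Fourier side. -/
lemma integral_retardedSymbol_mul (hF : IsTestSource F) (φ : 𝓢(R3, ℂ)) (t : ℝ) :
    ∫ ξ, retardedSymbol F t ξ * 𝓕 (φ : R3 → ℂ) (-ξ)
      = ∫ s in Iio t, ∫ x, F s x * freeSchrodinger (t - s) φ x := by
  have hφ : Integrable (𝓕 (φ : R3 → ℂ)) := memLp_one_iff_integrable.1 (memLp_fourier_schwartz φ 1)
  have hφm : Measurable (𝓕 (φ : R3 → ℂ)) := (𝓕 φ : 𝓢(R3, ℂ)).continuous.measurable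
  have hint : Integrable (Function.uncurry fun s ξ => (starRingEnd ℂ) (backwardPhase t ξ)
      * profile F s ξ * 𝓕 (φ : R3 → ℂ) (-ξ)) ((volume.restrict (Iio t)).prod volume) := by
    have h1 : Integrable (fun p : ℝ × R3 => (∫ x, ‖F p.1 x‖) * ‖𝓕 (φ : R3 → ℂ) (-p.2)‖)
        ((volume.restrict (Iio t)).prod volume) :=
      Integrable.mul_prod (f := fun t => ∫ x, ‖F t x‖)
        (hF.integrable_uncurry.norm.integral_prod_left).integrableOn hφ.comp_neg.norm
    refine h1.mono' ?_ (Filter.Eventually.of_forall fun p => ?_)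
    · have hb : Measurable fun p : ℝ × R3 => (starRingEnd ℂ) (backwardPhase t p.2) :=
        Complex.continuous_conj.measurable.comp (continuous_backwardPhase.measurable.comp
          (measurable_const.prodMk measurable_snd))
      exact ((hb.mul hF.measurable_profile).mul
        (hφm.comp measurable_snd.neg)).aestronglyMeasurable
    · simp only [Function.uncurry, norm_mul, RCLike.norm_conj, norm_backwardPhase, one_mul]
      gcongr
      exact norm_profile_le F _ _
  have e1 : ∀ ξ, retardedSymbol F t ξ * 𝓕 (φ : R3 → ℂ) (-ξ) = ∫ s in Iio t,
      (starRingEnd ℂ) (backwardPhase t ξ) * profile F s ξ * 𝓕 (φ : R3 → ℂ) (-ξ) := fun ξ => by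
    rw [integral_mul_const, integral_const_mul, retardedSymbol]
  simp_rw [e1]
  rw [← integral_integral_swap hint]
  refine integral_congr_ae (Filter.Eventually.of_forall fun s => ?_)
  dsimp only
  have e2 : ∀ ξ, (starRingEnd ℂ) (backwardPhase t ξ) * profile F s ξ * 𝓕 (φ : R3 → ℂ) (-ξ)
      = (starRingEnd ℂ) (backwardPhase (t - s) ξ) * 𝓕 (F s) ξ * 𝓕 (φ : R3 → ℂ) (-ξ) := fun ξ => by
    rw [profile, ← mul_assoc, conj_backwardPhase_mul]
  simp_rw [e2]
  rw [← integral_neg_eq_self]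
  simp_rw [neg_neg, backwardPhase_neg]
  have e3 := integral_freeSchrodinger_mul φ (t - s) (hF.integrable_slice s)
  simp_rw [mul_comm (F s _)]
  rw [e3]
  exact integral_congr_ae (Filter.Eventually.of_forall fun ξ => mul_comm _ _)

end IsTestSource

/-- Parseval's identity for the bilinear pairing. -/
lemma integral_fourierInv_mul (V : Lp ℂ 2 (volume : Measure R3)) {f : R3 → ℂ} (h1 : Integrable f)
    (h2 : MemLp f 2) :
    ∫ x, (𝓕⁻ V : Lp ℂ 2 (volume : Measure R3)) x * f x = ∫ ξ, V ξ * 𝓕 f (-ξ) := by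
  have h1' : Integrable fun x : R3 => (starRingEnd ℂ) (f x) :=
    (Complex.conjLIE.toContinuousLinearEquiv.toContinuousLinearMap).integrable_comp h1
  have h2' : MemLp (fun x : R3 => (starRingEnd ℂ) (f x)) 2 := h2.star
  have h := Lp.inner_fourier_eq (h2'.toLp (μ := volume) _) (𝓕⁻ V)
  rw [FourierTransform.fourier_fourierInv_eq, fourier_toLp_eq h1' h2', L2.inner_def,
    L2.inner_def] at h
  have e1 : ∫ x, (𝓕⁻ V : Lp ℂ 2 (volume : Measure R3)) x * f x
      = ∫ x, inner ℂ ((h2'.toLp (μ := volume) _) x) ((𝓕⁻ V : Lp ℂ 2 (volume : Measure R3)) x) := by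
    refine integral_congr_ae ?_
    filter_upwards [h2'.coeFn_toLp] with x hx
    rw [hx, RCLike.inner_apply, Complex.conj_conj]
  rw [e1, ← h]
  refine integral_congr_ae ?_
  filter_upwards [(memLp_fourier h1' h2').coeFn_toLp] with ξ hξ
  rw [hξ, RCLike.inner_apply, conj_fourier_conj]

/-! ### Truncation -/

/-- Dominated convergence in `L^{4/3}_t L^1_ω L^2_{ω^⊥}`. -/
lemma tendsto_dualNorm_zero {ω : sphere (0 : R3) 1} {g : ℕ → ℝ → R3 → ℝ≥0∞} {h : ℝ → R3 → ℝ≥0∞}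
    (hg : ∀ n, Measurable (Function.uncurry (g n))) (hh : Measurable (Function.uncurry h))
    (hgh : ∀ n t x, g n t x ≤ h t x) (hfin : dualNorm ω h ≠ ∞)
    (hlim : ∀ t x, Filter.Tendsto (fun n => g n t x) Filter.atTop (nhds 0)) :
    Filter.Tendsto (fun n => dualNorm ω (g n)) Filter.atTop (nhds 0) := by
  have hpow : ∀ {a : ℝ} (_ : 0 < a) {k : ℕ → ℝ≥0∞} (_ : Filter.Tendsto k Filter.atTop (nhds 0)),
      Filter.Tendsto (fun n => k n ^ a) Filter.atTop (nhds 0) := by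
    intro a ha k hk
    have := (ENNReal.continuous_rpow_const (y := a)).tendsto 0 |>.comp hk
    rwa [ENNReal.zero_rpow_of_pos ha] at this
  have hI : ∫⁻ t, timeDensity ω h t ≠ ∞ := fun h' => by
    rw [dualNorm_eq, h', ENNReal.top_rpow_of_pos (by norm_num)] at hfin
    exact hfin rfl
  have hae := ae_lt_top (measurable_timeDensity hh) hI
  refine hpow (a := 3 / 4) (by norm_num) ?_
  rw [← lintegral_zero (μ := (volume : Measure ℝ))]
  refine tendsto_lintegral_of_dominated_convergence (timeDensity ω h)
    (fun n => measurable_timeDensity (hg n)) (fun n => Filter.Eventually.of_forall fun t => ?_)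
    hI ?_
  · unfold timeDensity
    dsimp only
    gcongr
    exact sliceNorm_mono (hgh n t) _
  filter_upwards [hae] with t ht
  refine hpow (a := 4 / 3) (by norm_num) ?_
  have ht' : ∫⁻ r, sliceNorm ω (h t) r ≠ ∞ := fun h' => by
    rw [timeDensity, h', ENNReal.top_rpow_of_pos (by norm_num)] at ht
    exact lt_irrefl _ ht
  have hms : ∀ {k : ℝ → R3 → ℝ≥0∞} (_ : Measurable (Function.uncurry k)),
      Measurable (sliceNorm ω (k t)) := fun hk =>
    (measurable_sliceNorm hk).comp (measurable_prodMk_left (x := t))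
  rw [← lintegral_zero (μ := (volume : Measure ℝ))]
  refine tendsto_lintegral_of_dominated_convergence (sliceNorm ω (h t)) (fun n => hms (hg n))
    (fun n => Filter.Eventually.of_forall fun r => sliceNorm_mono (hgh n t) r) ht' ?_
  filter_upwards [ae_lt_top (hms hh) ht'] with r hr
  refine hpow (a := 1 / 2) (by norm_num) ?_
  have hr' : ∫⁻ y : Plane ω, h t (dirCoord ω (r, y)) ^ 2 ≠ ∞ := fun h' => by
    rw [sliceNorm, h', ENNReal.top_rpow_of_pos (by norm_num)] at hr
    exact lt_irrefl _ hr
  rw [← lintegral_zero (μ := (volume : Measure (Plane ω)))]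
  refine tendsto_lintegral_of_dominated_convergence (fun y => h t (dirCoord ω (r, y)) ^ 2)
    (fun n => ?_) (fun n => Filter.Eventually.of_forall fun y => ?_) hr'
    (Filter.Eventually.of_forall fun y => ?_)
  · exact ((hg n).comp (measurable_prodMk_left (x := t)) |>.comp
      ((dirCoord ω).measurable.comp measurable_prodMk_left)).pow_const 2
  · dsimp only
    gcongr
    exact hgh n t _
  · simpa using ENNReal.Tendsto.pow (n := 2) (hlim t (dirCoord ω (r, y)))

open Classical in
/-- The restriction of `F` to the points where the time, the position and the value are at
most `n`. -/
noncomputable def truncation (F : ℝ → R3 → ℂ) (n : ℕ) (t : ℝ) (x : R3) : ℂ :=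
  if |t| ≤ n ∧ ‖x‖ ≤ n ∧ ‖F t x‖ ≤ n then F t x else 0

section truncation

variable {F : ℝ → R3 → ℂ}

lemma isTestSource_truncation (hF : Measurable (Function.uncurry F)) (n : ℕ) :
    IsTestSource (truncation F n) := by
  refine ⟨?_, ⟨n, fun t x => ?_⟩, ⟨n, fun t x h => ?_⟩⟩
  · refine Measurable.ite ?_ hF measurable_const
    exact (measurableSet_le measurable_fst.abs measurable_const).inter
      ((measurableSet_le measurable_snd.norm measurable_const).inter
        (measurableSet_le hF.norm measurable_const))
  · unfold truncation
    split_ifs with h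
    · exact h.2.2
    · simp
  · unfold truncation at h
    split_ifs at h with h'
    · exact ⟨h'.1, h'.2.1⟩
    · exact absurd rfl h

lemma norm_truncation_le (F : ℝ → R3 → ℂ) (n : ℕ) (t : ℝ) (x : R3) :
    ‖truncation F n t x‖ ≤ ‖F t x‖ := by
  unfold truncation
  split_ifs <;> simp

lemma norm_sub_truncation_le (F : ℝ → R3 → ℂ) (n : ℕ) (t : ℝ) (x : R3) :
    ‖F t x - truncation F n t x‖ ≤ ‖F t x‖ := by
  unfold truncation
  split_ifs <;> simp

lemma norm_truncation_sub_le (F : ℝ → R3 → ℂ) {N n m : ℕ} (hn : N ≤ n) (hm : N ≤ m) (t : ℝ)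
    (x : R3) : ‖truncation F n t x - truncation F m t x‖ ≤ ‖F t x - truncation F N t x‖ := by
  have hn' : (N : ℝ) ≤ n := by exact_mod_cast hn
  have hm' : (N : ℝ) ≤ m := by exact_mod_cast hm
  by_cases h : |t| ≤ N ∧ ‖x‖ ≤ N ∧ ‖F t x‖ ≤ N
  · obtain ⟨h1, h2, h3⟩ := h
    have en : truncation F n t x = F t x := if_pos ⟨h1.trans hn', h2.trans hn', h3.trans hn'⟩
    have em : truncation F m t x = F t x := if_pos ⟨h1.trans hm', h2.trans hm', h3.trans hm'⟩
    simp [en, em]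
  · have eN : truncation F N t x = 0 := if_neg h
    rw [eN, sub_zero]
    unfold truncation
    split_ifs <;> simp

lemma eventually_truncation_eq (F : ℝ → R3 → ℂ) (t : ℝ) (x : R3) :
    ∀ᶠ n in Filter.atTop, truncation F n t x = F t x := by
  obtain ⟨N, hN⟩ := exists_nat_ge (max |t| (max ‖x‖ ‖F t x‖))
  filter_upwards [Filter.eventually_ge_atTop N] with n hn
  have hn' : max |t| (max ‖x‖ ‖F t x‖) ≤ n := hN.trans (by exact_mod_cast hn)
  simp only [max_le_iff] at hn'
  exact if_pos hn'

lemma tendsto_dualNorm_sub_truncation {ω : sphere (0 : R3) 1} (hF : Measurable (Function.uncurry F))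
    (hFt : dualNorm ω (fun t x => ‖F t x‖ₑ) ≠ ∞) :
    Filter.Tendsto (fun n => dualNorm ω fun t x => ‖F t x - truncation F n t x‖ₑ) Filter.atTop
      (nhds 0) := by
  refine tendsto_dualNorm_zero (h := fun t x => ‖F t x‖ₑ)
    (fun n => (hF.sub (isTestSource_truncation hF n).measurable).enorm) hF.enorm
    (fun n t x => enorm_le_iff_norm_le.2 (norm_sub_truncation_le F n t x)) hFt fun t x => ?_
  refine tendsto_const_nhds.congr' ?_
  filter_upwards [eventually_truncation_eq F t x] with n hn
  simp [hn]

lemma dualNorm_truncation_le (F : ℝ → R3 → ℂ) (ω : sphere (0 : R3) 1) (n : ℕ) :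
    dualNorm ω (fun t x => ‖truncation F n t x‖ₑ) ≤ dualNorm ω (fun t x => ‖F t x‖ₑ) :=
  dualNorm_mono fun t x => enorm_le_iff_norm_le.2 (norm_truncation_le F n t x)

end truncation

/-! ### Construction of the retarded integral -/

section construction

variable {F : ℝ → R3 → ℂ} {ω : sphere (0 : R3) 1}

lemma norm_sub_toLp_eq {v : R3 → ℂ} (hv : MemLp v 2 volume) (d : Lp ℂ 2 (volume : Measure R3)) :
    ‖d - hv.toLp v‖ = ((∫⁻ ξ, ‖d ξ - v ξ‖ₑ ^ 2) ^ (1 / 2 : ℝ)).toReal := by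
  rw [Lp.norm_def, ← eLpNorm_two_eq_lintegral (μ := volume)]
  congr 1
  refine eLpNorm_congr_ae ?_
  filter_upwards [Lp.coeFn_sub d (hv.toLp v), hv.coeFn_toLp] with ξ h1 h2
  rw [h1, Pi.sub_apply, h2]

/-- The Fourier transforms of the retarded integrals of the truncations form a Cauchy sequence
in `L²`, at every time. -/
lemma exists_tendsto_retardedSymbol (hF : Measurable (Function.uncurry F))
    (hFt : dualNorm ω (fun t x => ‖F t x‖ₑ) ≠ ∞) (t : ℝ) :
    ∃ V : Lp ℂ 2 (volume : Measure R3), Filter.Tendsto (fun n =>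
      ((isTestSource_truncation hF n).memLp_retardedSymbol t).toLp) Filter.atTop (nhds V) := by
  have hT := isTestSource_truncation hF
  refine cauchySeq_tendsto_of_complete ?_
  rw [EMetric.cauchySeq_iff]
  intro ε hε
  have h4 : Filter.Tendsto (fun n => 4 * dualNorm ω fun t x => ‖F t x - truncation F n t x‖ₑ)
      Filter.atTop (nhds 0) := by
    simpa using ENNReal.Tendsto.const_mul (a := 4) (tendsto_dualNorm_sub_truncation hF hFt)
      (Or.inr (by norm_num))
  obtain ⟨N, hN⟩ := Filter.eventually_atTop.1 (h4.eventually_lt_const hε)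
  refine ⟨N, fun n hn m hm => ?_⟩
  rw [edist_eq_enorm_sub, ← MemLp.toLp_sub, Lp.enorm_toLp, eLpNorm_two_eq_lintegral]
  simp only [Pi.sub_apply, ← IsTestSource.retardedSymbol_sub (hT n) (hT m)]
  refine (((hT n).sub (hT m)).sqrt_lintegral_retardedSymbol_le ω t).trans_lt
    (lt_of_le_of_lt ?_ (hN N le_rfl))
  gcongr
  exact dualNorm_mono fun t x => enorm_le_iff_norm_le.2 (norm_truncation_sub_le F hn hm t x)

/-- The retarded integral of `F`, as the `L²` limit of those of the truncations. -/
lemma exists_retarded_limit (hF : Measurable (Function.uncurry F))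
    (hFt : dualNorm ω (fun t x => ‖F t x‖ₑ) ≠ ∞) :
    ∃ u : ℝ → R3 → ℂ, Measurable (Function.uncurry u) ∧
      (∀ t, eLpNorm (u t) 2 volume ≤ 4 * dualNorm ω fun t x => ‖F t x‖ₑ) ∧
      ∀ (t : ℝ) (f : R3 → ℂ), Integrable f → MemLp f 2 → Filter.Tendsto
        (fun n => ∫ ξ, retardedSymbol (truncation F n) t ξ * 𝓕 f (-ξ)) Filter.atTop
        (nhds (∫ x, u t x * f x)) := by
  have hT := isTestSource_truncation hF
  set v : ℕ → ℝ → Lp ℂ 2 (volume : Measure R3) := fun n t =>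
    ((hT n).memLp_retardedSymbol t).toLp with hv
  choose V hV using exists_tendsto_retardedSymbol (ω := ω) hF hFt
  have hVv : ∀ t, Filter.Tendsto (fun n => v n t) Filter.atTop (nhds (V t)) := hV
  have hmeas : ∀ d : Lp ℂ 2 (volume : Measure R3), Measurable fun t => ‖d - V t‖ := by
    intro d
    refine measurable_of_tendsto_metrizable (f := fun n t => ‖d - v n t‖) (fun n => ?_)
      (tendsto_pi_nhds.2 fun t => (tendsto_const_nhds.sub (hVv t)).norm)
    simp only [hv, norm_sub_toLp_eq]
    have h1 : Measurable fun p : ℝ × R3 => ‖d p.2 - retardedSymbol (truncation F n) p.1 p.2‖ₑ ^ 2 :=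
      ((((Lp.stronglyMeasurable d).measurable.comp measurable_snd).sub
        (hT n).measurable_retardedSymbol).enorm).pow_const 2
    exact (h1.lintegral_prod_right'.pow_const _).ennreal_toReal
  have hnorm : ∀ t, ‖V t‖ₑ ≤ 4 * dualNorm ω fun t x => ‖F t x‖ₑ := by
    intro t
    refine le_of_tendsto (hVv t).enorm (Filter.Eventually.of_forall fun n => ?_)
    simp only [hv]
    rw [Lp.enorm_toLp, eLpNorm_two_eq_lintegral]
    refine ((hT n).sqrt_lintegral_retardedSymbol_le ω t).trans ?_
    gcongr
    exact dualNorm_truncation_le F ω n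
  have hiso : ∀ W : Lp ℂ 2 (volume : Measure R3), ‖𝓕⁻ W‖ = ‖W‖ := fun W => by
    rw [← Lp.norm_fourier_eq, FourierTransform.fourier_fourierInv_eq]
  have hmeas' : ∀ d : Lp ℂ 2 (volume : Measure R3), Measurable fun t => ‖d - 𝓕⁻ (V t)‖ := by
    intro d
    have e : (fun t => ‖d - 𝓕⁻ (V t)‖) = fun t => ‖𝓕 d - V t‖ := by
      ext t
      rw [← hiso (𝓕 d - V t), sub_eq_add_neg (𝓕 d), FourierTransform.fourierInv_add,
        FourierTransform.fourierInv_neg, FourierTransform.fourierInv_fourier_eq, ← sub_eq_add_neg]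
    rw [e]
    exact hmeas _
  have : Fact ((2 : ℝ≥0∞) ≠ ∞) := ⟨by norm_num⟩
  obtain ⟨u, hu, hut⟩ := exists_jointly_measurable_rep (fun t => 𝓕⁻ (V t)) hmeas'
  refine ⟨u, hu.measurable, fun t => ?_, fun t f h1 h2 => ?_⟩
  · rw [eLpNorm_congr_ae (hut t), ← Lp.enorm_def]
    refine le_trans (le_of_eq ?_) (hnorm t)
    rw [enorm_eq_iff_norm_eq, hiso]
  · have e : ∫ x, u t x * f x = ∫ ξ, V t ξ * 𝓕 f (-ξ) := by
      rw [← integral_fourierInv_mul _ h1 h2]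
      refine integral_congr_ae ?_
      filter_upwards [hut t] with x hx
      rw [hx]
    have hg : MemLp (fun ξ => (starRingEnd ℂ) (𝓕 f (-ξ))) 2 (volume : Measure R3) :=
      ((memLp_fourier h1 h2).comp_measurePreserving
        (Measure.measurePreserving_neg (volume : Measure R3))).star
    have epair : ∀ {w : R3 → ℂ} {W : Lp ℂ 2 (volume : Measure R3)} (_ : W =ᵐ[volume] w),
        ∫ ξ, w ξ * 𝓕 f (-ξ) = inner ℂ (hg.toLp _) W := by
      intro w W hw
      rw [L2.inner_def]
      refine integral_congr_ae ?_
      filter_upwards [hw, hg.coeFn_toLp] with ξ h3 h4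
      rw [h3, h4, RCLike.inner_apply, Complex.conj_conj]
    rw [e, epair (W := V t) Filter.EventuallyEq.rfl]
    refine (Filter.Tendsto.inner tendsto_const_nhds (hVv t)).congr fun n => ?_
    exact (epair (MemLp.coeFn_toLp _)).symm

end construction

/-! ### The Strichartz bound and the weak formula for the retarded integral -/

section limits

variable {F u : ℝ → R3 → ℂ} {ω₁ : sphere (0 : R3) 1}

/-- The bound for the retarded form passes to the limit of the truncations. -/
lemma strichartzNorm_retarded_le (hF : Measurable (Function.uncurry F))
    (hFt : dualNorm ω₁ (fun t x => ‖F t x‖ₑ) ≠ ∞) (hu : Measurable (Function.uncurry u))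
    (hu2 : ∀ t, eLpNorm (u t) 2 volume ≤ 4 * dualNorm ω₁ fun t x => ‖F t x‖ₑ)
    (hlim : ∀ (t : ℝ) (f : R3 → ℂ), Integrable f → MemLp f 2 → Filter.Tendsto
        (fun n => ∫ ξ, retardedSymbol (truncation F n) t ξ * 𝓕 f (-ξ)) Filter.atTop
        (nhds (∫ x, u t x * f x))) (ω₂ : sphere (0 : R3) 1) :
    strichartzNorm ω₂ (fun t x => ‖u t x‖ₑ) ≤ 64 * dualNorm ω₁ fun t x => ‖F t x‖ₑ := by
  have hT := isTestSource_truncation hF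
  set D := dualNorm ω₁ fun t x => ‖F t x‖ₑ with hD
  have h4D : 4 * D ≠ ∞ := ENNReal.mul_ne_top (by norm_num) hFt
  refine strichartzNorm_le_of_pairing hu (fun t h => ?_) (fun G hG => ?_) fun G hG => ?_
  · have h1 := hu2 t
    rw [eLpNorm_two_eq_lintegral, h, ENNReal.top_rpow_of_pos (by norm_num), top_le_iff] at h1
    exact h4D h1
  · refine ⟨(hu.mul hG.measurable).aestronglyMeasurable, ?_⟩
    rw [hasFiniteIntegral_iff_enorm]
    have e := lintegral_prod (μ := (volume : Measure ℝ)) (ν := (volume : Measure R3))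
      (fun p : ℝ × R3 => ‖u p.1 p.2 * G p.1 p.2‖ₑ) (hu.mul hG.measurable).enorm.aemeasurable
    refine lt_of_le_of_lt (le_of_eq e) ?_
    obtain ⟨M, hM⟩ := hG.exists_bound_L2
    obtain ⟨T, hT⟩ := hG.support
    have hb : ∀ t, ∫⁻ x, ‖u t x * G t x‖ₑ ≤ (Icc (-T) T).indicator (fun _ => 4 * D * M) t := by
      intro t
      by_cases ht : t ∈ Icc (-T) T
      · rw [indicator_of_mem ht]
        have h1 := lintegral_enorm_conj_mul_le (μ := volume)
          (Complex.continuous_conj.measurable.comp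
            (hu.comp (measurable_prodMk_left (x := t)))).aemeasurable
          (hG.measurable_slice t).aemeasurable
        simp only [Function.comp, Function.uncurry, Complex.conj_conj, RCLike.enorm_conj] at h1
        refine h1.trans ?_
        gcongr
        · rw [← eLpNorm_two_eq_lintegral]
          exact hu2 t
        · exact hM t
      · have h0 : ∀ x, G t x = 0 := fun x => by
          by_contra h
          exact ht (abs_le.1 (hT t x h).1)
        simp [h0]
    refine (lintegral_mono hb).trans_lt ?_
    rw [lintegral_indicator measurableSet_Icc, setLIntegral_const]
    exact ENNReal.mul_lt_top (ENNReal.mul_lt_top h4D.lt_top ENNReal.coe_lt_top) (by simp)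
  have hGc := hG.conj
  obtain ⟨M, hM⟩ := hGc.exists_profile_bound_L2
  obtain ⟨T, -, hTG⟩ := hGc.exists_profile_support
  set a : ℕ → ℝ → ℂ := fun n t =>
    ∫ ξ, (starRingEnd ℂ) (profile (fun t x => (starRingEnd ℂ) (G t x)) t ξ)
      * ∫ s in Iio t, profile (truncation F n) s ξ with ha
  have e1 : ∀ n t, ∫ ξ, retardedSymbol (truncation F n) t ξ * 𝓕 (G t) (-ξ) = a n t := by
    intro n t
    refine integral_congr_ae (Filter.Eventually.of_forall fun ξ => ?_)
    dsimp only
    rw [conj_profile_conj, retardedSymbol]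
    ring
  have hba : ∀ n t, ‖a n t‖ₑ ≤ (Icc (-T) T).indicator (fun _ => M * (4 * D)) t := by
    intro n t
    by_cases ht : t ∈ Icc (-T) T
    · rw [indicator_of_mem ht]
      refine (enorm_integral_conj_mul_le
        (hGc.measurable_profile.comp (measurable_prodMk_left (x := t))).aemeasurable
        ((measurable_integral_Iio (hT n).measurable_profile).comp
          (measurable_prodMk_left (x := t))).aemeasurable).trans ?_
      refine mul_le_mul' (hM t) (le_trans (le_of_eq ?_)
        (((hT n).sqrt_lintegral_retardedSymbol_le ω₁ t).trans
          (mul_le_mul_right (dualNorm_truncation_le F ω₁ n) 4)))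
      simp only [enorm_retardedSymbol, Function.comp]
    · have h0 : ∀ ξ, profile (fun t x => (starRingEnd ℂ) (G t x)) t ξ = 0 := fun ξ => by
        refine hTG t ξ ?_
        by_contra h
        exact ht (abs_le.1 (not_le.1 h).le)
      simp [ha, h0]
  have hMD : (M : ℝ≥0∞) * (4 * D) ≠ ∞ := ENNReal.mul_ne_top ENNReal.coe_ne_top h4D
  have hlim' : Filter.Tendsto (fun n => ∫ t, a n t) Filter.atTop
      (nhds (∫ t, ∫ x, u t x * G t x)) := by
    refine tendsto_integral_of_dominated_convergence
      ((Icc (-T) T).indicator fun _ => ((M : ℝ≥0∞) * (4 * D)).toReal) (fun n => ?_) ?_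
      (fun n => Filter.Eventually.of_forall fun t => ?_) (Filter.Eventually.of_forall fun t => ?_)
    · have h1 : Measurable fun p : ℝ × R3 =>
          (starRingEnd ℂ) (profile (fun t x => (starRingEnd ℂ) (G t x)) p.1 p.2)
            * ∫ s in Iio p.1, profile (truncation F n) s p.2 :=
        (Complex.continuous_conj.measurable.comp hGc.measurable_profile).mul
          (measurable_integral_Iio (hT n).measurable_profile)
      exact h1.stronglyMeasurable.integral_prod_right'.aestronglyMeasurable
    · exact (integrable_indicator_iff measurableSet_Icc).2 (integrableOn_const (by simp))
    · have h1 := hba n t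
      rw [← toReal_enorm]
      by_cases ht : t ∈ Icc (-T) T
      · rw [indicator_of_mem ht] at h1 ⊢
        exact ENNReal.toReal_mono hMD h1
      · rw [indicator_of_notMem ht] at h1 ⊢
        simpa using h1
    · refine (hlim t (G t) (hG.integrable_slice t) (hG.memLp t 2)).congr fun n => e1 n t
  refine le_of_tendsto hlim'.enorm (Filter.Eventually.of_forall fun n => ?_)
  have hDn := dualNorm_truncation_le F ω₁ n
  refine ((hT n).enorm_retarded_pairing_le hGc ω₁ ω₂ (ne_top_of_le_ne_top hFt hDn)
    (hGc.dualNorm_ne_top ω₂)).trans ?_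
  simp only [RCLike.enorm_conj]
  gcongr

/-- The weak Duhamel formula passes to the limit of the truncations. -/
lemma isRetardedDuhamel_of_tendsto (hF : Measurable (Function.uncurry F))
    (hFt : dualNorm ω₁ (fun t x => ‖F t x‖ₑ) ≠ ∞) (hu : Measurable (Function.uncurry u))
    (hu2 : ∀ t, eLpNorm (u t) 2 volume ≤ 4 * dualNorm ω₁ fun t x => ‖F t x‖ₑ)
    (hlim : ∀ (t : ℝ) (f : R3 → ℂ), Integrable f → MemLp f 2 → Filter.Tendsto
        (fun n => ∫ ξ, retardedSymbol (truncation F n) t ξ * 𝓕 f (-ξ)) Filter.atTop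
        (nhds (∫ x, u t x * f x))) :
    IsRetardedDuhamel F u := by
  have hT := isTestSource_truncation hF
  refine Filter.Eventually.of_forall fun t φ => ?_
  have hφ2 : MemLp (φ : R3 → ℂ) 2 := φ.memLp 2 volume
  have hut : MemLp (u t) 2 :=
    ⟨(hu.comp (measurable_prodMk_left (x := t))).aestronglyMeasurable,
      (hu2 t).trans_lt (ENNReal.mul_lt_top (by norm_num) hFt.lt_top)⟩
  have hfs := integrable_source_mul_freeSchrodinger hF hFt φ t
  have hfs' : Integrable (fun p : ℝ × R3 => F p.1 p.2 * freeSchrodinger (t - p.1) φ p.2)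
      ((volume.restrict (Iio t)).prod volume) := by
    have h := hfs.integrableOn (s := Iio t ×ˢ univ)
    rwa [IntegrableOn, ← Measure.prod_restrict, Measure.restrict_univ] at h
  refine ⟨hfs.prod_right_ae.mono fun s hs _ => hs, hfs'.integral_prod_left,
    hut.integrable_mul hφ2, ?_⟩
  refine tendsto_nhds_unique (hlim t φ φ.integrable hφ2) ?_
  have hms : Measurable fun p : ℝ × R3 => freeSchrodinger (t - p.1) φ p.2 :=
    measurable_reflected (E := fun t => freeSchrodinger t φ) (measurable_freeSchrodinger φ) t
  have hle : ∀ n (p : ℝ × R3), ‖truncation F n p.1 p.2 * freeSchrodinger (t - p.1) φ p.2‖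
      ≤ ‖F p.1 p.2 * freeSchrodinger (t - p.1) φ p.2‖ := fun n p => by
    rw [norm_mul, norm_mul]
    gcongr
    exact norm_truncation_le F n _ _
  have hmn : ∀ n, AEStronglyMeasurable
      (fun p : ℝ × R3 => truncation F n p.1 p.2 * freeSchrodinger (t - p.1) φ p.2)
      ((volume.restrict (Iio t)).prod volume) := fun n =>
    ((hT n).measurable.mul hms).aestronglyMeasurable
  have hin : ∀ n, Integrable
      (fun p : ℝ × R3 => truncation F n p.1 p.2 * freeSchrodinger (t - p.1) φ p.2)
      ((volume.restrict (Iio t)).prod volume) := fun n =>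
    hfs'.mono (hmn n) (Filter.Eventually.of_forall (hle n))
  have e1 : ∀ n, ∫ ξ, retardedSymbol (truncation F n) t ξ * 𝓕 (φ : R3 → ℂ) (-ξ)
      = ∫ p, truncation F n p.1 p.2 * freeSchrodinger (t - p.1) φ p.2
        ∂((volume.restrict (Iio t)).prod volume) := fun n => by
    rw [(hT n).integral_retardedSymbol_mul φ t, integral_prod _ (hin n)]
  have e2 : ∫ s in Iio t, ∫ x, F s x * freeSchrodinger (t - s) φ x
      = ∫ p, F p.1 p.2 * freeSchrodinger (t - p.1) φ p.2
        ∂((volume.restrict (Iio t)).prod volume) := (integral_prod _ hfs').symm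
  simp_rw [e1]
  rw [e2]
  refine tendsto_integral_of_dominated_convergence _ hmn hfs'.norm
    (fun n => Filter.Eventually.of_forall (hle n)) (Filter.Eventually.of_forall fun p => ?_)
  refine tendsto_const_nhds.congr' ?_
  filter_upwards [eventually_truncation_eq F p.1 p.2] with n hn
  rw [hn]

end limits

/-! ### Mixed norms of complex-valued functions -/

lemma directionalNorm_dual_eq (ω : sphere (0 : R3) 1) (F : ℝ → R3 → ℂ) :
    directionalNorm (4 / 3) 1 ω F = dualNorm ω fun t x => ‖F t x‖ₑ := by
  have e : ((4 / 3 : ℝ≥0∞)).toReal = 4 / 3 := by simp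
  unfold directionalNorm dualNorm
  rw [eLpNorm_eq_lintegral_rpow_enorm_toReal (by simp) (by simp [ENNReal.div_eq_top]), e]
  simp only [eLpNorm_one_eq_lintegral_enorm, enorm_eq_self, eLpNorm_two_eq_lintegral, sliceNorm,
    dirCoord_apply]
  norm_num

lemma directionalNorm_strichartz_eq (ω : sphere (0 : R3) 1) (u : ℝ → R3 → ℂ) :
    directionalNorm 4 ∞ ω u = strichartzNorm ω fun t x => ‖u t x‖ₑ := by
  unfold directionalNorm strichartzNorm
  rw [eLpNorm_eq_lintegral_rpow_enorm_toReal (by simp) (by simp)]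
  simp only [eLpNorm_exponent_top, eLpNormEssSup, enorm_eq_self, eLpNorm_two_eq_lintegral]
  simp only [ENNReal.toReal_ofNat]
  congr! 5 with t r

/-- The mixed norm does not see null sets of space-time. -/
lemma directionalNorm_congr_ae {q p : ℝ≥0∞} {ω : sphere (0 : R3) 1} {F F' : ℝ → R3 → ℂ}
    (h : Function.uncurry F =ᵐ[(volume : Measure (ℝ × R3))] Function.uncurry F') :
    directionalNorm q p ω F = directionalNorm q p ω F' := by
  have h1 : ∀ᵐ t : ℝ, ∀ᵐ x : R3, F t x = F' t x := by
    rw [Measure.volume_eq_prod] at h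
    exact Measure.ae_ae_of_ae_prod h
  refine eLpNorm_congr_ae ?_
  filter_upwards [h1] with t ht
  have h2 := (measurePreserving_dirCoord ω).quasiMeasurePreserving.ae ht
  refine eLpNorm_congr_ae ?_
  filter_upwards [Measure.ae_ae_of_ae_prod h2] with r hr
  refine eLpNorm_congr_ae ?_
  filter_upwards [hr] with y hy
  simpa [dirCoord_apply] using hy

lemma IsRetardedDuhamel.congr_ae {F F' u : ℝ → R3 → ℂ} (hu : IsRetardedDuhamel F' u)
    (h : Function.uncurry F =ᵐ[(volume : Measure (ℝ × R3))] Function.uncurry F') :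
    IsRetardedDuhamel F u := by
  have h1 : ∀ᵐ s : ℝ, F s =ᵐ[volume] F' s := by
    rw [Measure.volume_eq_prod] at h
    exact Measure.ae_ae_of_ae_prod h
  refine hu.mono fun t ht φ => ?_
  obtain ⟨i1, i2, i3, i4⟩ := ht φ
  have e : ∀ {s : ℝ} (_ : F s =ᵐ[volume] F' s),
      (fun x => F s x * freeSchrodinger (t - s) φ x)
        =ᵐ[volume] fun x => F' s x * freeSchrodinger (t - s) φ x := fun hs => by
    filter_upwards [hs] with x hx
    rw [hx]
  have e' : (fun s => ∫ x, F s x * freeSchrodinger (t - s) φ x)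
      =ᵐ[volume.restrict (Iio t)] fun s => ∫ x, F' s x * freeSchrodinger (t - s) φ x := by
    filter_upwards [ae_restrict_of_ae h1] with s hs
    exact integral_congr_ae (e hs)
  refine ⟨?_, i2.congr e'.symm, i3, i4.trans (integral_congr_ae e').symm⟩
  filter_upwards [h1, i1] with s hs his hst
  exact (his hst).congr (e hs).symm

theorem mainTheorem3 :
    ∃ C : ℝ≥0, ∀ (ω₁ ω₂ : sphere (0 : R3) 1) (F : ℝ → R3 → ℂ),
      MemDirectional (4 / 3) 1 ω₁ F →
      ∃ u : ℝ → R3 → ℂ,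
        IsRetardedDuhamel F u ∧ MemDirectional 4 ∞ ω₂ u ∧
        directionalNorm 4 ∞ ω₂ u ≤ C * directionalNorm (4 / 3) 1 ω₁ F := by
  refine ⟨64, fun ω₁ ω₂ F hF => ?_⟩
  obtain ⟨hFm, hFt⟩ := hF
  -- the norms and the weak formula do not change when `F` is replaced by a measurable function
  have hF' : Measurable (Function.uncurry (Function.curry (hFm.mk _))) :=
    hFm.stronglyMeasurable_mk.measurable
  have hae : Function.uncurry F =ᵐ[(volume : Measure (ℝ × R3))]
      Function.uncurry (Function.curry (hFm.mk _)) := hFm.ae_eq_mk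
  generalize Function.curry (hFm.mk _) = F' at hF' hae
  rw [directionalNorm_congr_ae hae, directionalNorm_dual_eq] at hFt ⊢
  obtain ⟨u, hu, hu2, hlim⟩ := exists_retarded_limit hF' hFt.ne
  have hle : directionalNorm 4 ∞ ω₂ u ≤ (64 : ℝ≥0) * dualNorm ω₁ fun t x => ‖F' t x‖ₑ := by
    rw [directionalNorm_strichartz_eq]
    exact strichartzNorm_retarded_le hF' hFt.ne hu hu2 hlim ω₂
  exact ⟨u, (isRetardedDuhamel_of_tendsto hF' hFt.ne hu hu2 hlim).congr_ae hae,
    ⟨hu.aestronglyMeasurable, hle.trans_lt (ENNReal.mul_lt_top ENNReal.coe_lt_top hFt)⟩, hle⟩
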